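/- Let $\omega=e^{2i\pi/3}$ and let $G_{25}\subset \mathrm{GL}_3(\mathbb{C})$ be the group generated by the three reflections of order $3$ $$R_1=\begin{pmatrix}1&0&0\\0&1&0\\0&0&\omega^2\end{pmatrix},\quad R_2=\frac{\omega^2-\omega}{3}\begin{pmatrix}\omega&\omega^2&\omega^2\\ \omega^2&\omega&\omega^2\\ \omega^2&\omega^2&\omega\end{pmatrix},\quad R_3=\begin{pmatrix}1&0&0\\0&\omega^2&0\\0&0&1\end{pmatrix}.$$ It acts on the set $\mathbb{P}^2(\mathbb{C})$ of complex lines of $\mathbb{C}^3$. A *reflection plane* of $G_{25}$ is a plane of $\mathbb{C}^3$ fixed pointwise by a nontrivial element of $G_{25}$; a vector is *regular* if it lies on no reflection plane; a *proper plane* is an eigenspace $\ker(g-\zeta)$, with $g\in G_{25}$ and $\zeta\in\mathbb{C}^*$ of order $6$, that contains a regular vector. Every orbit of lines under $G_{25}$ is of exactly one of the following eight types, where the columns give the size of the orbit, the number of orbits of that type, and the numbers of reflection planes and of proper planes on which each line of the orbit lies. | Size | Number of orbits | Reflection planes | Proper planes | |---|---|---|---| | 216 | generic | 0 | 0 | |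 72 | 1 | 0 | 0 | | 108 | infinite, of dimension 1 | 0 | 1 | | 54 | 1 | 0 | 1 | | 72 | infinite, of dimension 1 | 1 | 0 | | 36 | 1 | 1 | 1 | | 12 | 1 | 2 | 3 | | 9 | 1 | 4 | 0 | Here $\mathbb{P}^2(\mathbb{C})/G_{25}$ carries the quotient of the Zariski topology; "generic" means that the orbits of this type form a dense open subset of $\mathbb{P}^2(\mathbb{C})/G_{25}$, and "infinite, of dimension 1" that they form an infinite subset whose Krull dimension (in the induced topology) is $1$. Moreover, - for every $\nu\in\mathbb{C}^*$ of order $9$, the line $[\nu:\nu^2:1]$ represents the only orbit of size $72$ whose lines lie on no reflection plane; - the line $[(1+\sqrt3)\,\omega^2:\omega:1]$ represents the only orbit of size $54$; - for two lines, neither of which lies in the orbit of $[\nu:\nu^2:1]$ ($\nu$ of order $9$) or of $[(1+\sqrt3)\,\omega^2:\omega:1]$, the orbits have the same size if and only if the two lines lie on the same number of reflection planes and on the same number of proper planes. -/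

import Mathlib

open scoped LinearAlgebra.Projectivization MatrixGroups

noncomputable section

namespace Hessian

/-- The cube root of unity `ω = exp(2πi/3)`. -/
def ω : ℂ := Complex.exp (2 * Real.pi * Complex.I / 3)

theorem omega_pow_three : ω ^ 3 = 1 := by
  rw [ω, ← Complex.exp_nat_mul, Complex.exp_eq_one_iff]
  exact ⟨1, by push_cast; ring⟩

theorem omega_sq : ω ^ 2 = -1 - ω := by
  have h1 : ω ≠ 1 := by
    rw [ω, Ne, Complex.exp_eq_one_iff]
    rintro ⟨n, hn⟩
    have h3 : (3 * n : ℂ) = 1 := by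
      have := Complex.two_pi_I_ne_zero
      field_simp at hn
      linear_combination -hn
    have h4 : 3 * n = 1 := by exact_mod_cast h3
    omega
  have h : (ω - 1) * (ω ^ 2 + ω + 1) = 0 := by linear_combination omega_pow_three
  rcases mul_eq_zero.mp h with h | h
  · exact absurd (sub_eq_zero.mp h) h1
  · linear_combination h

/-- The matrix of the generator `R₁`. -/
def M₁ : Matrix (Fin 3) (Fin 3) ℂ := !![1, 0, 0; 0, 1, 0; 0, 0, ω ^ 2]

/-- The matrix of the generator `R₂`. -/
def M₂ : Matrix (Fin 3) (Fin 3) ℂ :=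
  ((ω ^ 2 - ω) / 3) • !![ω, ω ^ 2, ω ^ 2; ω ^ 2, ω, ω ^ 2; ω ^ 2, ω ^ 2, ω]

/-- The matrix of the generator `R₃`. -/
def M₃ : Matrix (Fin 3) (Fin 3) ℂ := !![1, 0, 0; 0, ω ^ 2, 0; 0, 0, 1]

theorem M₁_pow_three : M₁ ^ 3 = 1 := by
  have h : ω ^ 2 * ω ^ 2 * ω ^ 2 = 1 := by
    linear_combination (ω ^ 3 + 1) * omega_pow_three
  ext i j
  fin_cases i <;> fin_cases j <;>
    simp [M₁, pow_succ, Matrix.mul_apply, Fin.sum_univ_three]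
  linear_combination h

theorem M₃_pow_three : M₃ ^ 3 = 1 := by
  have h : ω ^ 2 * ω ^ 2 * ω ^ 2 = 1 := by
    linear_combination (ω ^ 3 + 1) * omega_pow_three
  ext i j
  fin_cases i <;> fin_cases j <;>
    simp [M₃, pow_succ, Matrix.mul_apply, Fin.sum_univ_three]
  linear_combination h

theorem M₂_pow_three : M₂ ^ 3 = 1 := by
  have key : M₂ =
      (1 / 3 : ℂ) • !![ω + 2, ω - 1, ω - 1; ω - 1, ω + 2, ω - 1; ω - 1, ω - 1, ω + 2] := by
    ext i j
    fin_cases i <;> fin_cases j <;> simp [M₂] <;> grind [omega_sq]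
  rw [key]
  ext i j
  fin_cases i <;> fin_cases j <;>
    simp [pow_succ, Matrix.mul_apply, Fin.sum_univ_three] <;> grind [omega_sq]

/-- The reflection `R₁` as an element of `GL₃(ℂ)`. -/
def R₁ : GL (Fin 3) ℂ := Units.ofPowEqOne M₁ 3 M₁_pow_three (by norm_num)

/-- The reflection `R₂` as an element of `GL₃(ℂ)`. -/
def R₂ : GL (Fin 3) ℂ := Units.ofPowEqOne M₂ 3 M₂_pow_three (by norm_num)

/-- The reflection `R₃` as an element of `GL₃(ℂ)`. -/
def R₃ : GL (Fin 3) ℂ := Units.ofPowEqOne M₃ 3 M₃_pow_three (by norm_num)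

/-- The group `G₂₅`, generated by the three reflections `R₁`, `R₂`, `R₃`. -/
def G25 : Subgroup (GL (Fin 3) ℂ) := Subgroup.closure {R₁, R₂, R₃}

/-- A point of `ℙ²(ℂ)`, that is, a complex line (through the origin) of `ℂ³`. The group `GL₃(ℂ)`,
hence also `G25`, acts on these lines through `g • v = g *ᵥ v`. -/
abbrev Line : Type := ℙ ℂ (Fin 3 → ℂ)

/-- The line `[a : b : 1]`. -/
def line (a b : ℂ) : Line :=
  Projectivization.mk ℂ ![a, b, 1] (fun h => one_ne_zero (congrFun h 2))

/-- `P` is a reflection plane of `G25`: a plane that is fixed pointwise by a nontrivial element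
of the group (such an element is a complex reflection). -/
def IsReflectionPlane (P : Submodule ℂ (Fin 3 → ℂ)) : Prop :=
  Module.finrank ℂ P = 2 ∧ ∃ g ∈ G25, g ≠ 1 ∧ ∀ v ∈ P, g • v = v

/-- A regular vector lies on no reflection plane. -/
def IsRegularVector (v : Fin 3 → ℂ) : Prop :=
  ∀ P : Submodule ℂ (Fin 3 → ℂ), IsReflectionPlane P → v ∉ P

/-- The eigenspace `V(g, ζ)`. -/
def eigenspace (g : GL (Fin 3) ℂ) (ζ : ℂ) : Submodule ℂ (Fin 3 → ℂ) :=
  Module.End.eigenspace (Matrix.toLin' (g : Matrix (Fin 3) (Fin 3) ℂ)) ζ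

/-- `E` is a proper plane: a regular eigenspace (one that contains a regular vector) of an element
of `G25` for an eigenvalue of order `6`. -/
def IsProperPlane (E : Submodule ℂ (Fin 3 → ℂ)) : Prop :=
  ∃ g ∈ G25, ∃ ζ : ℂ, orderOf ζ = 6 ∧ E = eigenspace g ζ ∧ ∃ v ∈ E, IsRegularVector v

/-- The number of reflection planes on which the line `L` lies. -/
def numReflectionPlanes (L : Line) : ℕ∞ :=
  {P : Submodule ℂ (Fin 3 → ℂ) | IsReflectionPlane P ∧ L.submodule ≤ P}.encard

/-- The number of proper planes on which the line `L` lies. -/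
def numProperPlanes (L : Line) : ℕ∞ :=
  {E : Submodule ℂ (Fin 3 → ℂ) | IsProperPlane E ∧ L.submodule ≤ E}.encard

/-- The Zariski topology on `ℙ²(ℂ)`, generated by the complements of the zero loci of homogeneous
polynomials. -/
instance zariskiTopology : TopologicalSpace Line :=
  TopologicalSpace.generateFrom
    {U | ∃ (d : ℕ) (F : MvPolynomial (Fin 3) ℂ), F.IsHomogeneous d ∧
      U = {L : Line | ∃ v ∈ L.submodule, MvPolynomial.eval v F ≠ 0}}

/-- The set of orbits of `G25` on lines, that is `ℙ²(ℂ) / G25`. It carries the quotient of the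
Zariski topology. -/
abbrev LineOrbit : Type := MulAction.orbitRel.Quotient G25 Line

/-- The orbit of the line `L`, as a point of `ℙ²(ℂ) / G25`. -/
def orbitOf (L : Line) : LineOrbit := Quotient.mk'' L

/-- The orbits of `n` lines, each of which lies on exactly `r` reflection planes and exactly `p`
proper planes. -/
def orbitsOfType (n r p : ℕ∞) : Set LineOrbit :=
  {O | O.orbit.encard = n ∧
    ∀ L ∈ O.orbit, numReflectionPlanes L = r ∧ numProperPlanes L = p}

/-- A set of orbits that is infinite of dimension one: Krull dimension with respect to
the topology induced from `ℙ²(ℂ) / G25`. -/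
def IsInfiniteOfDimOne (S : Set LineOrbit) : Prop :=
  S.Infinite ∧ topologicalKrullDim S = 1

/-- A set of orbits that consists of the generic ones: a dense Zariski open subset of
`ℙ²(ℂ) / G25`. -/
def IsGeneric (S : Set LineOrbit) : Prop :=
  IsOpen S ∧ Dense S

end Hessian

end

noncomputable section

namespace Hessian

open Matrix Equiv

/-! The group is finite and completely explicit. Its elements are the monomial matrices `mono σ d`
(signed permutations times cube roots of unity) and the rescaled Fourier matrices `had η r c`,
obtained from the 3×3 Fourier matrix `F = had ω 1 1` by diagonal factors and exchange of the two
primitive cube roots. That this set is stable under the generators comes down to a Gauss sum: for a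
diagonal `D` of cube roots of unity, `F D F` is again monomial or Fourier (`fourier_mul_had`).
Conversely all these matrices lie in `G25`, and counting labels gives 648 elements
(`isMono_or_isHad_of_mem`, `indexEquiv`).

A line whose stabilizer consists of scalars has an orbit of 648/3 = 216 lines. Any other line is
fixed by a nonscalar element. If that element is of Fourier type, it is conjugate to a monomial
matrix, or its square is monomial and nonscalar (`exists_conj_isMono`). Hence some line of the orbit
is fixed by a nonscalar monomial matrix, and its eigenvectors can be read off: a diagonal matrix
forces a zero coordinate, a transposition leads further to `[t : 1 : 1]`, a 3-cycle to `[1 : 1 : 1]`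
or `[ν : ν² : 1]`. So the normal forms are `[1 : 0 : 0]`, `[0 : 1 : t]`, `[t : 1 : 1]` and `[ν : ν²
: 1]` (`orbitOf_cases`). Solving the eigenvector equations for each of them gives the stabilizer,
and orbit-stabilizer gives the size.

The reflection planes are the three coordinate planes and nine planes whose coefficients are cube
roots of unity (`isReflectionPlane_iff`). The proper planes through the normal forms are of the form
`w (k + 1) = u * w (k + 2)` with `u ^ 3 = 1` (`numProperPlanes_mk`). Both incidence numbers are
constant on orbits, so they only have to be computed for the normal forms.

The generic orbits are the complement of finitely many fixed loci, which are proper closed subsets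
of an irreducible space. Each one-dimensional row is covered by a polynomially parametrized line
with finite fibres over the quotient, so its proper closed subsets are finite and its dimension is
one (`isInfiniteOfDimOne_of_curve`). -/

/-! ### Cube roots of unity. -/

theorem omega_prim : ω ^ 2 + ω + 1 = 0 := by rw [omega_sq]; ring

theorem prim_pow_three {η : ℂ} (h : η ^ 2 + η + 1 = 0) : η ^ 3 = 1 := by
  linear_combination (η - 1) * h

theorem prim_sub_sq_sq {η : ℂ} (h : η ^ 2 + η + 1 = 0) : (η - η ^ 2) ^ 2 = -3 := by
  linear_combination (η ^ 2 - 3 * η + 3) * h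

theorem prim_sub_ne_zero {η : ℂ} (h : η ^ 2 + η + 1 = 0) : η - η ^ 2 ≠ 0 := by
  intro h0
  have := prim_sub_sq_sq h
  rw [h0] at this
  norm_num at this

theorem prim_ne_one {η : ℂ} (h : η ^ 2 + η + 1 = 0) : η ≠ 1 := by
  rintro rfl
  norm_num at h

theorem prim_inv_sub {η : ℂ} (h : η ^ 2 + η + 1 = 0) : (η - η ^ 2)⁻¹ = -(2 * η + 1) / 3 := by
  refine inv_eq_of_mul_eq_one_right ?_
  linear_combination (2 * η / 3 - 1) * h

theorem eq_of_cube_eq_one {η x : ℂ} (h : η ^ 2 + η + 1 = 0) (hx : x ^ 3 = 1) :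
    x = 1 ∨ x = η ∨ x = η ^ 2 := by
  have : (x - 1) * ((x - η) * (x - η ^ 2)) = 0 := by
    linear_combination hx + (x - x ^ 2 + (η - 1) * (x - 1)) * h
  rcases mul_eq_zero.mp this with h | h
  · exact Or.inl (sub_eq_zero.mp h)
  · rcases mul_eq_zero.mp h with h | h
    · exact Or.inr (Or.inl (sub_eq_zero.mp h))
    · exact Or.inr (Or.inr (sub_eq_zero.mp h))

theorem prim_cases {η : ℂ} (h : η ^ 2 + η + 1 = 0) : η = ω ∨ η = ω ^ 2 := by
  rcases eq_of_cube_eq_one omega_prim (prim_pow_three h) with h1 | h1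
  · exact absurd h1 (prim_ne_one h)
  · exact h1

theorem prim_sq {η : ℂ} (h : η ^ 2 + η + 1 = 0) : (η ^ 2) ^ 2 + η ^ 2 + 1 = 0 := by
  linear_combination (η ^ 2 - η + 1) * h

theorem ne_zero_of_cube {x : ℂ} (hx : x ^ 3 = 1) : x ≠ 0 := by
  rintro rfl
  norm_num at hx

/-! ### Monomial and Fourier matrices, and their products. -/

/-- The monomial matrix `v ↦ (i ↦ sign σ * d i * v (σ i))`. -/
def mono (σ : Perm (Fin 3)) (d : Fin 3 → ℂ) : Matrix (Fin 3) (Fin 3) ℂ :=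
  Matrix.of fun i j => if j = σ i then ((Perm.sign σ : ℤ) : ℂ) * d i else 0

/-- The rescaled Fourier matrix with rows multiplied by `r` and columns multiplied by `c`. -/
def had (η : ℂ) (r c : Fin 3 → ℂ) : Matrix (Fin 3) (Fin 3) ℂ :=
  Matrix.of fun i j => (η - η ^ 2)⁻¹ * (r i * c j * η ^ ((i : ℕ) * (j : ℕ)))

theorem mono_mulVec (σ : Perm (Fin 3)) (d v : Fin 3 → ℂ) (i : Fin 3) :
    (mono σ d *ᵥ v) i = ((Perm.sign σ : ℤ) : ℂ) * d i * v (σ i) := by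
  simp [mono, Matrix.mulVec, dotProduct]

theorem had_mulVec (η : ℂ) (r c v : Fin 3 → ℂ) (i : Fin 3) :
    (had η r c *ᵥ v) i = (η - η ^ 2)⁻¹ * r i *
      (c 0 * v 0 + c 1 * η ^ (i : ℕ) * v 1 + c 2 * η ^ ((i : ℕ) * 2) * v 2) := by
  simp [had, Matrix.mulVec, dotProduct, Fin.sum_univ_three]
  ring

/-- The set of matrices `mono σ d` with `d` consisting of cube roots of unity. -/
def IsMono (A : Matrix (Fin 3) (Fin 3) ℂ) : Prop :=
  ∃ σ d, (∀ i, d i ^ 3 = 1) ∧ A = mono σ d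

/-- The set of matrices `had η r c` with `r`, `c` consisting of cube roots of unity. -/
def IsHad (A : Matrix (Fin 3) (Fin 3) ℂ) : Prop :=
  ∃ η r c, η ^ 2 + η + 1 = 0 ∧ (∀ i, r i ^ 3 = 1) ∧ (∀ i, c i ^ 3 = 1) ∧ r 0 = 1 ∧ A = had η r c

/-- A common scalar can be moved between the row and the column factors. Dividing by `r 0` removes
this freedom, which later makes the labels unique. -/
theorem isHad_had {η : ℂ} {r c : Fin 3 → ℂ} (h : η ^ 2 + η + 1 = 0) (hr : ∀ i, r i ^ 3 = 1)
    (hc : ∀ i, c i ^ 3 = 1) : IsHad (had η r c) := by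
  have h0 := ne_zero_of_cube (hr 0)
  refine ⟨η, fun i => r i / r 0, fun i => r 0 * c i, h, fun i => ?_, fun i => ?_, ?_, ?_⟩
  · rw [div_pow, hr, hr, div_one]
  · rw [mul_pow, hr, hc, mul_one]
  · exact div_self h0
  · ext i j
    simp only [had, Matrix.of_apply]
    field_simp

theorem diagonal_mul_mono (e d : Fin 3 → ℂ) (σ : Perm (Fin 3)) :
    diagonal e * mono σ d = mono σ (fun i => e i * d i) := by
  ext i j
  simp only [Matrix.diagonal_mul, mono, Matrix.of_apply]
  split_ifs <;> ring

theorem mono_mul_diagonal (e d : Fin 3 → ℂ) (σ : Perm (Fin 3)) :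
    mono σ d * diagonal e = mono σ (fun i => d i * e (σ i)) := by
  ext i j
  simp only [Matrix.mul_diagonal, mono, Matrix.of_apply]
  split_ifs with h
  · subst h; ring
  · ring

theorem diagonal_mul_had (e r c : Fin 3 → ℂ) (η : ℂ) :
    diagonal e * had η r c = had η (fun i => e i * r i) c := by
  ext i j
  simp only [Matrix.diagonal_mul, had, Matrix.of_apply]
  ring

theorem had_mul_diagonal (e r c : Fin 3 → ℂ) (η : ℂ) :
    had η r c * diagonal e = had η r (fun i => c i * e i) := by
  ext i j
  simp only [Matrix.mul_diagonal, had, Matrix.of_apply]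
  ring

theorem had_eq_diagonal_mul (r c : Fin 3 → ℂ) (η : ℂ) :
    had η r c = diagonal r * had η 1 1 * diagonal c := by
  rw [diagonal_mul_had, had_mul_diagonal]
  simp

theorem mono_eq_diagonal_mul (d : Fin 3 → ℂ) (σ : Perm (Fin 3)) :
    mono σ d = diagonal d * mono σ 1 := by
  rw [diagonal_mul_mono]
  simp

theorem mono_one_one : mono 1 1 = 1 := by
  ext i j
  simp [mono, Matrix.one_apply, eq_comm]

theorem mono_one (d : Fin 3 → ℂ) : mono 1 d = diagonal d := by
  rw [mono_eq_diagonal_mul, mono_one_one, mul_one]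

theorem mono_mul_mono (σ τ : Perm (Fin 3)) (d e : Fin 3 → ℂ) :
    mono σ d * mono τ e = mono (τ * σ) (fun i => d i * e (σ i)) := by
  ext i j
  simp only [Matrix.mul_apply, mono, Matrix.of_apply, ite_mul, zero_mul, Finset.sum_ite_eq',
    Finset.mem_univ, if_true, Perm.mul_apply, Perm.sign_mul]
  split_ifs
  · push_cast; ring
  · ring

theorem perm_three_cases (σ : Perm (Fin 3)) : σ = 1 ∨ σ = swap 1 2 ∨ σ = swap 0 1 ∨ σ = swap 0 2 ∨
    σ = finRotate 3 ∨ σ = (finRotate 3)⁻¹ := by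
  revert σ
  decide

theorem isMono_diagonal_mul {e : Fin 3 → ℂ} (he : ∀ i, e i ^ 3 = 1)
    {A : Matrix (Fin 3) (Fin 3) ℂ} (hA : IsMono A) : IsMono (diagonal e * A) := by
  obtain ⟨σ, d, hd, rfl⟩ := hA
  exact ⟨σ, _, fun i => by rw [mul_pow, he, hd, mul_one], diagonal_mul_mono e d σ⟩

theorem isMono_mul_diagonal {e : Fin 3 → ℂ} (he : ∀ i, e i ^ 3 = 1)
    {A : Matrix (Fin 3) (Fin 3) ℂ} (hA : IsMono A) : IsMono (A * diagonal e) := by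
  obtain ⟨σ, d, hd, rfl⟩ := hA
  exact ⟨σ, _, fun i => by rw [mul_pow, he, hd, mul_one], mono_mul_diagonal e d σ⟩

theorem isHad_diagonal_mul {e : Fin 3 → ℂ} (he : ∀ i, e i ^ 3 = 1)
    {A : Matrix (Fin 3) (Fin 3) ℂ} (hA : IsHad A) : IsHad (diagonal e * A) := by
  obtain ⟨η, r, c, hη, hr, hc, -, rfl⟩ := hA
  rw [diagonal_mul_had]
  exact isHad_had hη (fun i => by rw [mul_pow, he, hr, mul_one]) hc

theorem isHad_mul_diagonal {e : Fin 3 → ℂ} (he : ∀ i, e i ^ 3 = 1)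
    {A : Matrix (Fin 3) (Fin 3) ℂ} (hA : IsHad A) : IsHad (A * diagonal e) := by
  obtain ⟨η, r, c, hη, hr, hc, -, rfl⟩ := hA
  rw [had_mul_diagonal]
  exact isHad_had hη hr (fun i => by rw [mul_pow, he, hc, mul_one])

theorem mul_mono_apply (A : Matrix (Fin 3) (Fin 3) ℂ) (τ : Perm (Fin 3)) (i j : Fin 3) :
    (A * mono τ 1) i (τ j) = ((Perm.sign τ : ℤ) : ℂ) * A i j := by
  simp only [Matrix.mul_apply, mono, Matrix.of_apply, EmbeddingLike.apply_eq_iff_eq, mul_ite,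
    mul_zero, Finset.sum_ite_eq, Finset.mem_univ, if_true, Pi.one_apply, mul_one]
  ring

theorem mono_mul_apply (A : Matrix (Fin 3) (Fin 3) ℂ) (τ : Perm (Fin 3)) (i j : Fin 3) :
    (mono τ 1 * A) i j = ((Perm.sign τ : ℤ) : ℂ) * A (τ i) j := by
  simp [Matrix.mul_apply, mono]

/-- Exchanging the columns 1 and 2 replaces `η` by `η ^ 2`; the normalizing factor `(η - η ^ 2)⁻¹`
then changes sign, which matches the sign of the transposition. -/
theorem had_mul_mono_swap {η : ℂ} (h : η ^ 2 + η + 1 = 0) (r c : Fin 3 → ℂ) :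
    had η r c * mono (swap 1 2) 1 = had (η ^ 2) r (c ∘ swap 1 2) := by
  have h3 := prim_pow_three h
  have hθ : (η ^ 2 - (η ^ 2) ^ 2)⁻¹ = - (η - η ^ 2)⁻¹ := by
    rw [← inv_neg]
    congr 1
    linear_combination -η * h3
  ext i j
  obtain ⟨j, rfl⟩ := (swap (1 : Fin 3) 2).surjective j
  rw [mul_mono_apply]
  simp only [had, Matrix.of_apply, hθ, Function.comp_apply, swap_apply_self]
  have hj : (η ^ 2) ^ ((i : ℕ) * ((swap (1 : Fin 3) 2 j : Fin 3) : ℕ)) =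
      η ^ ((i : ℕ) * (j : ℕ)) := by
    rw [← pow_mul]
    fin_cases i <;> fin_cases j <;> simp [swap_apply_def]
    · linear_combination η * h3
    · linear_combination (η ^ 5 + η ^ 2) * h3
  rw [hj]
  simp

/-- The Fourier matrix turns a shift into a modulation: replacing `i` by `i + 1` multiplies the
column `j` by `η ^ j`. -/
theorem mono_rotate_mul_had {η : ℂ} (h : η ^ 2 + η + 1 = 0) (r c : Fin 3 → ℂ) :
    mono (finRotate 3) 1 * had η r c =
      had η (r ∘ finRotate 3) (fun j => c j * η ^ (j : ℕ)) := by
  have h3 := prim_pow_three h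
  ext i j
  rw [mono_mul_apply]
  have hs : Perm.sign (finRotate 3) = 1 := by decide
  have hj : η ^ (((finRotate 3 i : Fin 3) : ℕ) * (j : ℕ)) =
      η ^ (j : ℕ) * η ^ ((i : ℕ) * (j : ℕ)) := by
    fin_cases i <;> fin_cases j <;> simp
    · ring
    · ring
    · linear_combination - h3
    · linear_combination - (η ^ 3 + 1) * h3
  simp only [had, Matrix.of_apply, hs, Function.comp_apply, hj]
  push_cast
  ring

theorem had_mul_mono_rotate {η : ℂ} (h : η ^ 2 + η + 1 = 0) (r c : Fin 3 → ℂ) :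
    had η r c * mono (finRotate 3) 1 =
      had η (fun i => r i * η ^ (2 * (i : ℕ))) (c ∘ (finRotate 3).symm) := by
  have h3 := prim_pow_three h
  ext i j
  obtain ⟨j, rfl⟩ := (finRotate 3).surjective j
  rw [mul_mono_apply]
  have hs : Perm.sign (finRotate 3) = 1 := by decide
  have hj : η ^ (2 * (i : ℕ)) * η ^ ((i : ℕ) * ((finRotate 3 j : Fin 3) : ℕ)) =
      η ^ ((i : ℕ) * (j : ℕ)) := by
    rw [← pow_add]
    fin_cases i <;> fin_cases j <;> simp
    · exact h3
    · linear_combination η * h3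
    · linear_combination (η ^ 3 + 1) * h3
    · linear_combination (η ^ 5 + η ^ 2) * h3
  simp only [had, Matrix.of_apply, hs, Function.comp_apply, Equiv.symm_apply_apply]
  push_cast
  linear_combination - (η - η ^ 2)⁻¹ * (r i * c j) * hj

theorem isHad_mul_mono_swap {A : Matrix (Fin 3) (Fin 3) ℂ} (hA : IsHad A) :
    IsHad (A * mono (swap 1 2) 1) := by
  obtain ⟨η, r, c, hη, hr, hc, -, rfl⟩ := hA
  rw [had_mul_mono_swap hη]
  exact isHad_had (prim_sq hη) hr fun i => hc _

theorem isHad_mul_mono_rotate {A : Matrix (Fin 3) (Fin 3) ℂ} (hA : IsHad A) :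
    IsHad (A * mono (finRotate 3) 1) := by
  obtain ⟨η, r, c, hη, hr, hc, -, rfl⟩ := hA
  rw [had_mul_mono_rotate hη]
  refine isHad_had hη (fun i => ?_) fun i => hc _
  rw [mul_pow, hr, ← pow_mul, mul_comm _ 3, pow_mul, prim_pow_three hη, one_pow, mul_one]

theorem isHad_mono_rotate_mul {A : Matrix (Fin 3) (Fin 3) ℂ} (hA : IsHad A) :
    IsHad (mono (finRotate 3) 1 * A) := by
  obtain ⟨η, r, c, hη, hr, hc, -, rfl⟩ := hA
  rw [mono_rotate_mul_had hη]
  refine isHad_had hη (fun i => hr _) fun i => ?_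
  rw [mul_pow, hc, ← pow_mul, mul_comm _ 3, pow_mul, prim_pow_three hη, one_pow, mul_one]

theorem mono_one_mul_mono_one (σ τ : Perm (Fin 3)) : mono σ 1 * mono τ 1 = mono (τ * σ) 1 := by
  rw [mono_mul_mono]
  congr 1
  ext i
  simp

/-- A property of matrices that is preserved by right multiplication with two monomial matrices
that generate all signed permutation matrices is preserved by all of them. -/
theorem mul_mono_one_induction {p : Matrix (Fin 3) (Fin 3) ℂ → Prop}
    (h₁ : ∀ A, p A → p (A * mono (swap 1 2) 1)) (h₂ : ∀ A, p A → p (A * mono (finRotate 3) 1))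
    {A : Matrix (Fin 3) (Fin 3) ℂ} (hA : p A) (σ : Perm (Fin 3)) : p (A * mono σ 1) := by
  have key : ∀ σ : Perm (Fin 3), σ = 1 ∨ σ = swap 1 2 ∨ σ = finRotate 3 ∨
    σ = finRotate 3 * finRotate 3 ∨ σ = finRotate 3 * swap 1 2 ∨
    σ = finRotate 3 * (finRotate 3 * swap 1 2) := by decide
  rcases key σ with rfl | rfl | rfl | rfl | rfl | rfl
  · rwa [mono_one_one, mul_one]
  · exact h₁ _ hA
  · exact h₂ _ hA
  · rw [← mono_one_mul_mono_one, ← mul_assoc]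
    exact h₂ _ (h₂ _ hA)
  · rw [← mono_one_mul_mono_one, ← mul_assoc]
    exact h₂ _ (h₁ _ hA)
  · rw [← mono_one_mul_mono_one, ← mono_one_mul_mono_one, ← mul_assoc, ← mul_assoc]
    exact h₂ _ (h₂ _ (h₁ _ hA))

theorem isHad_mul_isMono {A B : Matrix (Fin 3) (Fin 3) ℂ} (hA : IsHad A) (hB : IsMono B) :
    IsHad (A * B) := by
  obtain ⟨σ, d, hd, rfl⟩ := hB
  rw [mono_eq_diagonal_mul, ← mul_assoc]
  exact mul_mono_one_induction (fun _ => isHad_mul_mono_swap) (fun _ => isHad_mul_mono_rotate)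
    (isHad_mul_diagonal hd hA) σ

theorem isMono_mul {A B : Matrix (Fin 3) (Fin 3) ℂ} (hA : IsMono A) (hB : IsMono B) :
    IsMono (A * B) := by
  obtain ⟨σ, d, hd, rfl⟩ := hA
  obtain ⟨τ, e, he, rfl⟩ := hB
  exact ⟨τ * σ, _, fun i => by rw [mul_pow, hd, he, mul_one], mono_mul_mono σ τ d e⟩

/-- The sum is the Fourier transform, at `i + j`, of the middle diagonal `c k * r' k`; the factor
`-(1 / 3)` is the inverse of `(η - η ^ 2) ^ 2 = -3`. -/
theorem had_mul_had_apply {η : ℂ} (h : η ^ 2 + η + 1 = 0) (r c r' c' : Fin 3 → ℂ) (i j : Fin 3) :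
    (had η r c * had η r' c') i j = -(1 / 3) * (r i * c' j) * (c 0 * r' 0 +
      c 1 * r' 1 * η ^ ((i : ℕ) + j) + c 2 * r' 2 * η ^ (2 * ((i : ℕ) + j))) := by
  have hθ : (η - η ^ 2)⁻¹ * (η - η ^ 2)⁻¹ = -(1 / 3) := by
    rw [← mul_inv, ← sq, prim_sub_sq_sq h]
    norm_num
  simp only [Matrix.mul_apply, had, Matrix.of_apply, Fin.sum_univ_three]
  rw [← hθ]
  simp
  ring

/-- By orthogonality of characters only the entries with `i + j = 0` modulo 3 survive, and they
equal `-1`. This is the sign that `mono` carries. -/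
theorem fourier_mul_self {η : ℂ} (h : η ^ 2 + η + 1 = 0) :
    had η 1 1 * had η 1 1 = mono (swap 1 2) 1 := by
  have h3 := prim_pow_three h
  ext i j
  rw [had_mul_had_apply h]
  fin_cases i <;> fin_cases j <;> simp [mono, swap_apply_def]
  all_goals grind

/-- A Gauss sum: the inner sum is `1 + 2 * ζ` if `i + j = 0` modulo 3 and `1 - ζ` otherwise. Since
`1 + 2 * ζ = ζ * (1 - ζ)`, the entries differ only by cube roots of unity. -/
theorem fourier_mul_diagonal_mul {η ζ : ℂ} (h : η ^ 2 + η + 1 = 0) (hζ : ζ ^ 2 + ζ + 1 = 0) :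
    had η 1 1 * diagonal ![1, ζ, ζ] * had η 1 1 = had ζ ![1, ζ ^ 2, ζ ^ 2] ![1, ζ ^ 2, ζ ^ 2] := by
  ext i j
  rw [had_mul_diagonal, had_mul_had_apply h, had, prim_inv_sub hζ]
  rcases eq_of_cube_eq_one h (prim_pow_three hζ) with rfl | rfl | rfl
  · norm_num at hζ
  all_goals
    fin_cases i <;> fin_cases j <;> simp
    all_goals grind

theorem fourier_mul_diagonal_rotate {η : ℂ} (h : η ^ 2 + η + 1 = 0) :
    had η 1 1 * diagonal ![1, η, η ^ 2] = mono (finRotate 3) 1 * had η 1 1 := by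
  rw [had_mul_diagonal, mono_rotate_mul_had h]
  congr 1
  ext j
  fin_cases j <;> simp

theorem omega_sq_pow_three : (ω ^ 2) ^ 3 = 1 := by
  rw [← pow_mul, mul_comm, pow_mul, omega_pow_three, one_pow]

theorem M₁_eq_diagonal : M₁ = diagonal ![1, 1, ω ^ 2] := by
  ext i j
  fin_cases i <;> fin_cases j <;> simp [M₁]

theorem M₃_eq_diagonal : M₃ = diagonal ![1, ω ^ 2, 1] := by
  ext i j
  fin_cases i <;> fin_cases j <;> simp [M₃]

theorem M₂_eq_had : M₂ = had ω ![1, ω, ω] ![ω, ω ^ 2, ω ^ 2] := by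
  have h := omega_prim
  ext i j
  fin_cases i <;> fin_cases j <;> simp [M₂, had, prim_inv_sub h] <;> grind

theorem isHad_mono_mul_of_rotate {A : Matrix (Fin 3) (Fin 3) ℂ} (hA : IsHad A) {x η : ℂ}
    (hη : η ^ 2 + η + 1 = 0) (hx : x ^ 3 = 1) :
    ∃ σ : Perm (Fin 3), had η 1 1 * diagonal ![1, x, x ^ 2] = mono σ 1 * had η 1 1 ∧
      IsHad (mono σ 1 * A) := by
  have hη3 := prim_pow_three hη
  rcases eq_of_cube_eq_one hη hx with rfl | rfl | rfl
  · refine ⟨1, ?_, ?_⟩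
    · have : diagonal ![(1 : ℂ), 1, 1 ^ 2] = 1 := by
        rw [← diagonal_one]
        congr 1
        ext i
        fin_cases i <;> simp
      rw [this, mono_one_one, one_mul, mul_one]
    · rwa [mono_one_one, one_mul]
  · exact ⟨_, fourier_mul_diagonal_rotate hη, isHad_mono_rotate_mul hA⟩
  · refine ⟨finRotate 3 * finRotate 3, ?_, ?_⟩
    · have : diagonal ![1, η ^ 2, (η ^ 2) ^ 2] =
          diagonal ![1, η, η ^ 2] * diagonal ![1, η, η ^ 2] := by
        rw [diagonal_mul_diagonal]
        congr 1
        ext i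
        fin_cases i <;> simp <;> ring
      rw [this, ← mul_assoc, fourier_mul_diagonal_rotate hη, mul_assoc,
        fourier_mul_diagonal_rotate hη, ← mul_assoc, mono_one_mul_mono_one]
    · rw [← mono_one_mul_mono_one, mul_assoc]
      exact isHad_mono_rotate_mul (isHad_mono_rotate_mul hA)

/-- The diagonal `r` factors into a modulation `![1, x, x ^ 2]`, which passes through the Fourier
matrix as a cyclic permutation, and `![1, ζ, ζ]`, for which either the square of the Fourier matrix
(`ζ = 1`) or the Gauss sum is available. -/
theorem fourier_mul_had {η : ℂ} (hη : η ^ 2 + η + 1 = 0) {r c : Fin 3 → ℂ}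
    (hr : ∀ i, r i ^ 3 = 1) (hc : ∀ i, c i ^ 3 = 1) (hr0 : r 0 = 1) :
    IsMono (had η 1 1 * had η r c) ∨ IsHad (had η 1 1 * had η r c) := by
  -- These solve `x * ζ = r 1` and `x ^ 2 * ζ = r 2`: `x = r 2 / r 1` and `ζ = r 1 ^ 2 / r 2`, with
  -- inverses written as squares.
  set x := r 2 * r 1 ^ 2
  set ζ := r 1 ^ 2 * r 2 ^ 2 with hζ
  have h1 := hr 1
  have h2 := hr 2
  have hx : x ^ 3 = 1 := by
    linear_combination (r 1 ^ 3 + 1) * r 2 ^ 3 * h1 + h2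
  have hζ3 : ζ ^ 3 = 1 := by
    rw [hζ]
    linear_combination (r 1 ^ 3 + 1) * r 2 ^ 6 * h1 + (r 2 ^ 3 + 1) * h2
  have hdiag : diagonal r = diagonal ![1, x, x ^ 2] * diagonal ![1, ζ, ζ] := by
    rw [diagonal_mul_diagonal]
    congr 1
    ext i
    fin_cases i
    · simpa using hr0
    · simp only [x, ζ, Fin.mk_one, cons_val_one, cons_val_zero]
      linear_combination - r 1 * r 2 ^ 3 * h1 - r 1 * h2
    · simp only [x, ζ, Fin.reduceFinMk, cons_val]
      linear_combination - r 2 * (r 1 ^ 3 + 1) * r 2 ^ 3 * h1 - r 2 * h2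
  have hI : IsHad (had η 1 1) := isHad_had hη (by simp) (by simp)
  rw [had_eq_diagonal_mul r c, hdiag]
  have hre : had η 1 1 * (diagonal ![1, x, x ^ 2] * diagonal ![1, ζ, ζ] * had η 1 1 * diagonal c) =
      had η 1 1 * diagonal ![1, x, x ^ 2] * diagonal ![1, ζ, ζ] * had η 1 1 * diagonal c := by
    simp only [mul_assoc]
  rw [hre]
  by_cases hζ1 : ζ = 1
  · left
    have : diagonal ![(1 : ℂ), ζ, ζ] = 1 := by
      rw [← diagonal_one]
      congr 1
      ext i
      fin_cases i <;> simp [hζ1]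
    obtain ⟨σ, hσ, -⟩ := isHad_mono_mul_of_rotate hI hη hx
    rw [this, mul_one, hσ, mul_assoc (mono σ 1), fourier_mul_self hη]
    exact isMono_mul_diagonal hc (isMono_mul ⟨_, _, by simp, rfl⟩ ⟨_, _, by simp, rfl⟩)
  · right
    have hp : ζ ^ 2 + ζ + 1 = 0 := by
      have : (ζ - 1) * (ζ ^ 2 + ζ + 1) = 0 := by linear_combination hζ3
      exact (mul_eq_zero.mp this).resolve_left (sub_ne_zero.mpr hζ1)
    have hv : ∀ i : Fin 3, ![1, ζ ^ 2, ζ ^ 2] i ^ 3 = 1 := by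
      intro i
      fin_cases i <;> simp <;> linear_combination (ζ ^ 3 + 1) * hζ3
    obtain ⟨σ, hσ, hA⟩ := isHad_mono_mul_of_rotate (isHad_had hp hv hv) hη hx
    have : mono σ 1 * had η 1 1 * diagonal ![1, ζ, ζ] * had η 1 1 =
        mono σ 1 * (had η 1 1 * diagonal ![1, ζ, ζ] * had η 1 1) := by simp only [mul_assoc]
    rw [hσ, this, fourier_mul_diagonal_mul hη hp]
    exact isHad_mul_diagonal hc hA

theorem fourier_mul_isHad {A : Matrix (Fin 3) (Fin 3) ℂ} (hA : IsHad A) :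
    IsMono (had ω 1 1 * A) ∨ IsHad (had ω 1 1 * A) := by
  obtain ⟨η, r, c, hη, hr, hc, hr0, rfl⟩ := hA
  rcases prim_cases hη with rfl | rfl
  · exact fourier_mul_had hη hr hc hr0
  · have : had (ω ^ 2) r c = had ω r (c ∘ swap 1 2) * mono (swap 1 2) 1 := by
      rw [had_mul_mono_swap omega_prim]
      congr 1
      ext i
      simp
    rw [this, ← mul_assoc]
    rcases fourier_mul_had omega_prim hr (c := c ∘ swap 1 2) (fun i => hc _) hr0 with h | h
    · exact Or.inl (isMono_mul h ⟨_, _, by simp, rfl⟩)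
    · exact Or.inr (isHad_mul_mono_swap h)

theorem diagonal_mul_mem {A : Matrix (Fin 3) (Fin 3) ℂ} (hA : IsMono A ∨ IsHad A) {e : Fin 3 → ℂ}
    (he : ∀ i, e i ^ 3 = 1) : IsMono (diagonal e * A) ∨ IsHad (diagonal e * A) :=
  hA.imp (isMono_diagonal_mul he) (isHad_diagonal_mul he)

theorem M₂_mul_mem {A : Matrix (Fin 3) (Fin 3) ℂ} (hA : IsMono A ∨ IsHad A) :
    IsMono (M₂ * A) ∨ IsHad (M₂ * A) := by
  rw [M₂_eq_had, had_eq_diagonal_mul, mul_assoc, mul_assoc]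
  refine diagonal_mul_mem ?_ ?_
  · have h := diagonal_mul_mem hA (e := ![ω, ω ^ 2, ω ^ 2]) fun i => by
      fin_cases i <;> simp [omega_pow_three, omega_sq_pow_three]
    rcases h with h | h
    · exact Or.inr (isHad_mul_isMono (isHad_had omega_prim (by simp) (by simp)) h)
    · exact fourier_mul_isHad h
  · intro i
    fin_cases i <;> simp [omega_pow_three]

theorem coe_R₁ : (R₁ : Matrix (Fin 3) (Fin 3) ℂ) = M₁ := rfl
theorem coe_R₃ : (R₃ : Matrix (Fin 3) (Fin 3) ℂ) = M₃ := rfl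

theorem inv_eq_mul_self_of_mem {x : GL (Fin 3) ℂ} (hx : x ∈ ({R₁, R₂, R₃} : Set (GL (Fin 3) ℂ))) :
    x⁻¹ = x * x := by
  have h : x ^ 3 = 1 := by
    apply Units.ext
    rw [Units.val_pow_eq_pow_val]
    rcases hx with rfl | rfl | rfl
    · exact M₁_pow_three
    · exact M₂_pow_three
    · exact M₃_pow_three
  rw [inv_eq_iff_mul_eq_one, ← h, pow_succ, pow_two, mul_assoc]

/-- The elements of `G25` are monomial matrices or rescaled Fourier matrices. -/
theorem isMono_or_isHad_of_mem {g : GL (Fin 3) ℂ} (hg : g ∈ G25) :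
    IsMono (g : Matrix (Fin 3) (Fin 3) ℂ) ∨ IsHad (g : Matrix (Fin 3) (Fin 3) ℂ) := by
  have step : ∀ x ∈ ({R₁, R₂, R₃} : Set (GL (Fin 3) ℂ)), ∀ y : GL (Fin 3) ℂ,
      (IsMono (y : Matrix (Fin 3) (Fin 3) ℂ) ∨ IsHad (y : Matrix (Fin 3) (Fin 3) ℂ)) →
      IsMono ((x * y : GL (Fin 3) ℂ) : Matrix (Fin 3) (Fin 3) ℂ) ∨
        IsHad ((x * y : GL (Fin 3) ℂ) : Matrix (Fin 3) (Fin 3) ℂ) := by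
    rintro x (rfl | rfl | rfl) y hy
    · rw [Units.val_mul, coe_R₁, M₁_eq_diagonal]
      refine diagonal_mul_mem hy fun i => ?_
      fin_cases i <;> simp [omega_sq_pow_three]
    · exact M₂_mul_mem hy
    · rw [Units.val_mul, coe_R₃, M₃_eq_diagonal]
      refine diagonal_mul_mem hy fun i => ?_
      fin_cases i <;> simp [omega_sq_pow_three]
  induction hg using Subgroup.closure_induction_left with
  | one => exact Or.inl ⟨1, 1, by simp, by rw [mono_one_one]; rfl⟩
  | mul_left x hx y _ ih => exact step x hx y ih
  | inv_mul_cancel x hx y _ ih =>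
    -- The generators have order three, so multiplying by an inverse is multiplying twice.
    rw [inv_eq_mul_self_of_mem hx, mul_assoc]
    exact step x hx _ (step x hx y ih)

/-! ### All these matrices belong to the group. -/

/-- `A` is the matrix of an element of `G25`. -/
def InG25 (A : Matrix (Fin 3) (Fin 3) ℂ) : Prop := ∃ g ∈ G25, (g : Matrix (Fin 3) (Fin 3) ℂ) = A

theorem InG25.mul {A B : Matrix (Fin 3) (Fin 3) ℂ} (hA : InG25 A) (hB : InG25 B) :
    InG25 (A * B) := by
  obtain ⟨g, hg, rfl⟩ := hA
  obtain ⟨h, hh, rfl⟩ := hB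
  exact ⟨g * h, mul_mem hg hh, rfl⟩

theorem InG25.one : InG25 1 := ⟨1, one_mem _, rfl⟩

theorem InG25.pow {A : Matrix (Fin 3) (Fin 3) ℂ} (hA : InG25 A) (n : ℕ) : InG25 (A ^ n) := by
  obtain ⟨g, hg, rfl⟩ := hA
  exact ⟨g ^ n, pow_mem hg n, rfl⟩

theorem inG25_M₁ : InG25 (diagonal ![1, 1, ω ^ 2]) :=
  ⟨R₁, Subgroup.subset_closure (by simp), M₁_eq_diagonal⟩

theorem inG25_M₃ : InG25 (diagonal ![1, ω ^ 2, 1]) :=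
  ⟨R₃, Subgroup.subset_closure (by simp), M₃_eq_diagonal⟩

theorem inG25_M₂ : InG25 (had ω ![1, ω, ω] ![ω, ω ^ 2, ω ^ 2]) :=
  ⟨R₂, Subgroup.subset_closure (by simp), M₂_eq_had⟩

/-- Multiplying `R₂` on both sides by `R₁ R₃` makes its row factors trivial and all its column
factors equal to `ω`. -/
theorem inG25_smul_fourier : InG25 (had ω 1 (fun _ => ω)) := by
  have h := ((inG25_M₁.mul inG25_M₃).mul inG25_M₂).mul (inG25_M₁.mul inG25_M₃)
  rw [diagonal_mul_diagonal, diagonal_mul_had, had_mul_diagonal] at h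
  convert h using 1
  congr 1
  · ext i
    fin_cases i <;> simp [← pow_succ, omega_pow_three]
  · ext i
    have := omega_pow_three
    fin_cases i <;> simp <;> linear_combination -ω * this

theorem fourier_pow_four : had ω 1 1 ^ 4 = 1 := by
  have : had ω 1 1 ^ 4 = (had ω 1 1 * had ω 1 1) * (had ω 1 1 * had ω 1 1) := by
    simp only [pow_succ, pow_zero, one_mul, mul_assoc]
  rw [this, fourier_mul_self omega_prim, mono_one_mul_mono_one, Equiv.swap_mul_self, mono_one_one]

/-- The Fourier matrix has fourth power 1, so the fourth power of its multiple by `ω` is the scalar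
`ω ^ 4 = ω`. This separates the scalar from the Fourier matrix. -/
theorem inG25_scalar : InG25 (diagonal fun _ => ω) := by
  have h := inG25_smul_fourier.pow 4
  have h1 : had ω 1 (fun _ => ω) = ω • had ω 1 1 := by
    ext i j
    simp [had]
    ring
  rw [h1, smul_pow, fourier_pow_four] at h
  convert h using 1
  ext i j
  simp only [Matrix.diagonal_apply, Matrix.smul_apply, Matrix.one_apply, smul_eq_mul, mul_ite,
    mul_one, mul_zero]
  congr 1
  linear_combination -ω * omega_pow_three

theorem inG25_diagonal {d : Fin 3 → ℂ} (hd : ∀ i, d i ^ 3 = 1) : InG25 (diagonal d) := by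
  have h0 : InG25 (diagonal ![ω ^ 2, 1, 1]) := by
    -- The scalar `ω ^ 2` times the square of `diagonal ![1, ω ^ 2, ω ^ 2]` leaves `ω ^ 2` in the
    -- first place only.
    have h := (inG25_scalar.pow 2).mul ((inG25_M₁.mul inG25_M₃).pow 2)
    rw [diagonal_mul_diagonal, diagonal_pow, diagonal_pow, diagonal_mul_diagonal] at h
    convert h using 1
    congr 1
    ext i
    fin_cases i <;> simp
    all_goals linear_combination - (ω ^ 3 + 1) * omega_pow_three
  have key : ∀ x : ℂ, x ^ 3 = 1 → ∃ n : ℕ, x = (ω ^ 2) ^ n := by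
    intro x hx
    rcases eq_of_cube_eq_one omega_prim hx with rfl | rfl | rfl
    · exact ⟨0, by simp⟩
    · exact ⟨2, by linear_combination - ω * omega_pow_three⟩
    · exact ⟨1, by simp⟩
  obtain ⟨a, ha⟩ := key _ (hd 0)
  obtain ⟨b, hb⟩ := key _ (hd 1)
  obtain ⟨c, hc⟩ := key _ (hd 2)
  have h := ((h0.pow a).mul (inG25_M₃.pow b)).mul (inG25_M₁.pow c)
  rw [diagonal_pow, diagonal_pow, diagonal_pow, diagonal_mul_diagonal, diagonal_mul_diagonal] at h
  convert h using 1
  congr 1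
  ext i
  fin_cases i <;> simp [ha, hb, hc]

theorem inG25_fourier : InG25 (had ω 1 1) := by
  have h := inG25_smul_fourier.mul (inG25_diagonal (d := fun _ => ω ^ 2)
    fun _ => omega_sq_pow_three)
  rw [had_mul_diagonal] at h
  convert h using 2
  ext i
  simp [← pow_succ', omega_pow_three]

theorem inG25_mono_one (σ : Perm (Fin 3)) : InG25 (mono σ 1) := by
  rw [← one_mul (mono σ 1)]
  refine mul_mono_one_induction (fun A hA => hA.mul ?_) (fun A hA => hA.mul ?_) InG25.one σ
  · rw [← fourier_mul_self omega_prim]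
    exact inG25_fourier.mul inG25_fourier
  -- The shift-modulation relation solved for the shift, with the cube of the Fourier matrix as its
  -- inverse.
  · have h : mono (finRotate 3) 1 =
        had ω 1 1 * diagonal ![1, ω, ω ^ 2] * had ω 1 1 ^ 3 := by
      rw [fourier_mul_diagonal_rotate omega_prim, mul_assoc, ← pow_succ', fourier_pow_four, mul_one]
    rw [h]
    refine (inG25_fourier.mul (inG25_diagonal fun i => ?_)).mul (inG25_fourier.pow 3)
    fin_cases i <;> simp [omega_pow_three, omega_sq_pow_three]

theorem inG25_mono (σ : Perm (Fin 3)) {d : Fin 3 → ℂ} (hd : ∀ i, d i ^ 3 = 1) :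
    InG25 (mono σ d) := by
  rw [mono_eq_diagonal_mul]
  exact (inG25_diagonal hd).mul (inG25_mono_one σ)

theorem inG25_had {η : ℂ} (hη : η ^ 2 + η + 1 = 0) {r c : Fin 3 → ℂ}
    (hr : ∀ i, r i ^ 3 = 1) (hc : ∀ i, c i ^ 3 = 1) : InG25 (had η r c) := by
  rw [had_eq_diagonal_mul]
  refine ((inG25_diagonal hr).mul ?_).mul (inG25_diagonal hc)
  rcases prim_cases hη with rfl | rfl
  · exact inG25_fourier
  · have h := inG25_fourier.mul (inG25_mono_one (swap 1 2))
    rw [had_mul_mono_swap omega_prim] at h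
    exact h

/-! ### Unique labels and the order of the group. -/

/-- The cube root of unity `ω ^ e`. -/
def root (e : Fin 3) : ℂ := ω ^ (e : ℕ)

theorem root_pow_three (e : Fin 3) : root e ^ 3 = 1 := by
  rw [root, ← pow_mul, mul_comm, pow_mul, omega_pow_three, one_pow]

theorem root_ne_zero (e : Fin 3) : root e ≠ 0 := ne_zero_of_cube (root_pow_three e)

theorem omega_ne_zero : ω ≠ 0 := ne_zero_of_cube omega_pow_three

theorem root_injective : Function.Injective root := by
  have h : orderOf ω = 3 := orderOf_eq_prime omega_pow_three (prim_ne_one omega_prim)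
  intro a b hab
  have := pow_injOn_Iio_orderOf (x := ω) (by simp [h]) (by simp [h]) hab
  exact Fin.ext this

theorem root_inj {a b : Fin 3} : root a = root b ↔ a = b := root_injective.eq_iff

theorem root_zero : root 0 = 1 := by simp [root]

theorem exists_root_eq {x : ℂ} (hx : x ^ 3 = 1) : ∃ e, root e = x := by
  rcases eq_of_cube_eq_one omega_prim hx with rfl | rfl | rfl
  · exact ⟨0, by simp [root]⟩
  · exact ⟨1, by simp [root]⟩
  · exact ⟨2, by simp [root]⟩

theorem root_add (a b : Fin 3) : root (a + b) = root a * root b := by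
  have h := omega_pow_three
  rw [root, root, root, ← pow_add]
  fin_cases a <;> fin_cases b <;> simp [h]
  linear_combination -ω * h

/-- The two primitive cube roots of unity. -/
def primRoot (b : Bool) : ℂ := if b then ω else ω ^ 2

theorem primRoot_prim (b : Bool) : primRoot b ^ 2 + primRoot b + 1 = 0 := by
  cases b
  · exact prim_sq omega_prim
  · exact omega_prim

theorem primRoot_sub (b : Bool) :
    primRoot b - primRoot b ^ 2 = if b then ω - ω ^ 2 else -(ω - ω ^ 2) := by
  cases b
  · simp [primRoot]
    linear_combination ω * omega_pow_three
  · simp [primRoot]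

/-- Labels for the elements of `G25`. -/
abbrev Index : Type :=
  (Perm (Fin 3) × (Fin 3 → Fin 3)) ⊕ (Bool × Fin 3 × Fin 3 × (Fin 3 → Fin 3))

/-- The matrix of the element of `G25` with a given label. -/
def indexMatrix : Index → Matrix (Fin 3) (Fin 3) ℂ
  | .inl (σ, d) => mono σ (fun i => root (d i))
  | .inr (b, r₁, r₂, c) => had (primRoot b) ![1, root r₁, root r₂] (fun i => root (c i))

theorem vec_root_pow_three (r₁ r₂ : Fin 3) (i : Fin 3) : ![1, root r₁, root r₂] i ^ 3 = 1 := by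
  fin_cases i <;> simp [root_pow_three]

theorem inG25_indexMatrix (j : Index) : InG25 (indexMatrix j) := by
  rcases j with ⟨σ, d⟩ | ⟨b, r₁, r₂, c⟩
  · exact inG25_mono σ fun i => root_pow_three _
  · exact inG25_had (primRoot_prim b) (vec_root_pow_three r₁ r₂) fun i => root_pow_three _

theorem sign_mul_self (σ : Perm (Fin 3)) :
    ((Perm.sign σ : ℤ) : ℂ) * ((Perm.sign σ : ℤ) : ℂ) = 1 := by
  exact_mod_cast Int.units_coe_mul_self (Perm.sign σ)

theorem had_apply_ne_zero {η : ℂ} (hη : η ^ 2 + η + 1 = 0) {r c : Fin 3 → ℂ}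
    (hr : ∀ i, r i ^ 3 = 1) (hc : ∀ i, c i ^ 3 = 1) (i j : Fin 3) : had η r c i j ≠ 0 := by
  simp only [had, Matrix.of_apply]
  exact mul_ne_zero (inv_ne_zero (prim_sub_ne_zero hη)) (mul_ne_zero (mul_ne_zero
    (ne_zero_of_cube (hr i)) (ne_zero_of_cube (hc j)))
    (pow_ne_zero _ (ne_zero_of_cube (prim_pow_three hη))))

theorem mono_ne_had {σ : Perm (Fin 3)} {d : Fin 3 → ℂ} {η : ℂ} (hη : η ^ 2 + η + 1 = 0)
    {r c : Fin 3 → ℂ} (hr : ∀ i, r i ^ 3 = 1) (hc : ∀ i, c i ^ 3 = 1) :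
    mono σ d ≠ had η r c := by
  intro h
  obtain ⟨j, hj⟩ : ∃ j, j ≠ σ 0 := exists_ne _
  have := had_apply_ne_zero hη hr hc 0 j
  rw [← h] at this
  simp [mono, hj] at this

/-- For Fourier matrices, row 0 is `±(ω - ω ^ 2)⁻¹` times cube roots of unity. The sign tells the
two primitive roots apart, because the negative of a cube root of unity is not one; then row 0
yields `c` and column 0 yields `r`. -/
theorem indexMatrix_injective : Function.Injective indexMatrix := by
  rintro (⟨σ, d⟩ | ⟨b, r₁, r₂, c⟩) (⟨σ', d'⟩ | ⟨b', r₁', r₂', c'⟩) h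
  · simp only [indexMatrix] at h
    have hσ : σ = σ' := by
      ext1 i
      have h1 := congrFun (congrFun h i) (σ i)
      by_contra hne
      simp [mono, hne, root_ne_zero] at h1
    subst hσ
    have hd : d = d' := by
      ext1 i
      have h1 := congrFun (congrFun h i) (σ i)
      simpa [mono, sign_ne_zero, root_inj] using h1
    rw [hd]
  · exact absurd h (mono_ne_had (primRoot_prim _) (vec_root_pow_three _ _)
      fun i => root_pow_three _)
  · exact absurd h.symm (mono_ne_had (primRoot_prim _) (vec_root_pow_three _ _)
      fun i => root_pow_three _)
  · simp only [indexMatrix] at h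
    have h0 : ∀ j, (primRoot b - primRoot b ^ 2)⁻¹ * root (c j) =
        (primRoot b' - primRoot b' ^ 2)⁻¹ * root (c' j) := fun j => by
      simpa [had] using congrFun (congrFun h 0) j
    have hθ := prim_sub_ne_zero omega_prim
    have hb : b = b' := by
      by_contra hne
      have h2 : root (c 0) = - root (c' 0) := by
        have h1 := h0 0
        cases b <;> cases b' <;> simp only [primRoot_sub, not_true] at h1 hne ⊢
        all_goals
          simp only [if_true, Bool.false_eq_true, if_false, inv_neg] at h1
          refine mul_left_cancel₀ (inv_ne_zero hθ) ?_
          first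
          | linear_combination h1
          | linear_combination -h1
      have h3 := root_pow_three (c 0)
      rw [h2] at h3
      have h4 := root_pow_three (c' 0)
      have : (1 : ℂ) = -1 := by linear_combination -h3 - h4
      norm_num at this
    subst hb
    have hθb := inv_ne_zero (prim_sub_ne_zero (primRoot_prim b))
    have hc : c = c' := by
      ext1 j
      exact root_injective (mul_left_cancel₀ hθb (h0 j))
    subst hc
    have hc0 := root_ne_zero (c 0)
    have h1 : r₁ = r₁' := by
      have := congrFun (congrFun h 1) 0
      simp only [had, Matrix.of_apply] at this
      have := mul_left_cancel₀ hθb this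
      simpa [hc0, root_inj] using this
    have h2 : r₂ = r₂' := by
      have := congrFun (congrFun h 2) 0
      simp only [had, Matrix.of_apply] at this
      have := mul_left_cancel₀ hθb this
      simpa [hc0, root_inj] using this
    rw [h1, h2]

/-- The element of `G25` with a given label. -/
def ofIndex (j : Index) : G25 :=
  ⟨(inG25_indexMatrix j).choose, (inG25_indexMatrix j).choose_spec.1⟩

theorem coe_ofIndex (j : Index) :
    ((ofIndex j : GL (Fin 3) ℂ) : Matrix (Fin 3) (Fin 3) ℂ) = indexMatrix j :=
  (inG25_indexMatrix j).choose_spec.2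

theorem ofIndex_bijective : Function.Bijective ofIndex := by
  constructor
  · intro a b hab
    apply indexMatrix_injective
    rw [← coe_ofIndex, ← coe_ofIndex, hab]
  · intro g
    have key : ∃ j, indexMatrix j = ((g : GL (Fin 3) ℂ) : Matrix (Fin 3) (Fin 3) ℂ) := by
      rcases isMono_or_isHad_of_mem g.2 with ⟨σ, d, hd, h⟩ | ⟨η, r, c, hη, hr, hc, hr0, h⟩
      · choose e he using fun i => exists_root_eq (hd i)
        refine ⟨.inl (σ, e), ?_⟩
        rw [h, indexMatrix]
        congr 1
        ext i
        exact he i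
      · choose e he using fun i => exists_root_eq (hr i)
        choose f hf using fun i => exists_root_eq (hc i)
        obtain ⟨b, hb⟩ : ∃ b, primRoot b = η := by
          rcases prim_cases hη with rfl | rfl
          · exact ⟨true, rfl⟩
          · exact ⟨false, rfl⟩
        refine ⟨.inr (b, e 1, e 2, f), ?_⟩
        rw [h, indexMatrix, hb]
        congr 1
        · ext i
          fin_cases i <;> simp [hr0, he]
        · ext i
          exact hf i
    obtain ⟨j, hj⟩ := key
    exact ⟨j, Subtype.ext (Units.ext (by rw [coe_ofIndex, hj]))⟩

/-- The elements of `G25` correspond to their labels. -/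
def indexEquiv : Index ≃ G25 := Equiv.ofBijective ofIndex ofIndex_bijective

/-- The count is 6 · 27 monomial and 2 · 9 · 27 Fourier labels. -/
theorem card_index : Fintype.card Index = 648 := by
  simp [Fintype.card_perm, Nat.factorial]

instance : Finite G25 := Finite.of_equiv _ indexEquiv

theorem card_G25 : Nat.card G25 = 648 := by
  rw [← Nat.card_congr indexEquiv, Nat.card_eq_fintype_card, card_index]

/-! ### Stabilizers of the standard lines. -/

theorem smul_mk_eq_mk_iff (g : GL (Fin 3) ℂ) {v w : Fin 3 → ℂ} (hv : v ≠ 0) (hw : w ≠ 0) :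
    g • Projectivization.mk ℂ v hv = Projectivization.mk ℂ w hw ↔
      ∃ a : ℂ, ∀ i, ((g : Matrix (Fin 3) (Fin 3) ℂ) *ᵥ v) i = a * w i := by
  rw [Projectivization.smul_mk, Projectivization.mk_eq_mk_iff']
  constructor
  · rintro ⟨a, ha⟩
    exact ⟨a, fun i => (congrFun ha i).symm⟩
  · rintro ⟨a, ha⟩
    exact ⟨a, funext fun i => (ha i).symm⟩

/-- The size of an orbit, from a description of the stabilizer. -/
theorem encard_orbit_eq {v : Fin 3 → ℂ} (hv : v ≠ 0) {C : Index → Prop} [DecidablePred C]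
    (hC : ∀ j, (∃ a : ℂ, ∀ i, (indexMatrix j *ᵥ v) i = a * v i) ↔ C j) {n m : ℕ}
    (hn : (Finset.univ.filter C).card = n) (hnm : m * n = 648) :
    (MulAction.orbit G25 (Projectivization.mk ℂ v hv)).encard = m := by
  set L := Projectivization.mk ℂ v hv
  have h1 : Nat.card (MulAction.stabilizer G25 L) = n := by
    rw [← hn, ← Fintype.card_subtype, ← Nat.card_eq_fintype_card]
    refine Nat.card_congr (indexEquiv.subtypeEquiv fun j => ?_).symm
    rw [← hC, ← coe_ofIndex, ← smul_mk_eq_mk_iff _ hv hv]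
    rfl
  have h2 := Nat.card_congr (MulAction.orbitProdStabilizerEquivGroup G25 L)
  rw [Nat.card_prod, card_G25, h1, ← hnm] at h2
  have hn0 : 0 < n := Nat.pos_of_ne_zero (by rintro rfl; simp at hnm)
  have h3 := Nat.eq_of_mul_eq_mul_right hn0 h2
  have hfin : (MulAction.orbit G25 L).Finite := Set.finite_range _
  rw [← hfin.cast_ncard_eq, ← h3]
  rfl

/-- The matrix `A` preserves the line spanned by `v`. -/
def Fixes (A : Matrix (Fin 3) (Fin 3) ℂ) (v : Fin 3 → ℂ) : Prop :=
  ∃ a : ℂ, ∀ i, (A *ᵥ v) i = a * v i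

theorem fixes_mono_iff {σ : Perm (Fin 3)} {d v : Fin 3 → ℂ} :
    Fixes (mono σ d) v ↔ ∃ a : ℂ, d 0 * v (σ 0) = a * v 0 ∧ d 1 * v (σ 1) = a * v 1 ∧
      d 2 * v (σ 2) = a * v 2 := by
  have hs := sign_mul_self σ
  have key : Fixes (mono σ d) v ↔ ∃ a : ℂ, ∀ i, d i * v (σ i) = a * v i := by
    constructor
    · rintro ⟨a, ha⟩
      refine ⟨((Perm.sign σ : ℤ) : ℂ) * a, fun i => ?_⟩
      have := ha i
      rw [mono_mulVec] at this
      linear_combination ((Perm.sign σ : ℤ) : ℂ) * this - d i * v (σ i) * hs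
    · rintro ⟨a, ha⟩
      refine ⟨((Perm.sign σ : ℤ) : ℂ) * a, fun i => ?_⟩
      rw [mono_mulVec]
      linear_combination ((Perm.sign σ : ℤ) : ℂ) * ha i
  rw [key]
  simp only [Fin.forall_fin_succ, Fin.forall_fin_zero, and_true]
  rfl

/-- Only the line matters, so the normalizing factor is absorbed into the eigenvalue. -/
theorem fixes_had_iff {η : ℂ} (hη : η ^ 2 + η + 1 = 0) {r c v : Fin 3 → ℂ} :
    Fixes (had η r c) v ↔ ∃ a : ℂ, r 0 * (c 0 * v 0 + c 1 * v 1 + c 2 * v 2) = a * v 0 ∧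
      r 1 * (c 0 * v 0 + c 1 * η * v 1 + c 2 * η ^ 2 * v 2) = a * v 1 ∧
      r 2 * (c 0 * v 0 + c 1 * η ^ 2 * v 1 + c 2 * η * v 2) = a * v 2 := by
  have hθ := prim_sub_ne_zero hη
  have h3 := prim_pow_three hη
  have h0 := had_mulVec η r c v 0
  have h1 := had_mulVec η r c v 1
  have h2 := had_mulVec η r c v 2
  have h4 : η ^ 4 = η := by linear_combination η * h3
  simp [h4] at h0 h1 h2
  generalize η - η ^ 2 = θ at h0 h1 h2 hθ
  constructor
  · rintro ⟨a, ha⟩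
    refine ⟨θ * a, ?_, ?_, ?_⟩
    · have := ha 0; rw [h0] at this; field_simp at this; linear_combination this
    · have := ha 1; rw [h1] at this; field_simp at this; linear_combination this
    · have := ha 2; rw [h2] at this; field_simp at this; linear_combination this
  · rintro ⟨a, ha0, ha1, ha2⟩
    refine ⟨θ⁻¹ * a, fun i => ?_⟩
    fin_cases i
    · exact h0.trans (by rw [mul_assoc, ha0, mul_assoc]; rfl)
    · exact h1.trans (by rw [mul_assoc, ha1, mul_assoc]; rfl)
    · exact h2.trans (by rw [mul_assoc, ha2, mul_assoc]; rfl)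

section Vertex

theorem fixes_mono_vertex {σ : Perm (Fin 3)} {d : Fin 3 → ℂ} (hd : ∀ i, d i ^ 3 = 1) :
    Fixes (mono σ d) ![1, 0, 0] ↔ σ = 1 ∨ σ = swap 1 2 := by
  have h1 := ne_zero_of_cube (hd 1)
  have h2 := ne_zero_of_cube (hd 2)
  rw [fixes_mono_iff]
  rcases perm_three_cases σ with rfl | rfl | rfl | rfl | rfl | rfl <;>
    simp [swap_apply_def, h1, h2] <;> decide

theorem not_fixes_had_vertex {η : ℂ} (hη : η ^ 2 + η + 1 = 0) {r c : Fin 3 → ℂ}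
    (hr : ∀ i, r i ^ 3 = 1) (hc : ∀ i, c i ^ 3 = 1) : ¬ Fixes (had η r c) ![1, 0, 0] := by
  rw [fixes_had_iff hη]
  rintro ⟨a, -, h1, -⟩
  simp [ne_zero_of_cube (hr 1), ne_zero_of_cube (hc 0)] at h1

end Vertex

section CoordinatePlane

/-- The transposition needs `t ^ 2 = d 2 / d 1`, hence `t ^ 6 = 1`; this singles out the exceptional
values of `t`. -/
theorem fixes_mono_coordinatePlane {t : ℂ} (ht : t ≠ 0) {σ : Perm (Fin 3)} {d : Fin 3 → ℂ}
    (hd : ∀ i, d i ^ 3 = 1) :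
    Fixes (mono σ d) ![0, 1, t] ↔ (σ = 1 ∧ d 1 = d 2) ∨ (σ = swap 1 2 ∧ d 1 * t ^ 2 = d 2) := by
  have h0 := ne_zero_of_cube (hd 0)
  have h1 := ne_zero_of_cube (hd 1)
  have h2 := ne_zero_of_cube (hd 2)
  have e1 : (1 : Perm (Fin 3)) ≠ swap 1 2 := by decide
  rw [fixes_mono_iff]
  rcases perm_three_cases σ with rfl | rfl | rfl | rfl | rfl | rfl
  · simp [ht, e1, eq_comm]
  · simp [e1.symm, swap_apply_def]
    rw [sq, ← mul_assoc, eq_comm]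
  all_goals
    refine iff_of_false ?_ ?_
    · rintro ⟨a, ha, -, -⟩
      simp [h0, ht] at ha
    · rintro (⟨h, -⟩ | ⟨h, -⟩) <;> revert h <;> decide

/-- The first coordinate of the image has to vanish, so `-t` is a quotient of two cube roots of
unity. -/
theorem fixes_had_coordinatePlane {t : ℂ} {η : ℂ} (hη : η ^ 2 + η + 1 = 0) {r c : Fin 3 → ℂ}
    (hr : ∀ i, r i ^ 3 = 1) (hc : ∀ i, c i ^ 3 = 1) (h : Fixes (had η r c) ![0, 1, t]) :
    t ^ 3 = -1 := by
  rw [fixes_had_iff hη] at h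
  obtain ⟨a, h, -, -⟩ := h
  simp [ne_zero_of_cube (hr 0)] at h
  have h1 := hc 1
  have h2 : c 1 = - (c 2 * t) := by linear_combination h
  rw [h2] at h1
  linear_combination -h1 - t ^ 3 * hc 2

theorem fixes_had_center {η : ℂ} (hη : η ^ 2 + η + 1 = 0) {r c : Fin 3 → ℂ}
    (hr : ∀ i, r i ^ 3 = 1) (hc : ∀ i, c i ^ 3 = 1) :
    Fixes (had η r c) ![0, 1, -1] ↔ r 1 = r 2 ∧ c 1 = c 2 := by
  have hθ := prim_sub_ne_zero hη
  rw [fixes_had_iff hη]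
  constructor
  · rintro ⟨a, h0, h1, h2⟩
    simp at h0 h1 h2
    have h0 := h0.resolve_left (ne_zero_of_cube (hr 0))
    have hc12 : c 1 = c 2 := by linear_combination h0
    refine ⟨?_, hc12⟩
    rw [hc12] at h1 h2
    have : (r 1 - r 2) * (c 2 * (η - η ^ 2)) = 0 := by linear_combination h1 + h2
    rcases mul_eq_zero.mp this with h | h
    · exact sub_eq_zero.mp h
    · exact absurd h (mul_ne_zero (ne_zero_of_cube (hc 2)) hθ)
  · rintro ⟨h1, h2⟩
    refine ⟨r 2 * c 2 * (η - η ^ 2), ?_, ?_, ?_⟩ <;> simp [h1, h2] <;> ring_nf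

end CoordinatePlane

section ProperPlane

/-- A permutation that moves 0 would make `t` a quotient of cube roots of unity. -/
theorem fixes_mono_properPlane {t : ℂ} (ht1 : t ^ 3 ≠ 1) (ht0 : t ≠ 0) {σ : Perm (Fin 3)}
    {d : Fin 3 → ℂ} (hd : ∀ i, d i ^ 3 = 1) :
    Fixes (mono σ d) ![t, 1, 1] ↔ (σ = 1 ∨ σ = swap 1 2) ∧ d 0 = d 1 ∧ d 1 = d 2 := by
  have e1 : (1 : Perm (Fin 3)) ≠ swap 1 2 := by decide
  have h1 := hd 1
  have h2 := hd 2
  rw [fixes_mono_iff]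
  rcases perm_three_cases σ with rfl | rfl | rfl | rfl | rfl | rfl
  · simp [ht0]
    grind
  · simp [swap_apply_def, ht0]
    grind
  all_goals
    refine iff_of_false ?_ ?_
    · rintro ⟨a, -, ha1, ha2⟩
      simp [swap_apply_def] at ha1 ha2
      have : (d 1 * t) ^ 3 = d 2 ^ 3 ∨ (d 2 * t) ^ 3 = d 1 ^ 3 := by
        first
        | left; rw [ha1, ha2]
        | right; rw [ha1, ha2]
      rw [mul_pow, mul_pow, h1, h2, one_mul] at this
      tauto
    · rintro ⟨h, -⟩
      revert h
      decide

/-- The lines `[t : 1 : 1]` that are fixed by a rescaled Fourier matrix. -/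
theorem fixes_had_properPlane {t : ℂ} {η : ℂ} (hη : η ^ 2 + η + 1 = 0) {r c : Fin 3 → ℂ}
    (hr : ∀ i, r i ^ 3 = 1) (hc : ∀ i, c i ^ 3 = 1) (hr0 : r 0 = 1)
    (h : Fixes (had η r c) ![t, 1, 1]) :
    t ^ 3 = 1 ∨ t ^ 3 = -8 ∨ ∃ m : ℂ, m ^ 3 = 1 ∧ c 1 = c 0 * m ∧ c 2 = c 0 * m ∧ r 1 = m ^ 2 ∧
      r 2 = m ^ 2 ∧ t ^ 2 - 2 * m * t - 2 * m ^ 2 = 0 := by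
  rw [fixes_had_iff hη] at h
  obtain ⟨a, h0, h1, h2⟩ := h
  simp [hr0] at h0 h1 h2
  have c0 := ne_zero_of_cube (hc 0)
  obtain ⟨m, hm⟩ : ∃ m, c 1 = c 0 * m := ⟨c 1 / c 0, by field_simp⟩
  have hm3 : m ^ 3 = 1 := by
    have := hc 1
    rw [hm, mul_pow, hc 0] at this
    linear_combination this
  have m0 := ne_zero_of_cube hm3
  obtain ⟨k, hk⟩ : ∃ k, c 2 = c 0 * m * k := ⟨c 2 / (c 0 * m), by field_simp⟩
  have hk3 : k ^ 3 = 1 := by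
    have := hc 2
    rw [hk, mul_pow, mul_pow, hc 0, hm3] at this
    linear_combination this
  obtain ⟨ρ, hρ⟩ : ∃ ρ, r 2 = r 1 * ρ := ⟨r 2 / r 1, by
    have := ne_zero_of_cube (hr 1)
    field_simp⟩
  have hρ3 : ρ ^ 3 = 1 := by
    have := hr 2
    rw [hρ, mul_pow, hr 1] at this
    linear_combination this
  have r1 := ne_zero_of_cube (hr 1)
  obtain ⟨b, hb⟩ : ∃ b, a = c 0 * b := ⟨a / c 0, by field_simp⟩
  rw [hm, hk, hb] at h0 h1 h2
  rw [hρ] at h2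
  have h0' : t + m + m * k = b * t := mul_left_cancel₀ c0 (by linear_combination h0)
  have h1' : r 1 * (t + m * η + m * k * η ^ 2) = b := mul_left_cancel₀ c0 (by linear_combination h1)
  have h2' : r 1 * ρ * (t + m * η ^ 2 + m * k * η) = b :=
    mul_left_cancel₀ c0 (by linear_combination h2)
  -- Comparing the rows 1 and 2 eliminates the eigenvalue.
  have h12 : t + m * η + m * k * η ^ 2 = ρ * (t + m * η ^ 2 + m * k * η) :=
    mul_left_cancel₀ r1 (by linear_combination h1' - h2')
  have h3 := prim_pow_three hη
  have w0 : η ≠ 0 := ne_zero_of_cube h3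
  -- If `k ≠ 1`, the comparison takes the form below; `1 + 2 * ρ = ρ * (1 - ρ)` then gives `t = w *
  -- ρ`.
  have off : ∀ ρ w : ℂ, ρ ^ 3 = 1 → w ^ 3 = 1 → t - w = ρ * (t + 2 * w) → t ^ 3 = 1 := by
    intro ρ w hρ3 hw h
    have hρ1 : ρ ≠ 1 := by
      rintro rfl
      exact ne_zero_of_cube hw (by linear_combination - h / 3)
    have hp : ρ ^ 2 + ρ + 1 = 0 := by
      have : (ρ - 1) * (ρ ^ 2 + ρ + 1) = 0 := by linear_combination hρ3
      exact (mul_eq_zero.mp this).resolve_left (sub_ne_zero.mpr hρ1)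
    have : t = w * ρ := mul_left_cancel₀ (sub_ne_zero.mpr hρ1.symm) (by
      linear_combination h + w * hp)
    rw [this, mul_pow, hw, hρ3, mul_one]
  rcases eq_of_cube_eq_one hη hk3 with rfl | rfl | rfl
  · have h12' : (1 - ρ) * (t - m) = 0 := by linear_combination h12 - m * (1 - ρ) * hη
    rcases mul_eq_zero.mp h12' with h | h
    · have hρ1 : ρ = 1 := by linear_combination -h
      subst hρ1
      have hq : t + 2 * m = r 1 * (t - m) * t := by
        linear_combination h0' - t * h1' + r 1 * m * t * hη
      obtain ⟨u, hu⟩ : ∃ u, r 1 = u * m ^ 2 := ⟨r 1 * m, by linear_combination - r 1 * hm3⟩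
      have hu3 : u ^ 3 = 1 := by
        have := hr 1
        rw [hu] at this
        linear_combination this - u ^ 3 * (m ^ 3 + 1) * hm3
      by_cases hu1 : u = 1
      · right; right
        subst hu1
        refine ⟨m, hm3, hm, by rw [hk]; ring, by rw [hu]; ring, by rw [hρ, hu]; ring, ?_⟩
        rw [hu] at hq
        linear_combination - m * hq - (t ^ 2 - t * m) * hm3
      · have hp : u ^ 2 + u + 1 = 0 := by
          have : (u - 1) * (u ^ 2 + u + 1) = 0 := by linear_combination hu3
          exact (mul_eq_zero.mp this).resolve_left (sub_ne_zero.mpr hu1)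
        have : (t - m * u) * (t + 2 * m * u) = 0 := by
          rw [hu] at hq
          linear_combination - u ^ 2 * m * hq - (u ^ 3 * t ^ 2 - u ^ 3 * t * m) * hm3 - (t ^ 2 - t * m) * hu3 + m * t * hp
        rcases mul_eq_zero.mp this with h | h
        · left
          have : t = m * u := by linear_combination h
          rw [this, mul_pow, hm3, hu3, mul_one]
        · right; left
          have : t = -2 * (m * u) := by linear_combination h
          rw [this, mul_pow, mul_pow, hm3, hu3]; norm_num
    · left
      rw [sub_eq_zero.mp h, hm3]
  · left
    refine off ρ (m * k ^ 2) hρ3 (by linear_combination k ^ 6 * hm3 + (k ^ 3 + 1) * h3) ?_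
    linear_combination h12 - m * k * hη
  · left
    refine off (ρ ^ 2) (m * η) (by linear_combination (ρ ^ 3 + 1) * hρ3)
      (by linear_combination η ^ 3 * hm3 + h3) ?_
    linear_combination - ρ ^ 2 * h12 - (t - m * η + m * (1 + η + η ^ 2) + m * (η ^ 3 - 1)) * hρ3 + ρ ^ 2 * m * η * h3 - m * hη - m * h3

end ProperPlane

theorem sqrt_three_sq : (Real.sqrt 3 : ℂ) ^ 2 = 3 := by
  rw [← Complex.ofReal_pow, Real.sq_sqrt (by norm_num)]
  norm_num

section OrderFour

variable {s : ℂ}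

theorem one_add_cube (hs : s ^ 2 = 3) : (1 + s) ^ 3 = 10 + 6 * s := by
  linear_combination (s + 3) * hs

theorem one_add_cube_ne_one (hs : s ^ 2 = 3) : (1 + s) ^ 3 ≠ 1 := by
  rw [one_add_cube hs]
  intro h
  have h1 : s = -3 / 2 := by linear_combination h / 6
  rw [h1] at hs
  norm_num at hs

theorem one_add_cube_ne_neg_eight (hs : s ^ 2 = 3) : (1 + s) ^ 3 ≠ -8 := by
  rw [one_add_cube hs]
  intro h
  have h1 : s = -3 := by linear_combination h / 6
  rw [h1] at hs
  norm_num at hs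

theorem one_add_ne_zero (hs : s ^ 2 = 3) : 1 + s ≠ 0 := by
  intro h
  have h1 : s = -1 := by linear_combination h
  rw [h1] at hs
  norm_num at hs

theorem fixes_had_one_add (hs : s ^ 2 = 3) {η : ℂ} (hη : η ^ 2 + η + 1 = 0) {r c : Fin 3 → ℂ}
    (hr : ∀ i, r i ^ 3 = 1) (hc : ∀ i, c i ^ 3 = 1) (hr0 : r 0 = 1) :
    Fixes (had η r c) ![1 + s, 1, 1] ↔ r 1 = 1 ∧ r 2 = 1 ∧ c 0 = c 1 ∧ c 1 = c 2 := by
  constructor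
  · intro h
    rcases fixes_had_properPlane hη hr hc hr0 h with h | h | ⟨m, hm, h1, h2, h3, h4, h5⟩
    · exact absurd h (one_add_cube_ne_one hs)
    · exact absurd h (one_add_cube_ne_neg_eight hs)
    · have hm1 : m = 1 := by
        -- The quadratic at `t = 1 + s`. A root `m ≠ 1` would give `1 + s = -(1 + m) = m ^ 2`, a
        -- cube root of unity.
        have : (1 - m) * (1 + s + 1 + m) = 0 := by
          linear_combination (h5 - hs) / 2
        rcases mul_eq_zero.mp this with h | h
        · linear_combination -h
        · by_contra hm1
          have hp : m ^ 2 + m + 1 = 0 := by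
            have : (m - 1) * (m ^ 2 + m + 1) = 0 := by linear_combination hm
            exact (mul_eq_zero.mp this).resolve_left (sub_ne_zero.mpr hm1)
          refine one_add_cube_ne_one hs ?_
          have : 1 + s = m ^ 2 := by linear_combination h - hp
          rw [this]
          linear_combination (m ^ 3 + 1) * hm
      subst hm1
      simp [h1, h2, h3, h4]
  · rintro ⟨h1, h2, h3, h4⟩
    rw [fixes_had_iff hη]
    refine ⟨c 2 * s, ?_, ?_, ?_⟩ <;> simp [hr0, h1, h2, h3, h4]
    · linear_combination - c 2 * hs
    · linear_combination c 2 * hη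
    · linear_combination c 2 * hη

end OrderFour

section OrderNine

variable {ν : ℂ}

theorem cube_prim_of_orderOf (hν : orderOf ν = 9) : (ν ^ 3) ^ 2 + ν ^ 3 + 1 = 0 := by
  have h1 : (ν ^ 3 - 1) * ((ν ^ 3) ^ 2 + ν ^ 3 + 1) = 0 := by
    have : ν ^ 9 = 1 := by rw [← hν]; exact pow_orderOf_eq_one ν
    linear_combination this
  refine (mul_eq_zero.mp h1).resolve_left fun h => ?_
  have := orderOf_dvd_of_pow_eq_one (sub_eq_zero.mp h)
  rw [hν] at this
  norm_num at this

/-- The minimal polynomial of `ν` over `ℚ` is the ninth cyclotomic polynomial, of degree 6. -/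
theorem int_combination_eq_zero (hν : orderOf ν = 9) {n : Fin 6 → ℤ}
    (h : ∑ i : Fin 6, (n i : ℂ) * ν ^ (i : ℕ) = 0) : n = 0 := by
  have hp : IsPrimitiveRoot ν 9 := hν ▸ IsPrimitiveRoot.orderOf ν
  have hmin := Polynomial.cyclotomic_eq_minpoly_rat hp (by norm_num)
  have hdeg : (minpoly ℚ ν).natDegree = 6 := by
    rw [← hmin, Polynomial.natDegree_cyclotomic]
    decide
  have hli := linearIndependent_pow (K := ℚ) ν
  rw [hdeg] at hli
  have := Fintype.linearIndependent_iff.mp hli (fun i => (n i : ℚ)) (by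
    rw [← h]
    refine Finset.sum_congr rfl fun i _ => ?_
    rw [Algebra.smul_def]
    simp)
  ext i
  exact_mod_cast this i

theorem exists_int_of_cube {ρ x : ℂ} (hρ : ρ ^ 2 + ρ + 1 = 0) (hx : x ^ 3 = 1) :
    ∃ a b : ℤ, x = a + b * ρ := by
  rcases eq_of_cube_eq_one hρ hx with rfl | rfl | rfl
  · exact ⟨1, 0, by simp⟩
  · exact ⟨0, 1, by simp⟩
  · exact ⟨-1, -1, by push_cast; linear_combination hρ⟩

/-- The powers `1, ν, ν²` are independent over the cube roots of unity. -/
theorem cube_root_combination_inj (hν : orderOf ν = 9) {x y z x' y' z' : ℂ} (hx : x ^ 3 = 1)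
    (hy : y ^ 3 = 1) (hz : z ^ 3 = 1) (hx' : x' ^ 3 = 1) (hy' : y' ^ 3 = 1) (hz' : z' ^ 3 = 1)
    (h : x + y * ν + z * ν ^ 2 = x' + y' * ν + z' * ν ^ 2) : x = x' ∧ y = y' ∧ z = z' := by
  have hρ := cube_prim_of_orderOf hν
  obtain ⟨a, b, rfl⟩ := exists_int_of_cube hρ hx
  obtain ⟨c, d, rfl⟩ := exists_int_of_cube hρ hy
  obtain ⟨e, f, rfl⟩ := exists_int_of_cube hρ hz
  obtain ⟨a', b', rfl⟩ := exists_int_of_cube hρ hx'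
  obtain ⟨c', d', rfl⟩ := exists_int_of_cube hρ hy'
  obtain ⟨e', f', rfl⟩ := exists_int_of_cube hρ hz'
  have := int_combination_eq_zero hν (n := ![a - a', c - c', e - e', b - b', d - d', f - f']) (by
    simp [Fin.sum_univ_succ]
    linear_combination h)
  have h0 := congrFun this 0
  have h1 := congrFun this 1
  have h2 := congrFun this 2
  have h3 := congrFun this 3
  have h4 := congrFun this 4
  have h5 := congrFun this 5
  simp [sub_eq_zero] at h0 h1 h2 h3 h4 h5
  rw [h0, h1, h2, h3, h4, h5]
  exact ⟨rfl, rfl, rfl⟩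

theorem not_fixes_had_orderNine (hν : orderOf ν = 9) {η : ℂ} (hη : η ^ 2 + η + 1 = 0)
    {r c : Fin 3 → ℂ} (hr : ∀ i, r i ^ 3 = 1) (hc : ∀ i, c i ^ 3 = 1) :
    ¬ Fixes (had η r c) ![ν, ν ^ 2, 1] := by
  rw [fixes_had_iff hη]
  rintro ⟨a, h0, -, h2⟩
  simp at h0 h2
  have hρ := cube_prim_of_orderOf hν
  have hρ3 := prim_pow_three hρ
  have h3 := prim_pow_three hη
  have hr0 := hr 0
  have hr2 := hr 2
  have hc0 := hc 0
  have hc1 := hc 1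
  have hc2 := hc 2
  -- As `v 2 = 1`, row 0 is `ν` times row 2; the term `ν ^ 3` is itself a cube root of unity and
  -- joins the constant coefficient.
  obtain ⟨e1, e2, e3⟩ := cube_root_combination_inj hν (x := r 2 * c 1 * η ^ 2 * ν ^ 3)
    (y := r 2 * c 2 * η) (z := r 2 * c 0) (x' := r 0 * c 2) (y' := r 0 * c 0) (z' := r 0 * c 1)
    (by simp only [mul_pow, hr2, hc1, hρ3, ← pow_mul, mul_comm 2 3]
        rw [pow_mul η, h3]
        norm_num)
    (by simp only [mul_pow, hr2, hc2, h3, one_mul]) (by simp only [mul_pow, hr2, hc0, one_mul])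
    (by simp only [mul_pow, hr0, hc2, one_mul]) (by simp only [mul_pow, hr0, hc0, one_mul])
    (by simp only [mul_pow, hr0, hc1, one_mul])
    (by linear_combination ν * h2 - h0)
  refine prim_ne_one hρ ?_
  have hne : r 2 ^ 3 * (c 0 * c 1 * c 2) ≠ 0 := by
    rw [hr2]
    simp [ne_zero_of_cube, hc0, hc1, hc2]
  -- In the product of the three coefficient identities all cubes and `c 0 * c 1 * c 2` cancel,
  -- which leaves `ν ^ 3 = 1`.
  have h6 : r 2 ^ 3 * (c 0 * c 1 * c 2) * (ν ^ 3 * η ^ 3) =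
      r 0 ^ 3 * (c 0 * c 1 * c 2) := by
    have : r 2 * c 1 * η ^ 2 * ν ^ 3 * (r 2 * c 2 * η) * (r 2 * c 0) =
      r 0 * c 2 * (r 0 * c 0) * (r 0 * c 1) := by rw [e1, e2, e3]
    linear_combination this
  rw [hr0, ← hr2, h3, mul_one] at h6
  exact mul_left_cancel₀ hne (by rw [h6, mul_one])

/-- Transpositions would force `ν ^ 6 = 1`. The 3-cycles survive because `[ν : ν² : 1]` is an
eigenline of a cyclic shift twisted by cube roots of unity. -/
theorem fixes_mono_orderNine (hν : orderOf ν = 9) {σ : Perm (Fin 3)} {d : Fin 3 → ℂ}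
    (hd : ∀ i, d i ^ 3 = 1) :
    Fixes (mono σ d) ![ν, ν ^ 2, 1] ↔ (σ = 1 ∧ d 0 = d 1 ∧ d 1 = d 2) ∨
      (σ = finRotate 3 ∧ d 0 = d 2 ∧ d 1 = d 2 * ν ^ 3) ∨
      (σ = (finRotate 3)⁻¹ ∧ d 0 = d 1 ∧ d 0 = d 2 * ν ^ 3) := by
  have hρ := cube_prim_of_orderOf hν
  have h1 := hd 1
  have h2 := hd 2
  have h0 := hd 0
  have hν0 : ν ≠ 0 := by
    rintro rfl
    norm_num at hρ
  have hν6 : ν ^ 6 ≠ 1 := fun h => by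
    have := orderOf_dvd_of_pow_eq_one h
    rw [hν] at this
    norm_num at this
  have n1 : (1 : Perm (Fin 3)) ≠ finRotate 3 := by decide
  have n2 : (1 : Perm (Fin 3)) ≠ (finRotate 3)⁻¹ := by decide
  have n3 : finRotate 3 ≠ (finRotate 3)⁻¹ := by decide
  rw [fixes_mono_iff]
  rcases perm_three_cases σ with rfl | rfl | rfl | rfl | rfl | rfl
  · simp only [n1, n2, false_and, or_false, true_and, Perm.one_apply]
    simp [hν0]
    grind
  · refine iff_of_false ?_ ?_
    · rintro ⟨a, ha0, ha1, ha2⟩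
      simp [swap_apply_def, hν0] at ha0 ha1 ha2
      apply hν6
      rw [← ha0] at ha1
      rw [ha1] at h1
      linear_combination h1 - ν ^ 6 * h0
    · rintro (⟨h, -⟩ | ⟨h, -⟩ | ⟨h, -⟩) <;> revert h <;> decide
  · refine iff_of_false ?_ ?_
    · rintro ⟨a, ha0, ha1, ha2⟩
      simp [swap_apply_def] at ha0 ha1 ha2
      apply hν6
      have : d 0 * ν = d 2 := mul_left_cancel₀ hν0 (by rw [ha2]; linear_combination ha0)
      rw [← this] at h2
      linear_combination (d 0 ^ 3 * ν ^ 3 + 1) * h2 - (d 0 ^ 3 + 1) * ν ^ 6 * h0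
    · rintro (⟨h, -⟩ | ⟨h, -⟩ | ⟨h, -⟩) <;> revert h <;> decide
  · refine iff_of_false ?_ ?_
    · rintro ⟨a, ha0, ha1, ha2⟩
      simp [swap_apply_def, hν0] at ha0 ha1 ha2
      apply hν6
      rw [← ha1] at ha0
      rw [ha0] at h0
      linear_combination (d 1 ^ 3 * ν ^ 3 + 1) * h0 - (d 1 ^ 3 + 1) * ν ^ 6 * h1
    · rintro (⟨h, -⟩ | ⟨h, -⟩ | ⟨h, -⟩) <;> revert h <;> decide
  · simp only [n1.symm, n3, false_and, or_false, false_or, true_and]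
    constructor
    · rintro ⟨a, ha0, ha1, ha2⟩
      simp at ha0 ha1 ha2
      have : d 0 = d 2 := mul_left_cancel₀ (pow_ne_zero 2 hν0) (by linear_combination ha0 - ν * ha2)
      exact ⟨this, by rw [ha1, ← ha2]; ring⟩
    · rintro ⟨h, h'⟩
      refine ⟨d 2 * ν, ?_, ?_, ?_⟩ <;> simp [h, h'] <;> ring
  · simp only [n2.symm, n3.symm, false_and, false_or, true_and]
    constructor
    · rintro ⟨a, ha0, ha1, ha2⟩
      simp at ha0 ha1 ha2
      have : d 1 = a * ν := mul_left_cancel₀ hν0 (by linear_combination ha1)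
      exact ⟨ha0.trans this.symm, by rw [ha0, ← ha2]; ring⟩
    · rintro ⟨h, h'⟩
      refine ⟨d 2 * ν ^ 2, ?_, ?_, ?_⟩ <;> simp [← h, h'] <;> ring

end OrderNine

/-! ### Orbit sizes. -/

/-- The size of the orbit of the line spanned by `v`, when the elements of `G25` that preserve
this line are those whose label belongs to `f`. -/
theorem encard_orbit_of_fixes {v : Fin 3 → ℂ} (hv : v ≠ 0)
    {f : Perm (Fin 3) → (Fin 3 → Fin 3) → Prop} {k : Fin 3 → Fin 3 → (Fin 3 → Fin 3) → Prop}
    [∀ σ d, Decidable (f σ d)] [∀ r₁ r₂ c, Decidable (k r₁ r₂ c)]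
    (hf : ∀ σ d, Fixes (mono σ fun i => root (d i)) v ↔ f σ d)
    (hk : ∀ b r₁ r₂ c, Fixes (had (primRoot b) ![1, root r₁, root r₂] fun i => root (c i)) v ↔
      k r₁ r₂ c) {n m : ℕ}
    (hn : (Finset.univ.filter fun p : Perm (Fin 3) × (Fin 3 → Fin 3) => f p.1 p.2).card +
      2 * (Finset.univ.filter fun p : Fin 3 × Fin 3 × (Fin 3 → Fin 3) =>
        k p.1 p.2.1 p.2.2).card = n) (hnm : m * n = 648) :
    (MulAction.orbit G25 (Projectivization.mk ℂ v hv)).encard = m := by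
  classical
  refine encard_orbit_eq hv (C := Sum.elim (fun p => f p.1 p.2) (fun q => k q.2.1 q.2.2.1 q.2.2.2))
    ?_ (n := n) ?_ hnm
  · rintro (⟨σ, d⟩ | ⟨b, r₁, r₂, c⟩)
    · exact hf σ d
    · exact hk b r₁ r₂ c
  · rw [← hn, ← Fintype.card_subtype, ← Fintype.card_subtype, ← Fintype.card_subtype,
      Fintype.card_congr (Equiv.subtypeSum), Fintype.card_sum]
    congr 1
    · exact Fintype.card_congr (Equiv.refl _)
    -- The condition `k` does not involve the choice of primitive root, whence the factor 2.
    rw [← Fintype.card_bool, ← Fintype.card_prod]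
    refine Fintype.card_congr ⟨fun x => (x.1.1, ⟨x.1.2, x.2⟩), fun x => ⟨(x.1, x.2.1), x.2.2⟩,
      fun _ => rfl, fun _ => rfl⟩

theorem vertex_ne_zero : ![(1 : ℂ), 0, 0] ≠ 0 := fun h => one_ne_zero (congrFun h 0)

theorem coordinatePlane_ne_zero (t : ℂ) : ![0, 1, t] ≠ 0 := fun h => one_ne_zero (congrFun h 1)

theorem properPlane_ne_zero (t : ℂ) : ![t, 1, 1] ≠ 0 := fun h => one_ne_zero (congrFun h 2)

theorem affine_ne_zero (a b : ℂ) : ![a, b, 1] ≠ 0 := fun h => one_ne_zero (congrFun h 2)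

theorem encard_orbit_vertex :
    (MulAction.orbit G25 (Projectivization.mk ℂ ![(1 : ℂ), 0, 0] vertex_ne_zero)).encard = 12 :=
  encard_orbit_of_fixes _ (f := fun σ _ => σ = 1 ∨ σ = swap 1 2) (k := fun _ _ _ => False)
    (fun σ d => fixes_mono_vertex fun i => root_pow_three _)
    (fun b r₁ r₂ c => iff_false_intro (not_fixes_had_vertex (primRoot_prim b)
      (vec_root_pow_three r₁ r₂) fun i => root_pow_three _)) (n := 54) (by decide +kernel)
    (by norm_num)

theorem encard_orbit_coordinatePlane {t : ℂ} (ht : t ≠ 0) (ht6 : t ^ 6 ≠ 1) :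
    (MulAction.orbit G25 (Projectivization.mk ℂ ![0, 1, t] (coordinatePlane_ne_zero t))).encard =
      72 := by
  refine encard_orbit_of_fixes _ (f := fun σ d => σ = 1 ∧ d 1 = d 2) (k := fun _ _ _ => False)
    (fun σ d => ?_) (fun b r₁ r₂ c => iff_false_intro fun h => ht6 ?_) (n := 9) (by decide +kernel)
    (by norm_num)
  · rw [fixes_mono_coordinatePlane ht fun i => root_pow_three _, root_inj, or_iff_left]
    rintro ⟨-, h⟩
    apply ht6
    have h1 := root_pow_three (d 2)
    rw [← h] at h1
    linear_combination h1 - t ^ 6 * root_pow_three (d 1)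
  · have := fixes_had_coordinatePlane (primRoot_prim b) (vec_root_pow_three r₁ r₂)
      (fun i => root_pow_three _) h
    linear_combination (t ^ 3 - 1) * this

theorem encard_orbit_coordinatePlane_one :
    (MulAction.orbit G25 (Projectivization.mk ℂ ![0, 1, 1] (coordinatePlane_ne_zero 1))).encard =
      36 := by
  refine encard_orbit_of_fixes _ (f := fun σ d => (σ = 1 ∨ σ = swap 1 2) ∧ d 1 = d 2)
    (k := fun _ _ _ => False)
    (fun σ d => ?_) (fun b r₁ r₂ c => iff_false_intro fun h => ?_) (n := 18) (by decide +kernel)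
    (by norm_num)
  · rw [fixes_mono_coordinatePlane one_ne_zero fun i => root_pow_three _, one_pow, mul_one,
      root_inj, or_and_right]
  · have := fixes_had_coordinatePlane (primRoot_prim b) (vec_root_pow_three r₁ r₂)
      (fun i => root_pow_three _) h
    norm_num at this

theorem encard_orbit_center :
    (MulAction.orbit G25 (Projectivization.mk ℂ ![0, 1, -1] (coordinatePlane_ne_zero _))).encard =
      9 := by
  refine encard_orbit_of_fixes _ (f := fun σ d => (σ = 1 ∨ σ = swap 1 2) ∧ d 1 = d 2)
    (k := fun r₁ r₂ c => r₁ = r₂ ∧ c 1 = c 2)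
    (fun σ d => ?_) (fun b r₁ r₂ c => ?_) (n := 72) (by decide +kernel)
    (by norm_num)
  · rw [fixes_mono_coordinatePlane (neg_ne_zero.mpr one_ne_zero) fun i => root_pow_three _,
      neg_one_sq, mul_one, root_inj, or_and_right]
  · rw [fixes_had_center (primRoot_prim b) (vec_root_pow_three r₁ r₂) fun i => root_pow_three _]
    simp [root_inj]

theorem encard_orbit_properPlane {t : ℂ} (ht : t ≠ 0) (ht1 : t ^ 3 ≠ 1) (ht8 : t ^ 3 ≠ -8)
    (ht54 : t ^ 6 - 20 * t ^ 3 - 8 ≠ 0) :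
    (MulAction.orbit G25 (Projectivization.mk ℂ ![t, 1, 1] (properPlane_ne_zero t))).encard =
      108 := by
  refine encard_orbit_of_fixes _ (f := fun σ d => (σ = 1 ∨ σ = swap 1 2) ∧ d 0 = d 1 ∧ d 1 = d 2)
    (k := fun _ _ _ => False)
    (fun σ d => ?_) (fun b r₁ r₂ c => iff_false_intro fun h => ?_) (n := 6) (by decide +kernel)
    (by norm_num)
  · rw [fixes_mono_properPlane ht1 ht fun i => root_pow_three _, root_inj, root_inj]
  · rcases fixes_had_properPlane (primRoot_prim b) (vec_root_pow_three r₁ r₂)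
      (fun i => root_pow_three _) rfl h with h | h | ⟨m, hm, -, -, -, -, h⟩
    · exact ht1 h
    · exact ht8 h
    · apply ht54
      have h1 : t ^ 3 = 6 * m ^ 2 * t + 4 * m ^ 3 := by linear_combination (t + 2 * m) * h
      -- This sextic is the product of the quadratics obtained by multiplying `m` by the three cube
      -- roots of unity; at `m ^ 3 = 1` it no longer depends on `m`.
      have h2 : t ^ 6 - 20 * m ^ 3 * t ^ 3 - 8 * m ^ 6 = 0 := by
        linear_combination (t ^ 3 + 6 * m ^ 2 * t - 16 * m ^ 3) * h1 + 36 * m ^ 4 * h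
      linear_combination h2 + (20 * t ^ 3 + 8 * (m ^ 3 + 1)) * hm

theorem encard_orbit_one_add {s : ℂ} (hs : s ^ 2 = 3) :
    (MulAction.orbit G25 (Projectivization.mk ℂ ![1 + s, 1, 1] (properPlane_ne_zero _))).encard =
      54 := by
  refine encard_orbit_of_fixes _ (f := fun σ d => (σ = 1 ∨ σ = swap 1 2) ∧ d 0 = d 1 ∧ d 1 = d 2)
    (k := fun r₁ r₂ c => r₁ = 0 ∧ r₂ = 0 ∧ c 0 = c 1 ∧ c 1 = c 2)
    (fun σ d => ?_) (fun b r₁ r₂ c => ?_) (n := 12) (by decide +kernel)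
    (by norm_num)
  · rw [fixes_mono_properPlane (one_add_cube_ne_one hs) (one_add_ne_zero hs)
      fun i => root_pow_three _, root_inj, root_inj]
  · rw [fixes_had_one_add hs (primRoot_prim b) (vec_root_pow_three r₁ r₂)
      (fun i => root_pow_three _) rfl]
    simp [root_inj, ← root_zero]

theorem encard_orbit_orderNine {ν : ℂ} (hν : orderOf ν = 9) :
    (MulAction.orbit G25 (Projectivization.mk ℂ ![ν, ν ^ 2, 1] (affine_ne_zero _ _))).encard =
      72 := by
  obtain ⟨e, he⟩ := exists_root_eq (prim_pow_three (cube_prim_of_orderOf hν))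
  refine encard_orbit_of_fixes _ (f := fun σ d => (σ = 1 ∧ d 0 = d 1 ∧ d 1 = d 2) ∨
      (σ = finRotate 3 ∧ d 0 = d 2 ∧ d 1 = d 2 + e) ∨
      (σ = (finRotate 3)⁻¹ ∧ d 0 = d 1 ∧ d 0 = d 2 + e))
    (k := fun _ _ _ => False)
    (fun σ d => ?_) (fun b r₁ r₂ c => iff_false_intro fun h => ?_) (n := 9) ?_
    (by norm_num)
  · rw [fixes_mono_orderNine hν fun i => root_pow_three _, ← he, ← root_add]
    simp only [root_inj]
  · exact not_fixes_had_orderNine hν (primRoot_prim b) (vec_root_pow_three r₁ r₂)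
      (fun i => root_pow_three _) h
  -- The count does not depend on which cube root of unity `ν ^ 3` is, so it is decided for all `e`
  -- at once.
  · clear he
    revert e
    decide +kernel

theorem prim_of_cube_ne_one {x : ℂ} (hx : x ^ 3 = 1) (hx1 : x ≠ 1) : x ^ 2 + x + 1 = 0 := by
  have : (x - 1) * (x ^ 2 + x + 1) = 0 := by linear_combination hx
  exact (mul_eq_zero.mp this).resolve_left (sub_ne_zero.mpr hx1)

/-- `A` is a scalar matrix. -/
def IsScalar (A : Matrix (Fin 3) (Fin 3) ℂ) : Prop := ∃ x : ℂ, A = diagonal fun _ => x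

theorem isScalar_mono_iff {σ : Perm (Fin 3)} {d : Fin 3 → ℂ} (hd : ∀ i, d i ^ 3 = 1) :
    IsScalar (mono σ d) ↔ σ = 1 ∧ d 0 = d 1 ∧ d 1 = d 2 := by
  constructor
  · rintro ⟨x, hx⟩
    have hσ : σ = 1 := by
      ext1 i
      by_contra hne
      have h1 := congrFun (congrFun hx i) (σ i)
      rw [diagonal_apply_ne _ (show i ≠ σ i from fun h => hne h.symm)] at h1
      simp [mono, ne_zero_of_cube (hd i)] at h1
    subst hσ
    have : ∀ i, d i = x := fun i => by
      have h1 := congrFun (congrFun hx i) i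
      simpa [mono] using h1
    simp [this]
  · rintro ⟨rfl, h, h'⟩
    refine ⟨d 0, ?_⟩
    rw [mono_one]
    congr 1
    ext i
    fin_cases i <;> simp [h, h']

theorem not_isScalar_had {η : ℂ} (hη : η ^ 2 + η + 1 = 0) {r c : Fin 3 → ℂ}
    (hr : ∀ i, r i ^ 3 = 1) (hc : ∀ i, c i ^ 3 = 1) : ¬ IsScalar (had η r c) := by
  rintro ⟨x, hx⟩
  refine had_apply_ne_zero hη hr hc 0 1 ?_
  rw [hx, diagonal_apply_ne _ (by decide)]

theorem IsScalar.fixes {A : Matrix (Fin 3) (Fin 3) ℂ} (h : IsScalar A) (v : Fin 3 → ℂ) :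
    Fixes A v := by
  obtain ⟨x, rfl⟩ := h
  exact ⟨x, fun i => by simp [mulVec_diagonal]⟩

/-- The scalars in the group are the three cube roots of unity, and 648 / 3 = 216. -/
theorem encard_orbit_of_scalar {v : Fin 3 → ℂ} (hv : v ≠ 0)
    (h : ∀ A, InG25 A → Fixes A v → IsScalar A) :
    (MulAction.orbit G25 (Projectivization.mk ℂ v hv)).encard = 216 := by
  refine encard_orbit_of_fixes _ (f := fun σ d => σ = 1 ∧ d 0 = d 1 ∧ d 1 = d 2)
    (k := fun _ _ _ => False)
    (fun σ d => ?_) (fun b r₁ r₂ c => iff_false_intro fun h' => ?_) (n := 3) (by decide +kernel)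
    (by norm_num)
  · have hd : ∀ i, root (d i) ^ 3 = 1 := fun i => root_pow_three _
    rw [← root_inj, ← @root_inj (d 1) (d 2), ← isScalar_mono_iff hd]
    exact ⟨h _ (inG25_mono σ hd), fun h' => h'.fixes v⟩
  · have hr := vec_root_pow_three r₁ r₂
    have hc : ∀ i, root (c i) ^ 3 = 1 := fun i => root_pow_three _
    exact not_isScalar_had (primRoot_prim b) hr hc (h _ (inG25_had (primRoot_prim b) hr hc) h')

/-! ### Reduction of a Fourier stabilizer to a monomial one. -/

/-- No entry of a Fourier matrix vanishes, so a single zero entry decides the type. -/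
theorem isMono_of_apply_eq_zero {g : GL (Fin 3) ℂ} (hg : g ∈ G25) {i j : Fin 3}
    (h : (g : Matrix (Fin 3) (Fin 3) ℂ) i j = 0) : IsMono (g : Matrix (Fin 3) (Fin 3) ℂ) := by
  refine (isMono_or_isHad_of_mem hg).resolve_right ?_
  rintro ⟨η, r, c, hη, hr, hc, -, h'⟩
  rw [h'] at h
  exact had_apply_ne_zero hη hr hc i j h

theorem sum_pow_eq_zero {x : ℂ} (hx : x ^ 3 = 1) {η : ℂ} (hη : η ^ 2 + η + 1 = 0) :
    x ^ 2 + x + 1 = 0 ∨ (x * η) ^ 2 + x * η + 1 = 0 := by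
  by_cases hx1 : x = 1
  · right
    rw [hx1, one_mul, hη]
  · exact Or.inl (prim_of_cube_ne_one hx hx1)

/-- Up to a nonzero factor this is the entry `(0, l)` of the matrix examined in
`exists_conj_isMono`. With `e 1 = e 0 * x` and `e 2 = κ * e 0 * x ^ 2` it becomes `e 0 * (1 - κ) *
(1 + y + y ^ 2)`, where `y` is `x` or `x * κ` times `η ^ l`, and a suitable `l` makes `y` primitive.
-/
theorem exists_gauss_eq_zero {η : ℂ} (hη : η ^ 2 + η + 1 = 0) {e : Fin 3 → ℂ}
    (he : ∀ i, e i ^ 3 = 1) {κ : ℂ} (hκ : κ = e 0 * e 1 * e 2) (hκ1 : κ ≠ 1) :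
    ∃ l : Fin 3, e 0 * (2 + κ ^ 2) + e 1 * (1 + η + κ ^ 2 * η ^ 2) * η ^ (l : ℕ) +
      e 2 * κ * (1 + η ^ 2 + κ ^ 2 * η) * (η ^ (l : ℕ)) ^ 2 = 0 := by
  have h0 := he 0
  have h1 := he 1
  have h2 := he 2
  have h3 := prim_pow_three hη
  have hκ3 : κ ^ 3 = 1 := by rw [hκ, mul_pow, mul_pow, h0, h1, h2]; norm_num
  obtain ⟨x, hx⟩ : ∃ x, e 1 = e 0 * x := ⟨e 1 / e 0, by
    have := ne_zero_of_cube h0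
    field_simp⟩
  have hx3 : x ^ 3 = 1 := by
    rw [hx, mul_pow, h0] at h1
    linear_combination h1
  have he2 : e 2 = κ * e 0 * x ^ 2 := by
    rw [hκ, hx]
    linear_combination - (e 2 * x ^ 3) * h0 - e 2 * hx3
  rw [hx, he2]
  clear hκ
  have key : ∀ y : ℂ, y ^ 3 = 1 → ∃ l : Fin 3, 1 + y * η ^ (l : ℕ) + (y * η ^ (l : ℕ)) ^ 2 = 0 := by
    intro y hy
    rcases sum_pow_eq_zero hy hη with h | h
    · exact ⟨0, by simp; linear_combination h⟩
    · exact ⟨1, by simp; linear_combination h⟩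
  rcases eq_of_cube_eq_one hη hκ3 with rfl | rfl | rfl
  · exact absurd rfl hκ1
  · obtain ⟨l, hl⟩ := key (x * κ) (by rw [mul_pow, hx3, hκ3, one_mul])
    refine ⟨l, ?_⟩
    generalize κ ^ (l : ℕ) = L at hl
    have e1 : 2 + κ ^ 2 = 1 - κ := by linear_combination hη
    have e2 : 1 + κ + κ ^ 2 * κ ^ 2 = κ * (1 - κ) := by
      linear_combination (κ ^ 2 - κ + 1) * hη
    have e3 : 1 + κ ^ 2 + κ ^ 2 * κ = 1 - κ := by linear_combination κ * hη
    rw [e1, e2, e3]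
    linear_combination e 0 * (1 - κ) * hl
  · obtain ⟨l, hl⟩ := key x hx3
    refine ⟨l, ?_⟩
    generalize η ^ (l : ℕ) = L at hl
    have e1 : 2 + (η ^ 2) ^ 2 = 1 - η ^ 2 := by linear_combination (η ^ 2 - η + 1) * hη
    have e2 : 1 + η + (η ^ 2) ^ 2 * η ^ 2 = 1 - η ^ 2 := by
      linear_combination (η ^ 3 + 1) * h3 + hη
    have e3 : 1 + η ^ 2 + (η ^ 2) ^ 2 * η = η ^ 2 * (1 - η ^ 2) := by
      linear_combination η ^ 2 * h3 + (η ^ 2 - η + 1) * hη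
    rw [e1, e2, e3]
    linear_combination e 0 * (1 - η ^ 2) * hl + e 0 * x ^ 2 * L ^ 2 * (1 - η ^ 2) * (η ^ 3 + 1) * h3

/-- A rescaled Fourier matrix in `G25` is conjugate to a monomial matrix, or its square is a
monomial matrix that is not scalar. -/
theorem exists_conj_isMono {η : ℂ} (hη : η ^ 2 + η + 1 = 0) {r c : Fin 3 → ℂ}
    (hr : ∀ i, r i ^ 3 = 1) (hc : ∀ i, c i ^ 3 = 1) {g : GL (Fin 3) ℂ} (hg : g ∈ G25)
    (h : (g : Matrix (Fin 3) (Fin 3) ℂ) = had η r c) :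
    (IsMono ((g * g : GL (Fin 3) ℂ) : Matrix (Fin 3) (Fin 3) ℂ) ∧
      ¬ IsScalar ((g * g : GL (Fin 3) ℂ) : Matrix (Fin 3) (Fin 3) ℂ)) ∨
    ∃ k ∈ G25, IsMono ((k⁻¹ * g * k : GL (Fin 3) ℂ) : Matrix (Fin 3) (Fin 3) ℂ) := by
  have h3 := prim_pow_three hη
  have hη0 := ne_zero_of_cube h3
  set e : Fin 3 → ℂ := fun i => c i * r i with he
  have he3 : ∀ i, e i ^ 3 = 1 := fun i => by rw [he, mul_pow, hr, hc, mul_one]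
  -- The square of `g` contains the Fourier transform of the diagonal `e`. Product 1 means that `e`
  -- is `e 0` times the modulation `![1, x, x ^ 2]`, whose transform is a permutation pattern.
  by_cases hκ : e 0 * e 1 * e 2 = 1
  · left
    have hsq : ∀ i j, ((g * g : GL (Fin 3) ℂ) : Matrix (Fin 3) (Fin 3) ℂ) i j =
        -(1 / 3) * (r i * c j) * (e 0 + e 1 * η ^ ((i : ℕ) + j) + e 2 * η ^ (2 * ((i : ℕ) + j))) :=
      fun i j => by rw [Units.val_mul, h, had_mul_had_apply hη]
    obtain ⟨x, hx⟩ : ∃ x, e 1 = e 0 * x := ⟨e 1 / e 0, by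
      have := ne_zero_of_cube (he3 0)
      field_simp⟩
    have hx3 : x ^ 3 = 1 := by
      have h1 := he3 1
      rw [hx, mul_pow, he3 0] at h1
      linear_combination h1
    have he2 : e 2 = e 0 * x ^ 2 := by
      rw [hx] at hκ
      linear_combination e 0 * x ^ 2 * hκ - (e 2 * x ^ 3) * he3 0 - e 2 * hx3
    simp only [hx, he2] at hsq
    have hne : ∀ i j, r i * c j * e 0 ≠ 0 := fun i j => mul_ne_zero (mul_ne_zero
      (ne_zero_of_cube (hr i)) (ne_zero_of_cube (hc j))) (ne_zero_of_cube (he3 0))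
    have hzero : ∀ i j : Fin 3, x * η ^ ((i : ℕ) + j) ≠ 1 →
        ((g * g : GL (Fin 3) ℂ) : Matrix (Fin 3) (Fin 3) ℂ) i j = 0 := by
      intro i j hij
      have hp := prim_of_cube_ne_one (x := x * η ^ ((i : ℕ) + j)) (by
        rw [mul_pow, hx3, ← pow_mul, mul_comm _ 3, pow_mul, h3]; norm_num) hij
      rw [hsq, pow_mul']
      linear_combination -(1 / 3) * (r i * c j) * e 0 * hp
    have hnz : ∀ i j : Fin 3, x * η ^ ((i : ℕ) + j) = 1 →
        ((g * g : GL (Fin 3) ℂ) : Matrix (Fin 3) (Fin 3) ℂ) i j ≠ 0 := by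
      intro i j hij
      have : ((g * g : GL (Fin 3) ℂ) : Matrix (Fin 3) (Fin 3) ℂ) i j = - (r i * c j * e 0) := by
        rw [hsq, pow_mul']
        linear_combination -(1 / 3) * (r i * c j) * e 0 * (x * η ^ ((i : ℕ) + j) + 2) * hij
      rw [this]
      exact neg_ne_zero.mpr (hne i j)
    have hη1 := prim_ne_one hη
    constructor
    · by_cases hx1 : x = 1
      · refine isMono_of_apply_eq_zero (mul_mem hg hg) (hzero 0 1 ?_)
        simpa [hx1] using hη1
      · refine isMono_of_apply_eq_zero (mul_mem hg hg) (hzero 0 0 ?_)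
        simpa using hx1
    · rintro ⟨y, hy⟩
      -- In each case some off-diagonal position satisfies `x * η ^ (i + j) = 1` and carries a
      -- nonzero entry.
      rcases eq_of_cube_eq_one hη hx3 with rfl | rfl | rfl
      · refine hnz 1 2 (by simp [h3]) ?_
        rw [hy, diagonal_apply_ne _ (by decide)]
      · refine hnz 0 2 (by simp; linear_combination h3) ?_
        rw [hy, diagonal_apply_ne _ (by decide)]
      · refine hnz 0 1 (by simp; linear_combination h3) ?_
        rw [hy, diagonal_apply_ne _ (by decide)]
  · right
    obtain ⟨l, hl⟩ := exists_gauss_eq_zero hη he3 rfl hκ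
    set κ := e 0 * e 1 * e 2 with hκdef
    have hκ3 : κ ^ 3 = 1 := by rw [hκdef, mul_pow, mul_pow, he3, he3, he3]; norm_num
    clear_value κ
    have hr' : ∀ i, ![r 0, r 1, r 2 * κ] i ^ 3 = 1 := by
      intro i
      fin_cases i <;> simp [hr, mul_pow, hκ3]
    -- The conjugating element has rows `r`, corrected by `κ` in the last place. The element `k'` is
    -- its inverse up to the square of the Fourier matrix, so `k⁻¹ * g * k` is monomial as soon as
    -- `k' * g * k` has a zero entry.
    obtain ⟨k, hk, hkH⟩ := inG25_had hη hr' (c := 1) (by simp)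
    obtain ⟨k', hk', hkH'⟩ := inG25_had hη (r := 1) (c := ![r 0 ^ 2, r 1 ^ 2, r 2 ^ 2 * κ ^ 2])
      (by simp) (by
        intro i
        fin_cases i
        · simp; linear_combination (r 0 ^ 3 + 1) * hr 0
        · simp; linear_combination (r 1 ^ 3 + 1) * hr 1
        · simp
          linear_combination κ ^ 6 * (r 2 ^ 3 + 1) * hr 2 + (κ ^ 3 + 1) * hκ3)
    refine ⟨k, hk, ?_⟩
    have hkk : ((k' * k : GL (Fin 3) ℂ) : Matrix (Fin 3) (Fin 3) ℂ) = mono (swap 1 2) 1 := by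
      rw [← fourier_mul_self hη, Units.val_mul, hkH, hkH']
      ext i j
      rw [had_mul_had_apply hη, had_mul_had_apply hη]
      simp
      linear_combination hr 0 + η ^ ((i : ℕ) + j) * hr 1 +
        η ^ (2 * ((i : ℕ) + j)) * (κ ^ 3 * hr 2 + hκ3)
    have hzero : ((k' * (g * k) : GL (Fin 3) ℂ) : Matrix (Fin 3) (Fin 3) ℂ) 0 l = 0 := by
      rw [← mul_assoc, Units.val_mul, Units.val_mul, hkH, hkH', h, Matrix.mul_apply,
        Fin.sum_univ_three, had_mul_had_apply hη, had_mul_had_apply hη, had_mul_had_apply hη]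
      simp only [he] at hl
      have q : ∀ i, r i ^ 2 * r i = 1 := fun i => by rw [← pow_succ, hr]
      have q2 : r 2 ^ 2 * κ ^ 2 * r 2 = κ ^ 2 := by linear_combination κ ^ 2 * hr 2
      have h4 : η ^ 4 = η := by linear_combination η * h3
      simp [had]
      rw [q, q, q2, h4, pow_mul' η 2]
      linear_combination -3⁻¹ * (η - η ^ 2)⁻¹ * hl
    have hmono := isMono_of_apply_eq_zero (mul_mem hk' (mul_mem hg hk)) hzero
    have hconj : k⁻¹ * g * k = (k' * k)⁻¹ * (k' * (g * k)) := by group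
    have hinv : (k' * k)⁻¹ = k' * k := by
      rw [inv_eq_iff_mul_eq_one]
      apply Units.ext
      rw [Units.val_mul, hkk, mono_one_mul_mono_one, Equiv.swap_mul_self, mono_one_one]
      rfl
    rw [hconj, hinv, Units.val_mul, hkk]
    exact isMono_mul ⟨_, _, by simp, rfl⟩ hmono

/-! ### Normal forms of lines up to the group. -/

/-- The line `[1 : 0 : 0]`. -/
abbrev vertexLine : Line := Projectivization.mk ℂ ![(1 : ℂ), 0, 0] vertex_ne_zero

/-- The line `[0 : 1 : t]`. -/
abbrev coordinateLine (t : ℂ) : Line :=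
  Projectivization.mk ℂ ![0, 1, t] (coordinatePlane_ne_zero t)

/-- The line `[t : 1 : 1]`. -/
abbrev properLine (t : ℂ) : Line := Projectivization.mk ℂ ![t, 1, 1] (properPlane_ne_zero t)

theorem orbitOf_eq_iff {L L' : Line} : orbitOf L = orbitOf L' ↔ L ∈ MulAction.orbit G25 L' :=
  Quotient.eq''

theorem orbitOf_smul {g : GL (Fin 3) ℂ} (hg : g ∈ G25) (L : Line) :
    orbitOf (g • L) = orbitOf L :=
  orbitOf_eq_iff.mpr ⟨⟨g, hg⟩, rfl⟩

theorem orbitOf_mk_eq {A : Matrix (Fin 3) (Fin 3) ℂ} (hA : InG25 A) {v w : Fin 3 → ℂ} (hv : v ≠ 0)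
    (hw : w ≠ 0) (a : ℂ) (h : ∀ i, (A *ᵥ v) i = a * w i) :
    orbitOf (Projectivization.mk ℂ v hv) = orbitOf (Projectivization.mk ℂ w hw) := by
  obtain ⟨g, hg, rfl⟩ := hA
  rw [← (smul_mk_eq_mk_iff g hv hw).mpr ⟨a, h⟩, orbitOf_smul hg]

theorem orbitOf_mk_eq_of_mono (σ : Perm (Fin 3)) {d : Fin 3 → ℂ} (hd : ∀ i, d i ^ 3 = 1)
    {v w : Fin 3 → ℂ} (hv : v ≠ 0) (hw : w ≠ 0) (a : ℂ) (h : ∀ i, d i * v (σ i) = a * w i) :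
    orbitOf (Projectivization.mk ℂ v hv) = orbitOf (Projectivization.mk ℂ w hw) := by
  refine orbitOf_mk_eq (inG25_mono σ hd) hv hw (((Perm.sign σ : ℤ) : ℂ) * a) fun i => ?_
  rw [mono_mulVec, mul_assoc, h, mul_assoc]

theorem orbitOf_mk_eq_of_had {η : ℂ} (hη : η ^ 2 + η + 1 = 0) {r c : Fin 3 → ℂ}
    (hr : ∀ i, r i ^ 3 = 1) (hc : ∀ i, c i ^ 3 = 1) {v w : Fin 3 → ℂ} (hv : v ≠ 0) (hw : w ≠ 0)
    (a : ℂ) (h0 : r 0 * (c 0 * v 0 + c 1 * v 1 + c 2 * v 2) = a * w 0)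
    (h1 : r 1 * (c 0 * v 0 + c 1 * η * v 1 + c 2 * η ^ 2 * v 2) = a * w 1)
    (h2 : r 2 * (c 0 * v 0 + c 1 * η ^ 2 * v 1 + c 2 * η * v 2) = a * w 2) :
    orbitOf (Projectivization.mk ℂ v hv) = orbitOf (Projectivization.mk ℂ w hw) := by
  have h3 := prim_pow_three hη
  refine orbitOf_mk_eq (inG25_had hη hr hc) hv hw ((η - η ^ 2)⁻¹ * a) fun i => ?_
  rw [had_mulVec]
  fin_cases i <;> simp
  · linear_combination (η - η ^ 2)⁻¹ * h0
  · linear_combination (η - η ^ 2)⁻¹ * h1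
  · linear_combination (η - η ^ 2)⁻¹ * (h2 + r 2 * c 2 * v 2 * η * h3)

theorem vec_cube_eq_one {x y z : ℂ} (hx : x ^ 3 = 1) (hy : y ^ 3 = 1) (hz : z ^ 3 = 1)
    (i : Fin 3) : ![x, y, z] i ^ 3 = 1 := by
  fin_cases i <;> simp [hx, hy, hz]

theorem sq_cube_eq_one {x : ℂ} (hx : x ^ 3 = 1) : (x ^ 2) ^ 3 = 1 := by
  linear_combination (x ^ 3 + 1) * hx

theorem mul_cube_eq_one {x y : ℂ} (hx : x ^ 3 = 1) (hy : y ^ 3 = 1) : (x * y) ^ 3 = 1 := by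
  rw [mul_pow, hx, hy, mul_one]

theorem exists_cube_of_cube_eq {a b : ℂ} (hb : b ≠ 0) (h : a ^ 3 = b ^ 3) :
    ∃ x, x ^ 3 = 1 ∧ a = x * b :=
  ⟨a / b, by rw [div_pow, h, div_self (pow_ne_zero 3 hb)], by field_simp⟩

theorem orbitOf_coordinateLine_mul {t x : ℂ} (hx : x ^ 3 = 1) :
    orbitOf (coordinateLine (x * t)) = orbitOf (coordinateLine t) := by
  refine orbitOf_mk_eq_of_mono 1 (d := ![1, 1, x ^ 2])
    (vec_cube_eq_one (by norm_num) (by norm_num) (sq_cube_eq_one hx)) _ _ 1 fun i => ?_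
  fin_cases i <;> simp
  linear_combination t * hx

theorem orbitOf_properLine_mul {t x : ℂ} (hx : x ^ 3 = 1) :
    orbitOf (properLine (x * t)) = orbitOf (properLine t) := by
  refine orbitOf_mk_eq_of_mono 1 (d := ![x ^ 2, 1, 1])
    (vec_cube_eq_one (sq_cube_eq_one hx) (by norm_num) (by norm_num)) _ _ 1 fun i => ?_
  fin_cases i <;> simp
  linear_combination t * hx

theorem orbitOf_mk_coordinatePlane {b c : ℂ} (h : ![0, b, c] ≠ 0) :
    orbitOf (Projectivization.mk ℂ ![0, b, c] h) = orbitOf vertexLine ∨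
      ∃ t, t ≠ 0 ∧ orbitOf (Projectivization.mk ℂ ![0, b, c] h) = orbitOf (coordinateLine t) := by
  by_cases hb : b = 0
  · left
    refine orbitOf_mk_eq_of_mono (swap 0 2) (d := 1) (by simp) _ _ c fun i => ?_
    fin_cases i <;> simp [hb, swap_apply_def]
  · by_cases hc : c = 0
    · left
      refine orbitOf_mk_eq_of_mono (swap 0 1) (d := 1) (by simp) _ _ b fun i => ?_
      fin_cases i <;> simp [hc, swap_apply_def]
    · right
      refine ⟨c / b, div_ne_zero hc hb, ?_⟩
      refine orbitOf_mk_eq_of_mono 1 (d := 1) (by simp) _ _ b fun i => ?_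
      fin_cases i <;> simp
      field_simp

theorem orbitOf_coordinateLine_cases {t : ℂ} (ht : t ^ 6 = 1) :
    orbitOf (coordinateLine t) = orbitOf (coordinateLine 1) ∨
      orbitOf (coordinateLine t) = orbitOf (coordinateLine (-1)) := by
  have : (t ^ 3 - 1) * (t ^ 3 + 1) = 0 := by linear_combination ht
  rcases mul_eq_zero.mp this with h | h
  · obtain ⟨x, hx, h⟩ := exists_cube_of_cube_eq (a := t) (b := 1) one_ne_zero
      (by linear_combination h)
    exact Or.inl (h ▸ orbitOf_coordinateLine_mul hx)
  · obtain ⟨x, hx, h⟩ := exists_cube_of_cube_eq (a := t) (b := -1) (by norm_num)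
      (by linear_combination h)
    exact Or.inr (h ▸ orbitOf_coordinateLine_mul hx)

theorem orbitOf_properLine_one : orbitOf (properLine 1) = orbitOf vertexLine := by
  symm
  refine orbitOf_mk_eq_of_had omega_prim (r := 1) (c := 1) (by simp) (by simp) _ _ 1 ?_ ?_ ?_ <;>
    simp

theorem orbitOf_properLine_neg_two :
    orbitOf (properLine (-2)) = orbitOf (coordinateLine 1) := by
  have h := omega_prim
  symm
  refine orbitOf_mk_eq_of_had h (r := 1) (c := 1) (by simp) (by simp) _ _ (-1) ?_ ?_ ?_ <;>
    simp
  · norm_num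
  · linear_combination h
  · linear_combination h

/-- Because of this the two roots of `t ^ 2 - 2 * t - 2` contribute one orbit of size 54 and not
two. -/
theorem orbitOf_properLine_one_sub {s : ℂ} (hs : s ^ 2 = 3) :
    orbitOf (properLine (1 - s)) = orbitOf (properLine (1 + s)) := by
  have h := omega_prim
  have h3 := omega_pow_three
  symm
  refine orbitOf_mk_eq_of_had h (r := ![ω, 1, 1]) (c := ![1, ω, ω])
    (vec_cube_eq_one h3 (by norm_num) (by norm_num))
    (vec_cube_eq_one (by norm_num) h3 h3) _ _ (1 + s - ω) ?_ ?_ ?_ <;> simp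
  · linear_combination hs + 2 * h
  · linear_combination h + h3
  · linear_combination h + h3

theorem orbitOf_properLine_cases {t : ℂ} (h : t = 0 ∨ t ^ 3 = 1 ∨ t ^ 3 = -8 ∨
    t ^ 6 - 20 * t ^ 3 - 8 = 0) :
    orbitOf (properLine t) = orbitOf vertexLine ∨
      orbitOf (properLine t) = orbitOf (coordinateLine 1) ∨
      orbitOf (properLine t) = orbitOf (properLine (1 + (Real.sqrt 3 : ℂ))) := by
  have hs := sqrt_three_sq
  set s := (Real.sqrt 3 : ℂ)
  rcases h with rfl | h | h | h
  -- The line `[0 : 1 : 1]` belongs to both families.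
  · exact Or.inr (Or.inl rfl)
  · obtain ⟨x, hx, rfl⟩ := exists_cube_of_cube_eq (a := t) (b := 1) one_ne_zero
      (by linear_combination h)
    exact Or.inl ((orbitOf_properLine_mul hx).trans orbitOf_properLine_one)
  · obtain ⟨x, hx, rfl⟩ := exists_cube_of_cube_eq (a := t) (b := -2) (by norm_num)
      (by linear_combination h)
    exact Or.inr (Or.inl ((orbitOf_properLine_mul hx).trans orbitOf_properLine_neg_two))
  · right; right
    -- The values `(1 ± s) ^ 3 = 10 ± 6 * s` have sum 20 and product -8.
    have : (t ^ 3 - (1 + s) ^ 3) * (t ^ 3 - (1 + -s) ^ 3) = 0 := by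
      rw [one_add_cube hs, one_add_cube (s := -s) (by linear_combination hs)]
      linear_combination h - 36 * hs
    rcases mul_eq_zero.mp this with h | h
    · obtain ⟨x, hx, rfl⟩ := exists_cube_of_cube_eq (one_add_ne_zero hs) (sub_eq_zero.mp h)
      exact orbitOf_properLine_mul hx
    · obtain ⟨x, hx, rfl⟩ := exists_cube_of_cube_eq
        (one_add_ne_zero (s := -s) (by linear_combination hs)) (sub_eq_zero.mp h)
      rw [orbitOf_properLine_mul hx, ← sub_eq_add_neg]
      exact orbitOf_properLine_one_sub hs

/-- The orbit of `L` meets one of the standard positions of lines with a nontrivial stabilizer. -/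
def IsSpecial (ν : ℂ) (L : Line) : Prop :=
  (∃ b c, ∃ h : ![0, b, c] ≠ 0, orbitOf L = orbitOf (Projectivization.mk ℂ ![0, b, c] h)) ∨
    (∃ t, orbitOf L = orbitOf (properLine t)) ∨ orbitOf L = orbitOf (line ν (ν ^ 2))

theorem IsSpecial.congr {ν : ℂ} {L L' : Line} (h : orbitOf L = orbitOf L') (hL : IsSpecial ν L') :
    IsSpecial ν L := by
  rw [IsSpecial, h]
  exact hL

theorem comp_perm_ne_zero {v : Fin 3 → ℂ} (hv : v ≠ 0) (τ : Perm (Fin 3)) : v ∘ τ ≠ 0 := by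
  intro h
  apply hv
  ext i
  simpa using congrFun h (τ.symm i)

theorem orbitOf_mk_comp {v : Fin 3 → ℂ} (hv : v ≠ 0) (τ : Perm (Fin 3)) :
    orbitOf (Projectivization.mk ℂ v hv) =
      orbitOf (Projectivization.mk ℂ (v ∘ τ) (comp_perm_ne_zero hv τ)) :=
  orbitOf_mk_eq_of_mono τ (d := 1) (by simp) _ _ 1 fun i => by simp

theorem isSpecial_of_eq_zero {v : Fin 3 → ℂ} (hv : v ≠ 0) {i : Fin 3} (hi : v i = 0) (ν : ℂ) :
    IsSpecial ν (Projectivization.mk ℂ v hv) := by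
  left
  have h := orbitOf_mk_comp hv (swap 0 i)
  have he : v ∘ swap 0 i = ![0, v (swap 0 i 1), v (swap 0 i 2)] := by
    ext j
    fin_cases j <;> simp [hi]
  simp only [he] at h
  exact ⟨_, _, _, h⟩

/-- If no coordinate used here vanishes, the eigenvalue is determined by coordinate 0, so `v 1 / v
2` is a cube root of unity and a diagonal matrix moves the line to `[t : 1 : 1]`. -/
theorem isSpecial_of_fixes_swap {v : Fin 3 → ℂ} (hv : v ≠ 0) {d : Fin 3 → ℂ}
    (hd : ∀ i, d i ^ 3 = 1) (h : Fixes (mono (swap 1 2) d) v) (ν : ℂ) :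
    IsSpecial ν (Projectivization.mk ℂ v hv) := by
  by_cases h0 : v 0 = 0
  · exact isSpecial_of_eq_zero hv h0 ν
  by_cases h2 : v 2 = 0
  · exact isSpecial_of_eq_zero hv h2 ν
  obtain ⟨a, ha0, ha1, -⟩ := fixes_mono_iff.mp h
  simp [swap_apply_def] at ha0 ha1
  have ha := ha0.resolve_right h0
  subst ha
  right; left
  refine ⟨v 0 / v 2, ?_⟩
  refine orbitOf_mk_eq_of_mono 1 (d := ![1, d 1 ^ 2 * d 0, 1])
    (vec_cube_eq_one (by norm_num) (mul_cube_eq_one (sq_cube_eq_one (hd 1)) (hd 0)) (by norm_num))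
    _ _ (v 2) fun i => ?_
  fin_cases i <;> simp
  · field_simp
  · linear_combination - d 1 ^ 2 * ha1 + v 2 * hd 1

/-- Going once around the cycle gives `a ^ 3 = d 0 * d 1 * d 2`, so `a` is a ninth root of unity: a
cube root of unity, or one times `ν` or `ν⁻¹`. The first case leads to `[1 : 1 : 1]`, the others to
`[ν : ν² : 1]`. -/
theorem isSpecial_of_fixes_rotate {v : Fin 3 → ℂ} (hv : v ≠ 0) {d : Fin 3 → ℂ}
    (hd : ∀ i, d i ^ 3 = 1) (h : Fixes (mono (finRotate 3) d) v) {ν : ℂ} (hν : orderOf ν = 9) :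
    IsSpecial ν (Projectivization.mk ℂ v hv) := by
  by_cases h0 : v 0 = 0
  · exact isSpecial_of_eq_zero hv h0 ν
  obtain ⟨a, ha0, ha1, ha2⟩ := fixes_mono_iff.mp h
  simp at ha0 ha1 ha2
  have d0 := hd 0
  have d1 := hd 1
  have hd2 := hd 2
  have hv1 : v 1 = a * d 0 ^ 2 * v 0 := by linear_combination d 0 ^ 2 * ha0 - v 1 * d0
  have hv2 : v 2 = a ^ 2 * (d 0 ^ 2 * d 1 ^ 2) * v 0 := by
    linear_combination d 1 ^ 2 * ha1 - v 2 * d1 + a * d 1 ^ 2 * hv1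
  have ha3 : a ^ 3 = d 0 * d 1 * d 2 := by
    refine mul_right_cancel₀ h0 ?_
    rw [hv2] at ha2
    linear_combination - d 0 * d 1 * ha2 - a ^ 3 * v 0 * d 1 ^ 3 * d0 - a ^ 3 * v 0 * d1
  have ha9 : (a ^ 3) ^ 3 = 1 := by
    rw [ha3]
    exact mul_cube_eq_one (mul_cube_eq_one d0 d1) hd2
  have hρ := cube_prim_of_orderOf hν
  have hν9 : ν ^ 9 = 1 := by rw [← hν]; exact pow_orderOf_eq_one ν
  have hν0 : ν ≠ 0 := by
    rintro rfl
    norm_num at hν9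
  rcases eq_of_cube_eq_one hρ ha9 with h | h | h
  · right; left
    refine ⟨1, ?_⟩
    refine orbitOf_mk_eq_of_mono 1 (d := ![1, a ^ 2 * d 0, a * (d 0 * d 1)])
      (vec_cube_eq_one (by norm_num) (mul_cube_eq_one (sq_cube_eq_one h) d0)
        (mul_cube_eq_one h (mul_cube_eq_one d0 d1))) _ _ (v 0) fun i => ?_
    fin_cases i <;> simp
    · rw [hv1]
      linear_combination v 0 * d 0 ^ 3 * h + v 0 * d0
    · rw [hv2]
      linear_combination v 0 * d 0 ^ 3 * d 1 ^ 3 * h + v 0 * d 1 ^ 3 * d0 + v 0 * d1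
  · obtain ⟨u, hu, rfl⟩ := exists_cube_of_cube_eq hν0 h
    right; right
    refine orbitOf_mk_eq_of_mono (finRotate 3) (d := ![u ^ 2 * d 0, u * (d 0 * d 1), 1])
      (vec_cube_eq_one (mul_cube_eq_one (sq_cube_eq_one hu) d0)
        (mul_cube_eq_one hu (mul_cube_eq_one d0 d1)) (by norm_num)) _ _ (v 0) fun i => ?_
    fin_cases i <;> simp
    · rw [hv1]
      linear_combination v 0 * ν * d 0 ^ 3 * hu + v 0 * ν * d0
    · rw [hv2]
      linear_combination v 0 * ν ^ 2 * (d 0 ^ 3 * d 1 ^ 3 * hu + d 1 ^ 3 * d0 + d1)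
  · obtain ⟨u, hu, hua⟩ := exists_cube_of_cube_eq (a := a) (b := ν⁻¹) (inv_ne_zero hν0) (by
      rw [h, inv_pow]
      refine eq_inv_of_mul_eq_one_left ?_
      linear_combination hν9)
    subst hua
    right; right
    refine orbitOf_mk_eq_of_mono (swap 0 1) (d := ![u ^ 2 * d 0, 1, u * (d 0 * d 1)])
      (vec_cube_eq_one (mul_cube_eq_one (sq_cube_eq_one hu) d0) (by norm_num)
        (mul_cube_eq_one hu (mul_cube_eq_one d0 d1))) _ _ (v 0 / ν ^ 2) fun i => ?_
    fin_cases i <;> simp [swap_apply_def]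
    · rw [hv1]
      field_simp
      linear_combination d 0 ^ 3 * hu + d0
    · field_simp
    · rw [hv2]
      field_simp
      linear_combination d 0 ^ 3 * d 1 ^ 3 * hu + d 1 ^ 3 * d0 + d1

theorem fixes_mono_comp {σ : Perm (Fin 3)} {d v : Fin 3 → ℂ} (h : Fixes (mono σ d) v)
    (τ : Perm (Fin 3)) : Fixes (mono (τ⁻¹ * σ * τ) (d ∘ τ)) (v ∘ τ) := by
  have ht : Perm.sign (τ⁻¹ * σ * τ) = Perm.sign σ := by
    rw [Perm.sign_mul, Perm.sign_mul, Perm.sign_inv, mul_right_comm, Int.units_mul_self, one_mul]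
  obtain ⟨a, ha⟩ := h
  refine ⟨a, fun i => ?_⟩
  have := ha (τ i)
  rw [mono_mulVec] at this ⊢
  rw [ht]
  simpa using this

/-- Conjugation by permutations leaves one transposition and one 3-cycle to treat. A nonscalar
diagonal matrix fixes no line whose coordinates are all nonzero. -/
theorem isSpecial_of_fixes_mono {v : Fin 3 → ℂ} (hv : v ≠ 0) {σ : Perm (Fin 3)} {d : Fin 3 → ℂ}
    (hd : ∀ i, d i ^ 3 = 1) (h : Fixes (mono σ d) v) (hns : ¬ IsScalar (mono σ d)) {ν : ℂ}
    (hν : orderOf ν = 9) : IsSpecial ν (Projectivization.mk ℂ v hv) := by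
  have hd' : ∀ τ : Perm (Fin 3), ∀ i, (d ∘ τ) i ^ 3 = 1 := fun τ i => hd _
  rcases perm_three_cases σ with rfl | rfl | rfl | rfl | rfl | rfl
  · by_contra hcon
    have hne : ∀ i, v i ≠ 0 := fun i hi => hcon (isSpecial_of_eq_zero hv hi ν)
    obtain ⟨a, ha0, ha1, ha2⟩ := fixes_mono_iff.mp h
    simp [hne] at ha0 ha1 ha2
    exact hns ((isScalar_mono_iff hd).mpr ⟨rfl, by rw [ha0, ha1], by rw [ha1, ha2]⟩)
  · exact isSpecial_of_fixes_swap hv hd h ν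
  · refine IsSpecial.congr (orbitOf_mk_comp hv (swap 0 2))
      (isSpecial_of_fixes_swap _ (hd' (swap 0 2)) ?_ ν)
    have := fixes_mono_comp h (swap 0 2)
    rwa [show (swap 0 2 : Perm (Fin 3))⁻¹ * swap 0 1 * swap 0 2 = swap 1 2 by decide] at this
  · refine IsSpecial.congr (orbitOf_mk_comp hv (swap 0 1))
      (isSpecial_of_fixes_swap _ (hd' (swap 0 1)) ?_ ν)
    have := fixes_mono_comp h (swap 0 1)
    rwa [show (swap 0 1 : Perm (Fin 3))⁻¹ * swap 0 2 * swap 0 1 = swap 1 2 by decide] at this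
  · exact isSpecial_of_fixes_rotate hv hd h hν
  · refine IsSpecial.congr (orbitOf_mk_comp hv (swap 1 2))
      (isSpecial_of_fixes_rotate _ (hd' (swap 1 2)) ?_ hν)
    have := fixes_mono_comp h (swap 1 2)
    rwa [show (swap 1 2 : Perm (Fin 3))⁻¹ * (finRotate 3)⁻¹ * swap 1 2 = finRotate 3 by decide]
      at this

theorem mul_comm_of_isScalar {A : GL (Fin 3) ℂ} (hA : IsScalar (A : Matrix (Fin 3) (Fin 3) ℂ))
    (B : GL (Fin 3) ℂ) : A * B = B * A := by
  obtain ⟨x, hx⟩ := hA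
  apply Units.ext
  rw [Units.val_mul, Units.val_mul, hx]
  ext i j
  simp [diagonal_mul, mul_diagonal, mul_comm]

theorem fixes_iff_smul {g : GL (Fin 3) ℂ} {v : Fin 3 → ℂ} (hv : v ≠ 0) :
    Fixes (g : Matrix (Fin 3) (Fin 3) ℂ) v ↔
      g • Projectivization.mk ℂ v hv = Projectivization.mk ℂ v hv :=
  (smul_mk_eq_mk_iff g hv hv).symm

theorem isSpecial_of_smul_eq {L : Line} {g : GL (Fin 3) ℂ} (hg : g ∈ G25)
    (hns : ¬ IsScalar (g : Matrix (Fin 3) (Fin 3) ℂ)) (h : g • L = L) {ν : ℂ}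
    (hν : orderOf ν = 9) : IsSpecial ν L := by
  have hmono : ∀ (L : Line) (m : GL (Fin 3) ℂ), IsMono (m : Matrix (Fin 3) (Fin 3) ℂ) →
      ¬ IsScalar (m : Matrix (Fin 3) (Fin 3) ℂ) → m • L = L → IsSpecial ν L := by
    intro L m hm hms hmL
    induction L using Projectivization.ind with
    | h v hv =>
      obtain ⟨σ, d, hd, hm⟩ := hm
      have hf := (fixes_iff_smul hv).mpr hmL
      rw [hm] at hf hms
      exact isSpecial_of_fixes_mono hv hd hf hms hν
  rcases isMono_or_isHad_of_mem hg with hm | ⟨η, r, c, hη, hr, hc, -, hA⟩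
  · exact hmono L g hm hns h
  · rcases exists_conj_isMono hη hr hc hg hA with ⟨hm, hms⟩ | ⟨k, hk, hm⟩
    · exact hmono L (g * g) hm hms (by rw [mul_smul, h, h])
    · refine IsSpecial.congr (orbitOf_smul (inv_mem hk) L).symm (hmono _ _ hm ?_ ?_)
      · intro hs
        apply hns
        have := mul_comm_of_isScalar hs k⁻¹
        have hgk : k⁻¹ * g * k = g := by
          have h1 : k⁻¹ * (k⁻¹ * g * k) = k⁻¹ * g := by
            rw [← this]; group
          exact (mul_left_cancel (a := k⁻¹) h1)
        rwa [hgk] at hs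
      · rw [smul_smul]
        have : k⁻¹ * g * k * k⁻¹ = k⁻¹ * g := by group
        rw [this, mul_smul, h]

theorem line_sqrt_eq : orbitOf (line ((1 + (Real.sqrt 3 : ℂ)) * ω ^ 2) ω) =
    orbitOf (properLine (1 + (Real.sqrt 3 : ℂ))) := by
  refine orbitOf_mk_eq_of_mono 1 (d := ![ω, ω ^ 2, 1])
    (vec_cube_eq_one omega_pow_three omega_sq_pow_three (by norm_num)) _ _ 1 fun i => ?_
  fin_cases i <;> simp
  · linear_combination (1 + (Real.sqrt 3 : ℂ)) * omega_pow_three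
  · linear_combination omega_pow_three

/-- Every orbit of lines has one of eight types of representatives. -/
theorem orbitOf_cases {ν : ℂ} (hν : orderOf ν = 9) (L : Line) :
    (∀ g ∈ G25, g • L = L → IsScalar (g : Matrix (Fin 3) (Fin 3) ℂ)) ∨
    (∃ t, t ≠ 0 ∧ t ^ 6 ≠ 1 ∧ orbitOf L = orbitOf (coordinateLine t)) ∨
    (∃ t, t ≠ 0 ∧ t ^ 3 ≠ 1 ∧ t ^ 3 ≠ -8 ∧ t ^ 6 - 20 * t ^ 3 - 8 ≠ 0 ∧
      orbitOf L = orbitOf (properLine t)) ∨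
    orbitOf L = orbitOf vertexLine ∨ orbitOf L = orbitOf (coordinateLine (-1)) ∨
    orbitOf L = orbitOf (coordinateLine 1) ∨
    orbitOf L = orbitOf (properLine (1 + (Real.sqrt 3 : ℂ))) ∨
    orbitOf L = orbitOf (line ν (ν ^ 2)) := by
  by_cases hL : ∀ g ∈ G25, g • L = L → IsScalar (g : Matrix (Fin 3) (Fin 3) ℂ)
  · exact Or.inl hL
  right
  push Not at hL
  obtain ⟨g, hg, hgL, hns⟩ := hL
  rcases isSpecial_of_smul_eq hg hns hgL hν with ⟨b, c, h, hL⟩ | ⟨t, hL⟩ | hL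
  · rw [hL]
    rcases orbitOf_mk_coordinatePlane h with h | ⟨t, ht, h⟩
    · tauto
    · by_cases ht6 : t ^ 6 = 1
      · have := orbitOf_coordinateLine_cases ht6
        rw [h]
        tauto
      · exact Or.inl ⟨t, ht, ht6, h⟩
  · by_cases ht : t = 0 ∨ t ^ 3 = 1 ∨ t ^ 3 = -8 ∨ t ^ 6 - 20 * t ^ 3 - 8 = 0
    · have := orbitOf_properLine_cases ht
      rw [hL]
      tauto
    · push Not at ht
      exact Or.inr (Or.inl ⟨t, ht.1, ht.2.1, ht.2.2.1, ht.2.2.2, hL⟩)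
  · tauto

/-! ### Reflection planes. -/

/-- The plane with equation `n 0 * w 0 + n 1 * w 1 + n 2 * w 2 = 0`. -/
def plane (n : Fin 3 → ℂ) : Submodule ℂ (Fin 3 → ℂ) :=
  LinearMap.ker (Fintype.linearCombination ℂ n)

theorem mem_plane {n w : Fin 3 → ℂ} :
    w ∈ plane n ↔ n 0 * w 0 + n 1 * w 1 + n 2 * w 2 = 0 := by
  simp [plane, Fintype.linearCombination_apply, Fin.sum_univ_three, mul_comm]

theorem finrank_plane {n : Fin 3 → ℂ} (hn : n ≠ 0) : Module.finrank ℂ (plane n) = 2 := by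
  have hne : (Fintype.linearCombination ℂ n : Module.Dual ℂ (Fin 3 → ℂ)) ≠ 0 := by
    intro h
    apply hn
    ext i
    have := LinearMap.congr_fun h (Pi.single i 1)
    simpa [Fintype.linearCombination_apply, Pi.single_apply] using this
  have := Module.Dual.finrank_ker_add_one_of_ne_zero hne
  simp only [Module.finrank_fin_fun] at this
  exact Nat.succ_injective this

theorem eq_plane_of_le {P : Submodule ℂ (Fin 3 → ℂ)} (hP : Module.finrank ℂ P = 2)
    {n : Fin 3 → ℂ} (hn : n ≠ 0) (h : ∀ w ∈ P, n 0 * w 0 + n 1 * w 1 + n 2 * w 2 = 0) :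
    P = plane n :=
  Submodule.eq_of_le_of_finrank_eq (fun w hw => mem_plane.mpr (h w hw))
    (by rw [hP, finrank_plane hn])

theorem plane_smul (n : Fin 3 → ℂ) {a : ℂ} (ha : a ≠ 0) : plane (fun i => a * n i) = plane n := by
  ext w
  rw [mem_plane, mem_plane]
  constructor
  · intro h
    exact (mul_eq_zero.mp (by linear_combination h :
      a * (n 0 * w 0 + n 1 * w 1 + n 2 * w 2) = 0)).resolve_left ha
  · intro h
    linear_combination a * h

theorem single_one_ne_zero (i : Fin 3) : (Pi.single i 1 : Fin 3 → ℂ) ≠ 0 := by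
  simp

theorem mem_plane_single {i : Fin 3} {w : Fin 3 → ℂ} :
    w ∈ plane (Pi.single i 1) ↔ w i = 0 := by
  rw [mem_plane]
  fin_cases i <;> simp

theorem coe_mulVec_of_smul_eq {g : GL (Fin 3) ℂ} {w : Fin 3 → ℂ} (h : g • w = w) (i : Fin 3) :
    ((g : Matrix (Fin 3) (Fin 3) ℂ) *ᵥ w) i = w i :=
  congrFun h i

theorem eq_plane_of_diagonal {P : Submodule ℂ (Fin 3 → ℂ)} (hP : Module.finrank ℂ P = 2)
    {d : Fin 3 → ℂ} (h : ∀ w ∈ P, ∀ i, (mono 1 d *ᵥ w) i = w i) (hd : d ≠ 1) :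
    ∃ i, P = plane (Pi.single i 1) := by
  obtain ⟨i, hi⟩ := Function.ne_iff.mp hd
  refine ⟨i, eq_plane_of_le hP (single_one_ne_zero i) fun w hw => ?_⟩
  rw [← mem_plane, mem_plane_single]
  have := h w hw i
  rw [mono_mulVec] at this
  simp only [Perm.sign_one, Perm.one_apply] at this
  push_cast at this
  have h1 : (d i - 1) * w i = 0 := by linear_combination this
  exact (mul_eq_zero.mp h1).resolve_left (sub_ne_zero.mpr hi)

/-- A row `i` moved by `σ` forces `P` to be `w i = sign σ * d i * w (σ i)`, which contains the
remaining basis vector. This one is moved by `σ`, or multiplied by `-d k ≠ 1`: the sign prevents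
transpositions from being reflections. -/
theorem not_fixed_plane_of_perm {P : Submodule ℂ (Fin 3 → ℂ)} (hP : Module.finrank ℂ P = 2)
    {σ : Perm (Fin 3)} {d : Fin 3 → ℂ} (hd : ∀ i, d i ^ 3 = 1)
    (h : ∀ w ∈ P, ∀ i, (mono σ d *ᵥ w) i = w i) : σ = 1 := by
  by_contra hσ
  have key : ∀ σ : Perm (Fin 3), σ ≠ 1 → ∃ i k, σ i ≠ i ∧ k ≠ i ∧ k ≠ σ i ∧
      (σ k ≠ k ∨ Perm.sign σ = -1) := by decide
  obtain ⟨i, k, hi, hki, hkσ, hk⟩ := key σ hσ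
  set s : ℂ := ((Perm.sign σ : ℤ) : ℂ) with hs
  set n : Fin 3 → ℂ := Pi.single i 1 - Pi.single (σ i) (s * d i) with hn
  have hni : n i = 1 := by simp [hn, hi.symm]
  have hmem : ∀ w : Fin 3 → ℂ, n 0 * w 0 + n 1 * w 1 + n 2 * w 2 = w i - s * d i * w (σ i) := by
    intro w
    have : n 0 * w 0 + n 1 * w 1 + n 2 * w 2 = ∑ j, n j * w j := by rw [Fin.sum_univ_three]
    rw [this]
    simp [hn, sub_mul, Finset.sum_sub_distrib, Pi.single_apply]
  have hPn : P = plane n := by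
    refine eq_plane_of_le hP (fun h0 => by simp [h0] at hni) fun w hw => ?_
    have := h w hw i
    rw [mono_mulVec] at this
    rw [hmem, ← this, sub_self]
  have hk' := h (Pi.single k 1) (by
    rw [hPn, mem_plane, hmem]
    simp [hki.symm, hkσ.symm]) k
  rw [mono_mulVec] at hk'
  by_cases hkk : σ k = k
  · have hsgn := hk.resolve_left (not_not.mpr hkk)
    have := hd k
    simp [hkk, hsgn] at hk'
    have h1 : d k = -1 := by linear_combination -hk'
    rw [h1] at this
    norm_num at this
  · simp [hkk] at hk'

theorem eq_plane_of_had {P : Submodule ℂ (Fin 3 → ℂ)} (hP : Module.finrank ℂ P = 2)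
    {η : ℂ} (hη : η ^ 2 + η + 1 = 0) {r c : Fin 3 → ℂ} (hr : ∀ i, r i ^ 3 = 1)
    (hc : ∀ i, c i ^ 3 = 1) (hr0 : r 0 = 1) (h : ∀ w ∈ P, ∀ i, (had η r c *ᵥ w) i = w i) :
    P = plane ![1, η * c 1, η * c 2] := by
  have hθ := prim_sub_ne_zero hη
  have h3 := prim_pow_three hη
  have hη1 := prim_ne_one hη
  have hη0 := ne_zero_of_cube h3
  have c1 := ne_zero_of_cube (hc 1)
  have c2 := ne_zero_of_cube (hc 2)
  have r1 := ne_zero_of_cube (hr 1)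
  set θ := η - η ^ 2 with hθdef
  have hrow0 : ∀ w ∈ P, c 0 * w 0 + c 1 * w 1 + c 2 * w 2 = θ * w 0 := fun w hw => by
    have := h w hw 0
    rw [had_mulVec, ← hθdef] at this
    simp [hr0] at this
    field_simp at this
    linear_combination this
  have hrow1 : ∀ w ∈ P, r 1 * (c 0 * w 0 + c 1 * η * w 1 + c 2 * η ^ 2 * w 2) = θ * w 1 :=
    fun w hw => by
    have := h w hw 1
    rw [had_mulVec, ← hθdef] at this
    simp at this
    field_simp at this
    linear_combination this
  have hPn : P = plane ![c 0 - θ, c 1, c 2] := by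
    refine eq_plane_of_le hP (fun h0 => c1 (congrFun h0 1)) fun w hw => ?_
    simp
    linear_combination hrow0 w hw
  -- A vector of the plane cut out by row 0; row 1 applied to it forces `c 0 = η`.
  have hy := hrow1 ![c 2, 0, -(c 0 - θ)] (by rw [hPn, mem_plane]; simp; ring)
  simp at hy
  have hc0 : c 0 = η := by
    rcases hy with hy | hy
    · exact absurd hy r1
    have h1 : (1 - η ^ 2) * (c 0 - η) = 0 := by
      refine (mul_eq_zero.mp (?_ : c 2 * ((1 - η ^ 2) * (c 0 - η)) = 0)).resolve_left c2
      rw [hθdef] at hy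
      linear_combination hy + c 2 * η * h3
    refine sub_eq_zero.mp ((mul_eq_zero.mp h1).resolve_left fun h => hη1 ?_)
    linear_combination η * h + h3
  have hn : ![c 0 - θ, c 1, c 2] = fun i => η ^ 2 * ![1, η * c 1, η * c 2] i := by
    ext i
    fin_cases i <;> simp
    · rw [hc0, hθdef]; ring
    · linear_combination -c 1 * h3
    · linear_combination -c 2 * h3
  rw [hPn, hn, plane_smul _ (pow_ne_zero 2 hη0)]

theorem isReflectionPlane_single (i : Fin 3) : IsReflectionPlane (plane (Pi.single i 1)) := by
  refine ⟨finrank_plane (single_one_ne_zero i), ?_⟩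
  obtain ⟨g, hg, hgm⟩ := inG25_mono 1 (d := Function.update 1 i ω) (fun j => by
    by_cases hj : j = i
    · subst hj; simp [omega_pow_three]
    · simp [hj])
  have hω := prim_ne_one omega_prim
  refine ⟨g, hg, ?_, fun v hv => ?_⟩
  · rintro rfl
    have := congrFun (congrFun hgm i) i
    simp [mono] at this
    exact hω this.symm
  · rw [mem_plane_single] at hv
    ext j
    change ((g : Matrix (Fin 3) (Fin 3) ℂ) *ᵥ v) j = v j
    rw [hgm, mono_mulVec]
    by_cases hj : j = i
    · subst hj; simp [hv]
    · simp [hj]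

/-- The column factors are those dictated by `eq_plane_of_had`: `c 0 = ω`, and `ω * c 1 = y`, `ω * c
2 = z`. -/
theorem isReflectionPlane_cube {y z : ℂ} (hy : y ^ 3 = 1) (hz : z ^ 3 = 1) :
    IsReflectionPlane (plane ![1, y, z]) := by
  have hω := omega_prim
  have h3 := omega_pow_three
  refine ⟨finrank_plane (fun h => one_ne_zero (congrFun h 0)), ?_⟩
  have hr : ∀ i, ![1, ω * y ^ 2, ω * z ^ 2] i ^ 3 = 1 := vec_cube_eq_one (by norm_num)
    (mul_cube_eq_one h3 (sq_cube_eq_one hy)) (mul_cube_eq_one h3 (sq_cube_eq_one hz))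
  have hc : ∀ i, ![ω, ω ^ 2 * y, ω ^ 2 * z] i ^ 3 = 1 := vec_cube_eq_one h3
    (mul_cube_eq_one (sq_cube_eq_one h3) hy) (mul_cube_eq_one (sq_cube_eq_one h3) hz)
  obtain ⟨g, hg, hgm⟩ := inG25_had hω hr hc
  refine ⟨g, hg, ?_, fun v hv => ?_⟩
  · rintro rfl
    refine not_isScalar_had hω hr hc ⟨1, ?_⟩
    rw [← hgm]
    simp
  · rw [mem_plane] at hv
    simp at hv
    have hv0 : v 0 = - (y * v 1 + z * v 2) := by linear_combination hv
    ext j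
    change ((g : Matrix (Fin 3) (Fin 3) ℂ) *ᵥ v) j = v j
    rw [hgm, had_mulVec, prim_inv_sub hω]
    have h4 : ω ^ 4 = ω := by linear_combination ω * h3
    fin_cases j <;> simp [hv0, h4]
    · grind
    · grind
    · grind

theorem isReflectionPlane_iff {P : Submodule ℂ (Fin 3 → ℂ)} : IsReflectionPlane P ↔
    (∃ i, P = plane (Pi.single i 1)) ∨ ∃ y z : ℂ, y ^ 3 = 1 ∧ z ^ 3 = 1 ∧ P = plane ![1, y, z] := by
  constructor
  · rintro ⟨hP, g, hg, hg1, hfix⟩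
    have hfix' : ∀ w ∈ P, ∀ i, ((g : Matrix (Fin 3) (Fin 3) ℂ) *ᵥ w) i = w i :=
      fun w hw i => coe_mulVec_of_smul_eq (hfix w hw) i
    rcases isMono_or_isHad_of_mem hg with ⟨σ, d, hd, hA⟩ | ⟨η, r, c, hη, hr, hc, hr0, hA⟩
    · rw [hA] at hfix'
      have hσ := not_fixed_plane_of_perm hP hd hfix'
      subst hσ
      refine Or.inl (eq_plane_of_diagonal hP hfix' ?_)
      rintro rfl
      exact hg1 (Units.ext (hA.trans mono_one_one))
    · rw [hA] at hfix'
      have h3 := prim_pow_three hη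
      exact Or.inr ⟨_, _, mul_cube_eq_one h3 (hc 1), mul_cube_eq_one h3 (hc 2),
        eq_plane_of_had hP hη hr hc hr0 hfix'⟩
  · rintro (⟨i, rfl⟩ | ⟨y, z, hy, hz, rfl⟩)
    · exact isReflectionPlane_single i
    · exact isReflectionPlane_cube hy hz

theorem numReflectionPlanes_mk {v : Fin 3 → ℂ} (hv : v ≠ 0) :
    numReflectionPlanes (Projectivization.mk ℂ v hv) =
      {P | IsReflectionPlane P ∧ v ∈ P}.encard := by
  simp only [numReflectionPlanes, Projectivization.submodule_mk, Submodule.span_singleton_le_iff_mem]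

theorem plane_single_injective : Function.Injective fun i : Fin 3 =>
    plane (Pi.single i 1 : Fin 3 → ℂ) := by
  intro i j hij
  by_contra hne
  have : (Pi.single j 1 : Fin 3 → ℂ) ∈ plane (Pi.single i 1 : Fin 3 → ℂ) := by
    rw [mem_plane_single, Pi.single_eq_of_ne hne]
  simp only at hij
  rw [hij, mem_plane_single] at this
  simp at this

theorem plane_single_ne_plane (i : Fin 3) {y z : ℂ} (hy : y ^ 3 = 1) (hz : z ^ 3 = 1) :
    plane (Pi.single i 1) ≠ plane ![1, y, z] := by
  intro h
  have hy0 := ne_zero_of_cube hy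
  have hz0 := ne_zero_of_cube hz
  fin_cases i
  · have : ![0, 1, 0] ∈ plane ![1, y, z] := h ▸ (mem_plane_single.mpr (by simp))
    simp [mem_plane, hy0] at this
  · have : ![1, 0, 0] ∈ plane ![1, y, z] := h ▸ (mem_plane_single.mpr (by simp))
    simp [mem_plane] at this
  · have : ![1, 0, 0] ∈ plane ![1, y, z] := h ▸ (mem_plane_single.mpr (by simp))
    simp [mem_plane] at this

theorem numReflectionPlanes_vertexLine : numReflectionPlanes vertexLine = 2 := by
  rw [numReflectionPlanes_mk]
  have : {P | IsReflectionPlane P ∧ ![1, 0, 0] ∈ P} =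
      {plane (Pi.single 1 1), plane (Pi.single 2 1)} := by
    ext P
    simp only [Set.mem_ofPred_eq, Set.mem_insert_iff, Set.mem_singleton_iff, isReflectionPlane_iff]
    constructor
    · rintro ⟨⟨i, rfl⟩ | ⟨y, z, hy, hz, rfl⟩, h⟩
      · fin_cases i <;> simp [mem_plane_single] at h ⊢
      · simp [mem_plane] at h
    · rintro (rfl | rfl)
      · exact ⟨Or.inl ⟨_, rfl⟩, by simp [mem_plane_single]⟩
      · exact ⟨Or.inl ⟨_, rfl⟩, by simp [mem_plane_single]⟩
  rw [this, Set.encard_pair (plane_single_injective.ne (by decide))]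

theorem numReflectionPlanes_coordinateLine {t : ℂ} (ht : t ≠ 0) (ht1 : t ^ 3 ≠ -1) :
    numReflectionPlanes (coordinateLine t) = 1 := by
  rw [numReflectionPlanes_mk]
  have : {P | IsReflectionPlane P ∧ ![0, 1, t] ∈ P} = {plane (Pi.single 0 1)} := by
    ext P
    simp only [Set.mem_ofPred_eq, Set.mem_singleton_iff, isReflectionPlane_iff]
    constructor
    · rintro ⟨⟨i, rfl⟩ | ⟨y, z, hy, hz, rfl⟩, h⟩
      · fin_cases i <;> simp [mem_plane_single, ht] at h ⊢
      · simp [mem_plane] at h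
        have h1 : y = - (z * t) := by linear_combination h
        rw [h1] at hy
        exact absurd (by linear_combination -hy - t ^ 3 * hz) ht1
    · rintro rfl
      exact ⟨Or.inl ⟨_, rfl⟩, by simp [mem_plane_single]⟩
  rw [this, Set.encard_singleton]

theorem numReflectionPlanes_center : numReflectionPlanes (coordinateLine (-1)) = 4 := by
  rw [numReflectionPlanes_mk]
  have hinj : Function.Injective fun e : Fin 3 => plane ![1, root e, root e] := by
    intro a b hab
    simp only at hab
    have : ![-root a, 1, 0] ∈ plane ![1, root b, root b] := by
      rw [← hab, mem_plane]; simp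
    rw [mem_plane] at this
    simp at this
    exact root_injective (by linear_combination -this)
  have : {P | IsReflectionPlane P ∧ ![0, 1, -1] ∈ P} =
      insert (plane (Pi.single 0 1)) (Set.range fun e : Fin 3 => plane ![1, root e, root e]) := by
    ext P
    simp only [Set.mem_ofPred_eq, Set.mem_insert_iff, Set.mem_range, isReflectionPlane_iff]
    constructor
    · rintro ⟨⟨i, rfl⟩ | ⟨y, z, hy, hz, rfl⟩, h⟩
      · fin_cases i <;> simp [mem_plane_single] at h ⊢
      · simp [mem_plane] at h
        obtain ⟨e, he⟩ := exists_root_eq hy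
        right
        refine ⟨e, ?_⟩
        rw [he, show z = y by linear_combination -h]
    · rintro (rfl | ⟨e, rfl⟩)
      · exact ⟨Or.inl ⟨_, rfl⟩, by simp [mem_plane_single]⟩
      · exact ⟨Or.inr ⟨_, _, root_pow_three e, root_pow_three e, rfl⟩, by simp [mem_plane]⟩
  rw [this, Set.encard_insert_of_notMem, ← Set.image_univ, hinj.encard_image, Set.encard_univ]
  · simp
    norm_num
  · rintro ⟨e, he⟩
    exact plane_single_ne_plane 0 (root_pow_three e) (root_pow_three e) he.symm

/-- If `y = z` then `t = -2 * y`; otherwise `t` is the third cube root of unity. -/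
theorem cube_of_add_add_eq_zero {t y z : ℂ} (hy : y ^ 3 = 1) (hz : z ^ 3 = 1)
    (h : t + y + z = 0) : t ^ 3 = 1 ∨ t ^ 3 = -8 := by
  obtain ⟨x, hx, rfl⟩ := exists_cube_of_cube_eq (ne_zero_of_cube hy) (hz.trans hy.symm)
  by_cases hx1 : x = 1
  · right
    have : t = -2 * y := by rw [hx1] at h; linear_combination h
    rw [this]
    linear_combination -8 * hy
  · left
    have hp := prim_of_cube_ne_one hx hx1
    have : t = x ^ 2 * y := by linear_combination h - y * hp
    rw [this, mul_pow, sq_cube_eq_one hx, hy, one_mul]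

theorem isRegularVector_properLine {t : ℂ} (ht : t ≠ 0) (ht1 : t ^ 3 ≠ 1) (ht8 : t ^ 3 ≠ -8) :
    IsRegularVector ![t, 1, 1] := by
  intro P hP h
  rw [isReflectionPlane_iff] at hP
  rcases hP with ⟨i, rfl⟩ | ⟨y, z, hy, hz, rfl⟩
  · fin_cases i <;> simp [mem_plane_single, ht] at h
  · simp [mem_plane] at h
    have := cube_of_add_add_eq_zero hy hz h
    tauto

theorem numReflectionPlanes_eq_zero_of_regular {v : Fin 3 → ℂ} (hv : v ≠ 0) (h : IsRegularVector v) :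
    numReflectionPlanes (Projectivization.mk ℂ v hv) = 0 := by
  rw [numReflectionPlanes_mk, Set.encard_eq_zero, Set.eq_empty_iff_forall_notMem]
  rintro P ⟨hP, hvP⟩
  exact h P hP hvP

theorem isRegularVector_orderNine {ν : ℂ} (hν : orderOf ν = 9) :
    IsRegularVector ![ν, ν ^ 2, 1] := by
  have hν0 : ν ≠ 0 := by
    rintro rfl
    simp at hν
  intro P hP h
  rw [isReflectionPlane_iff] at hP
  rcases hP with ⟨i, rfl⟩ | ⟨y, z, hy, hz, rfl⟩
  · fin_cases i <;> simp [mem_plane_single, hν0] at h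
  · simp [mem_plane] at h
    have h3 := omega_pow_three
    -- Zero is not a cube root of unity, so the vanishing combination is compared with its own
    -- multiple by `ω`.
    obtain ⟨h1, -, -⟩ := cube_root_combination_inj hν (x := z) (y := 1) (z := y) (x' := ω * z)
      (y' := ω) (z' := ω * y) hz (by norm_num) hy (mul_cube_eq_one h3 hz) h3 (mul_cube_eq_one h3 hy)
      (by linear_combination (1 - ω) * h)
    refine prim_ne_one omega_prim (mul_right_cancel₀ (ne_zero_of_cube hz) ?_)
    rw [one_mul, ← h1]

/-! ### Proper planes. -/

theorem mem_eigenspace {g : GL (Fin 3) ℂ} {ζ : ℂ} {v : Fin 3 → ℂ} :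
    v ∈ eigenspace g ζ ↔ ∀ i, ((g : Matrix (Fin 3) (Fin 3) ℂ) *ᵥ v) i = ζ * v i := by
  rw [eigenspace, Module.End.mem_eigenspace_iff, funext_iff]
  rfl

theorem cube_eq_neg_one_of_orderOf {ζ : ℂ} (hζ : orderOf ζ = 6) : ζ ^ 3 = -1 := by
  have h6 : ζ ^ 6 = 1 := hζ ▸ pow_orderOf_eq_one ζ
  have h : (ζ ^ 3 - 1) * (ζ ^ 3 + 1) = 0 := by linear_combination h6
  rcases mul_eq_zero.mp h with h | h
  · have := orderOf_dvd_of_pow_eq_one (sub_eq_zero.mp h)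
    rw [hζ] at this
    norm_num at this
  · linear_combination h

theorem orderOf_neg_omega : orderOf (-ω) = 6 := by
  have h3 := omega_pow_three
  refine orderOf_eq_of_pow_and_pow_div_prime (by norm_num) ?_ ?_
  · linear_combination (ω ^ 3 + 1) * h3
  · intro p hp hpd
    have : p ≤ 6 := Nat.le_of_dvd (by norm_num) hpd
    interval_cases p <;> first | omega | norm_num at hp
    · intro h
      norm_num at h
      have : (1 : ℂ) = -1 := by linear_combination -h - h3
      norm_num at this
    · intro h
      norm_num at h
      rcases h with h | h
      · exact prim_ne_one omega_prim h
      · rw [h] at h3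
        norm_num at h3

/-- The plane with equation `w (k + 1) = u * w (k + 2)`. -/
def mirror (k : Fin 3) (u : ℂ) : Submodule ℂ (Fin 3 → ℂ) :=
  LinearMap.ker (LinearMap.proj (R := ℂ) (φ := fun _ : Fin 3 => ℂ) (k + 1) -
    u • LinearMap.proj (R := ℂ) (φ := fun _ : Fin 3 => ℂ) (k + 2))

theorem mem_mirror {k : Fin 3} {u : ℂ} {w : Fin 3 → ℂ} :
    w ∈ mirror k u ↔ w (k + 1) = u * w (k + 2) := by
  simp [mirror, sub_eq_zero]

theorem add_one_ne (k : Fin 3) : k + 1 ≠ k ∧ k + 2 ≠ k ∧ k + 1 ≠ k + 2 := by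
  revert k; decide

theorem mirror_injective : Function.Injective fun p : Fin 3 × Fin 3 => mirror p.1 (root p.2) := by
  rintro ⟨k, e⟩ ⟨l, f⟩ h
  simp only at h
  obtain ⟨h1, h2, h3⟩ := add_one_ne k
  have hmem : ∀ w : Fin 3 → ℂ, w (k + 1) = root e * w (k + 2) ↔ w (l + 1) = root f * w (l + 2) :=
    fun w => by rw [← mem_mirror, ← mem_mirror, h]
  have hf := ne_zero_of_cube (root_pow_three f)
  have hkl : k = l := by
    have key : ∀ k l : Fin 3, k = l ∨ (l + 1 = k ∧ l + 2 ≠ k) ∨ (l + 1 ≠ k ∧ l + 2 = k) := by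
      decide
    have := (hmem (Pi.single k 1)).mp (by simp [h1, h2])
    rcases key k l with h | ⟨h, h'⟩ | ⟨h, h'⟩
    · exact h
    · simp [h, h'] at this
    · simp [h, h', hf.symm] at this
  subst hkl
  have := (hmem (Pi.single (k + 1) (root e) + Pi.single (k + 2) 1)).mp (by simp [h3, h3.symm])
  simp [h3, h3.symm] at this
  rw [root_injective this]

theorem IsRegularVector.apply_ne_zero {w : Fin 3 → ℂ} (hw : IsRegularVector w) (i : Fin 3) :
    w i ≠ 0 :=
  fun h => hw _ (isReflectionPlane_single i) (mem_plane_single.mpr h)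

/-- For an even `σ`, the product of the three eigenvalue equations gives `∏ d = ζ ^ 3 = -1`, while
`∏ d` is a cube root of unity. So `σ` is a transposition fixing some `k`, the eigenvalue is `-d k`,
and the remaining two equations are proportional. -/
theorem exists_mirror_of_mono {σ : Perm (Fin 3)} {d : Fin 3 → ℂ} (hd : ∀ i, d i ^ 3 = 1) {ζ : ℂ}
    (hζ : orderOf ζ = 6) {w : Fin 3 → ℂ} (hw : ∀ i, w i ≠ 0)
    (h : ∀ i, (mono σ d *ᵥ w) i = ζ * w i) :
    ∃ k u, u ^ 3 = 1 ∧ ∀ v : Fin 3 → ℂ,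
      (∀ i, (mono σ d *ᵥ v) i = ζ * v i) ↔ v (k + 1) = u * v (k + 2) := by
  have hz := cube_eq_neg_one_of_orderOf hζ
  have hz1 : ζ ^ 3 ≠ 1 := by rw [hz]; norm_num
  simp only [mono_mulVec] at h ⊢
  have key : ∀ σ : Perm (Fin 3), σ = 1 ∨ Perm.sign σ = 1 ∨
      ∃ k : Fin 3, σ = swap (k + 1) (k + 2) := by decide
  rcases key σ with rfl | hs | ⟨k, rfl⟩
  · have := h 0
    simp at this
    have h0 : d 0 = ζ := this.resolve_right (hw 0)
    exact absurd (h0 ▸ hd 0) hz1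
  · have hp : ∏ i, w (σ i) = ∏ i, w i := Equiv.prod_comp σ w
    have hp0 : ∏ i, w i ≠ 0 := Finset.prod_ne_zero_iff.mpr fun i _ => hw i
    have hprod : (∏ i, d i) * ∏ i, w i = ζ ^ 3 * ∏ i, w i := by
      have : ∏ i, (d i * w (σ i)) = ∏ i, (ζ * w i) := by
        refine Finset.prod_congr rfl fun i _ => ?_
        simpa [hs] using h i
      rw [Finset.prod_mul_distrib, hp, Finset.prod_mul_distrib] at this
      simpa only [Finset.prod_const, Finset.card_univ, Fintype.card_fin] using this
    have hd3 := mul_right_cancel₀ hp0 hprod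
    have : (∏ i, d i) ^ 3 = 1 := by
      rw [← Finset.prod_pow]
      exact Finset.prod_eq_one fun i _ => hd i
    rw [hd3, hz] at this
    norm_num at this
  · obtain ⟨h1, h2, h3⟩ := add_one_ne k
    have hsgn : Perm.sign (swap (k + 1) (k + 2)) = -1 := Perm.sign_swap h3
    have hk := h k
    have hk1 := h (k + 1)
    have hk2 := h (k + 2)
    rw [swap_apply_of_ne_of_ne h1.symm h2.symm] at hk
    rw [swap_apply_left] at hk1
    rw [swap_apply_right] at hk2
    simp only [hsgn] at hk hk1 hk2 ⊢
    push_cast at hk hk1 hk2 ⊢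
    have hζk : ζ = - d k := mul_right_cancel₀ (hw k) (by linear_combination -hk)
    have hdd : d (k + 1) * d (k + 2) = d k ^ 2 := by
      refine mul_right_cancel₀ (mul_ne_zero (hw (k + 1)) (hw (k + 2))) ?_
      rw [hζk] at hk1 hk2
      linear_combination d (k + 2) * w (k + 1) * (-hk1) + d k * w (k + 1) * (-hk2)
    have hdk := hd k
    have d0 := ne_zero_of_cube hdk
    refine ⟨k, d (k + 1) * d k ^ 2, mul_cube_eq_one (hd _) (sq_cube_eq_one hdk), fun v => ?_⟩
    constructor
    · intro hv
      have := hv (k + 1)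
      rw [swap_apply_left, hζk] at this
      refine mul_left_cancel₀ d0 ?_
      linear_combination this - d (k + 1) * v (k + 2) * hdk
    · intro hv i
      have hi : ∀ k i : Fin 3, i = k ∨ i = k + 1 ∨ i = k + 2 := by decide
      rw [hζk]
      rcases hi k i with rfl | rfl | rfl
      · rw [swap_apply_of_ne_of_ne h1.symm h2.symm]; ring
      · rw [swap_apply_left]
        linear_combination d k * hv + d (k + 1) * v (k + 2) * hdk
      · rw [swap_apply_right]
        linear_combination -d (k + 2) * hv - d k ^ 2 * v (k + 2) * hdd - d k * v (k + 2) * hdk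

theorem isProperPlane_mirror (k : Fin 3) {u : ℂ} (hu : u ^ 3 = 1) : IsProperPlane (mirror k u) := by
  obtain ⟨h1, h2, h3⟩ := add_one_ne k
  have h12 := h3.symm
  have hω := omega_pow_three
  have hω0 := omega_ne_zero
  have hu0 := ne_zero_of_cube hu
  set d : Fin 3 → ℂ := Function.update (Function.update (fun _ => ω) (k + 1) (u * ω)) (k + 2)
    (u ^ 2 * ω) with hddef
  have dk : d k = ω := by simp [hddef, h1.symm, h2.symm]
  have dk1 : d (k + 1) = u * ω := by simp [hddef, h3]
  have dk2 : d (k + 2) = u ^ 2 * ω := by simp [hddef]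
  have hi : ∀ k i : Fin 3, i = k ∨ i = k + 1 ∨ i = k + 2 := by decide
  have hd : ∀ i, d i ^ 3 = 1 := by
    intro i
    rcases hi k i with rfl | rfl | rfl
    · rw [dk, hω]
    · rw [dk1, mul_cube_eq_one hu hω]
    · rw [dk2, mul_cube_eq_one (sq_cube_eq_one hu) hω]
  -- A regular vector of the mirror: its coordinates are nonzero, and since `5 ^ 3` is neither 1 nor
  -- -8, `cube_of_add_add_eq_zero` keeps it off the other reflection planes.
  set w : Fin 3 → ℂ := Function.update (Function.update (fun _ => 1) k 5) (k + 1) u with hwdef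
  have wk : w k = 5 := by simp [hwdef, h1.symm]
  have wk1 : w (k + 1) = u := by simp [hwdef]
  have wk2 : w (k + 2) = 1 := by simp [hwdef, h2, h12]
  obtain ⟨g, hg, hgm⟩ := inG25_mono (swap (k + 1) (k + 2)) hd
  refine ⟨g, hg, -ω, orderOf_neg_omega, ?_, w, ?_, ?_⟩
  · have hsgn : Perm.sign (swap (k + 1) (k + 2)) = -1 := Perm.sign_swap h3
    ext v
    rw [mem_mirror, mem_eigenspace, hgm]
    simp only [mono_mulVec, hsgn]
    push_cast
    constructor
    · intro hv i
      rcases hi k i with rfl | rfl | rfl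
      · rw [swap_apply_of_ne_of_ne h1.symm h2.symm, dk]; ring
      · rw [swap_apply_left, dk1, hv]; ring
      · rw [swap_apply_right, dk2, hv]
        linear_combination -ω * v (k + 2) * hu
    · intro hv
      have := hv (k + 1)
      rw [swap_apply_left, dk1] at this
      refine mul_left_cancel₀ hω0 ?_
      linear_combination this
  · rw [mem_mirror, wk1, wk2, mul_one]
  · intro P hP h
    rw [isReflectionPlane_iff] at hP
    rcases hP with ⟨i, rfl⟩ | ⟨y, z, hy, hz, rfl⟩
    · rw [mem_plane_single] at h
      rcases hi k i with rfl | rfl | rfl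
      · rw [wk] at h; norm_num at h
      · exact hu0 (wk1 ▸ h)
      · rw [wk2] at h; norm_num at h
    · rw [mem_plane] at h
      have hsum : ∀ k : Fin 3, ![1, y, z] 0 * w 0 + ![1, y, z] 1 * w 1 + ![1, y, z] 2 * w 2 =
          ![1, y, z] k * w k + ![1, y, z] (k + 1) * w (k + 1) + ![1, y, z] (k + 2) * w (k + 2) := by
        intro k
        fin_cases k <;> simp <;> ring
      have hc : ∀ i, ![1, y, z] i ^ 3 = 1 := vec_cube_eq_one (by norm_num) hy hz
      rw [hsum k, wk, wk1, wk2] at h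
      have h5 := cube_of_add_add_eq_zero (mul_cube_eq_one (hc (k + 1)) hu)
        (mul_cube_eq_one (hc (k + 2)) (one_pow 3)) h
      rw [mul_pow, hc k] at h5
      norm_num at h5

/-- If no element of `G25` outside the monomial group has `v` as an eigenvector for an eigenvalue of
order `6`, then the proper planes through `v` are mirrors. -/
theorem numProperPlanes_mk {v : Fin 3 → ℂ} (hv : v ≠ 0)
    (h : ∀ η : ℂ, η ^ 2 + η + 1 = 0 → ∀ r c : Fin 3 → ℂ, (∀ i, r i ^ 3 = 1) → (∀ i, c i ^ 3 = 1) →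
      r 0 = 1 → ∀ ζ : ℂ, orderOf ζ = 6 → ¬ ∀ i, (had η r c *ᵥ v) i = ζ * v i) :
    numProperPlanes (Projectivization.mk ℂ v hv) =
      {p : Fin 3 × Fin 3 | v (p.1 + 1) = root p.2 * v (p.1 + 2)}.encard := by
  rw [← mirror_injective.encard_image]
  simp only [numProperPlanes, Projectivization.submodule_mk, Submodule.span_singleton_le_iff_mem]
  congr 1
  ext E
  constructor
  · rintro ⟨⟨g, hg, ζ, hζ, rfl, w, hwE, hw⟩, hvE⟩
    have hvE' := hvE
    rw [mem_eigenspace] at hwE hvE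
    rcases isMono_or_isHad_of_mem hg with ⟨σ, d, hd, hA⟩ | ⟨η, r, c, hη, hr, hc, hr0, hA⟩
    · rw [hA] at hwE
      obtain ⟨k, u, hu, huv⟩ := exists_mirror_of_mono hd hζ hw.apply_ne_zero hwE
      obtain ⟨e, rfl⟩ := exists_root_eq hu
      refine ⟨(k, e), (huv v).mp (hA ▸ hvE), ?_⟩
      ext x
      rw [mem_mirror, mem_eigenspace, hA, huv]
    · rw [hA] at hvE
      exact absurd hvE (h η hη r c hr hc hr0 ζ hζ)
  · rintro ⟨⟨k, e⟩, hp, rfl⟩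
    exact ⟨isProperPlane_mirror k (root_pow_three e), mem_mirror.mpr hp⟩

theorem numProperPlanes_vertexLine : numProperPlanes vertexLine = 3 := by
  rw [numProperPlanes_mk]
  · have : {p : Fin 3 × Fin 3 | ![(1 : ℂ), 0, 0] (p.1 + 1) = root p.2 * ![(1 : ℂ), 0, 0] (p.1 + 2)}
        = {p | p.1 = 0} := by
      ext ⟨k, e⟩
      have := ne_zero_of_cube (root_pow_three e)
      fin_cases k <;> simp [this.symm]
    rw [this, Set.encard_eq_coe_toFinset_card, Set.toFinset_ofPred]
    have h : (Finset.univ.filter fun p : Fin 3 × Fin 3 => p.1 = 0).card = 3 := by decide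
    simp [h]
  · intro η hη r c hr hc _ ζ _ h
    exact not_fixes_had_vertex hη hr hc ⟨ζ, h⟩

theorem numProperPlanes_coordinateLine {t : ℂ} (ht : t ≠ 0) (ht1 : t ^ 3 ≠ -1) (ht1' : t ^ 3 ≠ 1) :
    numProperPlanes (coordinateLine t) = 0 := by
  rw [numProperPlanes_mk]
  · rw [Set.encard_eq_zero, Set.eq_empty_iff_forall_notMem]
    rintro ⟨k, e⟩ h
    have he := root_pow_three e
    have := ne_zero_of_cube he
    fin_cases k <;> simp [this.symm, ht] at h
    apply ht1'
    linear_combination -t ^ 3 * he - ((root e * t) ^ 2 + root e * t + 1) * h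
  · intro η hη r c hr hc _ ζ _ h
    exact ht1 (fixes_had_coordinatePlane hη hr hc ⟨ζ, h⟩)

theorem numProperPlanes_coordinateLine_one : numProperPlanes (coordinateLine 1) = 1 := by
  rw [numProperPlanes_mk]
  · rw [Set.encard_eq_one]
    refine ⟨(0, 0), ?_⟩
    ext ⟨k, e⟩
    have := ne_zero_of_cube (root_pow_three e)
    fin_cases k <;> simp [this.symm]
    rw [eq_comm, ← root_zero, root_inj]
  · intro η hη r c hr hc _ ζ _ h
    have := fixes_had_coordinatePlane hη hr hc ⟨ζ, h⟩
    norm_num at this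

theorem mul_of_had_mulVec_eq {η : ℂ} (hη : η ^ 2 + η + 1 = 0) {r c v : Fin 3 → ℂ} {i : Fin 3}
    {x : ℂ} (h : (had η r c *ᵥ v) i = x) :
    r i * (c 0 * v 0 + c 1 * η ^ (i : ℕ) * v 1 + c 2 * η ^ ((i : ℕ) * 2) * v 2) =
      (η - η ^ 2) * x := by
  rw [← h, had_mulVec, mul_assoc (η - η ^ 2)⁻¹, mul_inv_cancel_left₀ (prim_sub_ne_zero hη)]

theorem numProperPlanes_center : numProperPlanes (coordinateLine (-1)) = 0 := by
  rw [numProperPlanes_mk]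
  · rw [Set.encard_eq_zero, Set.eq_empty_iff_forall_notMem]
    rintro ⟨k, e⟩ h
    have he := root_pow_three e
    have := ne_zero_of_cube he
    fin_cases k <;> simp [this.symm] at h
    have h1 : root e = -1 := by rw [h, neg_neg]
    rw [h1] at he
    norm_num at he
  · intro η hη r c hr hc _ ζ hζ h
    have hz := cube_eq_neg_one_of_orderOf hζ
    obtain ⟨-, hc'⟩ := (fixes_had_center hη hr hc).mp ⟨ζ, h⟩
    have hθ := prim_sub_ne_zero hη
    have h1 := mul_of_had_mulVec_eq hη (h 1)
    simp at h1
    -- Fourier matrices do fix this line, but with a cube root of unity as eigenvalue.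
    have h2 : ζ = r 1 * c 2 := mul_left_cancel₀ hθ (by
      rw [hc'] at h1
      linear_combination -h1)
    rw [h2, mul_cube_eq_one (hr 1) (hc 2)] at hz
    norm_num at hz

theorem encard_mirrors_properLine {t : ℂ} (ht1 : t ^ 3 ≠ 1) :
    {p : Fin 3 × Fin 3 | ![t, 1, 1] (p.1 + 1) = root p.2 * ![t, 1, 1] (p.1 + 2)}.encard = 1 := by
  rw [Set.encard_eq_one]
  refine ⟨(0, 0), ?_⟩
  ext ⟨k, e⟩
  have he := root_pow_three e
  fin_cases k <;> simp
  · rw [eq_comm, ← root_zero, root_inj]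
  · intro h
    apply ht1
    linear_combination -t ^ 3 * he - ((root e * t) ^ 2 + root e * t + 1) * h
  · intro h
    exact ht1 (h ▸ he)

theorem numProperPlanes_properLine {t : ℂ} (ht1 : t ^ 3 ≠ 1) (ht8 : t ^ 3 ≠ -8)
    (ht54 : t ^ 6 - 20 * t ^ 3 - 8 ≠ 0) : numProperPlanes (properLine t) = 1 := by
  rw [numProperPlanes_mk, encard_mirrors_properLine ht1]
  intro η hη r c hr hc hr0 ζ _ h
  rcases fixes_had_properPlane hη hr hc hr0 ⟨ζ, h⟩ with h | h | ⟨m, hm, -, -, -, -, h⟩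
  · exact ht1 h
  · exact ht8 h
  · apply ht54
    linear_combination (t ^ 4 + 2 * t ^ 3 * m + 6 * t ^ 2 * m ^ 2 - 4 * t * m ^ 3 + 4 * m ^ 4) * h +
      (20 * t ^ 3 + 8 * m ^ 3 + 8) * hm

theorem numProperPlanes_one_add {s : ℂ} (hs : s ^ 2 = 3) :
    numProperPlanes (properLine (1 + s)) = 1 := by
  rw [numProperPlanes_mk, encard_mirrors_properLine (one_add_cube_ne_one hs)]
  intro η hη r c hr hc hr0 ζ hζ h
  obtain ⟨h1, -, hc0, hc1⟩ := (fixes_had_one_add hs hη hr hc hr0).mp ⟨ζ, h⟩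
  have hz := cube_eq_neg_one_of_orderOf hζ
  have h1' := mul_of_had_mulVec_eq hη (h 1)
  simp at h1'
  rw [h1, hc0, hc1] at h1'
  have h2 : (η - η ^ 2) * ζ = c 2 * s := by linear_combination -h1' + c 2 * hη
  -- Fourier matrices fix this line too; sixth powers show that the eigenvalue satisfies `ζ ^ 6 =
  -- -1`, so its order is not 6.
  have h6 : (η - η ^ 2) ^ 6 * ζ ^ 6 = c 2 ^ 6 * s ^ 6 := by
    rw [← mul_pow, h2, mul_pow]
  have e1 : (η - η ^ 2) ^ 6 = -27 := by
    have := prim_sub_sq_sq hη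
    rw [show (η - η ^ 2) ^ 6 = ((η - η ^ 2) ^ 2) ^ 3 by ring, this]
    norm_num
  rw [e1, show ζ ^ 6 = (ζ ^ 3) ^ 2 by ring, hz, show c 2 ^ 6 = (c 2 ^ 3) ^ 2 by ring, hc 2,
    show s ^ 6 = (s ^ 2) ^ 3 by ring, hs] at h6
  norm_num at h6

theorem numProperPlanes_orderNine {ν : ℂ} (hν : orderOf ν = 9) :
    numProperPlanes (line ν (ν ^ 2)) = 0 := by
  rw [line, numProperPlanes_mk]
  · rw [Set.encard_eq_zero, Set.eq_empty_iff_forall_notMem]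
    rintro ⟨k, e⟩ h
    have he := root_pow_three e
    have hp := cube_prim_of_orderOf hν
    have h9 : ν ^ 9 = 1 := hν ▸ pow_orderOf_eq_one ν
    have h1 := prim_ne_one hp
    fin_cases k <;> simp at h
    · have : (ν ^ 2) ^ 3 = 1 := h ▸ he
      exact h1 (by linear_combination h9 - ν ^ 3 * this)
    · apply h1
      linear_combination -ν ^ 3 * he - ((root e * ν) ^ 2 + root e * ν + 1) * h
    · have : ν ^ 3 = root e ^ 3 * ν ^ 6 := by
        conv_lhs => rw [h]
        ring
      rw [he] at this
      exact h1 (by linear_combination (1 - ν ^ 3) * h9 - ν ^ 6 * this)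
  · intro η hη r c hr hc _ ζ _ h
    exact not_fixes_had_orderNine hν hη hr hc ⟨ζ, h⟩

theorem isRegularVector_of_scalar {v : Fin 3 → ℂ} (hv : v ≠ 0)
    (h : ∀ A, InG25 A → Fixes A v → IsScalar A) : IsRegularVector v := by
  rintro P ⟨-, g, hg, hg1, hfix⟩ hvP
  have hgv := coe_mulVec_of_smul_eq (hfix v hvP)
  obtain ⟨x, hx⟩ := h g ⟨g, hg, rfl⟩ ⟨1, fun i => by rw [hgv, one_mul]⟩
  obtain ⟨i, hi⟩ := Function.ne_iff.mp hv
  have := hgv i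
  rw [hx, mulVec_diagonal] at this
  have hx1 : x = 1 := mul_right_cancel₀ hi (by rw [this, one_mul])
  apply hg1
  apply Units.ext
  rw [hx, hx1]
  simp

/-- An element having such a vector as eigenvector is scalar, and the scalars in the group have cube
1, not -1. -/
theorem numProperPlanes_of_scalar {v : Fin 3 → ℂ} (hv : v ≠ 0)
    (h : ∀ A, InG25 A → Fixes A v → IsScalar A) :
    numProperPlanes (Projectivization.mk ℂ v hv) = 0 := by
  simp only [numProperPlanes, Projectivization.submodule_mk, Submodule.span_singleton_le_iff_mem]
  rw [Set.encard_eq_zero, Set.eq_empty_iff_forall_notMem]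
  rintro E ⟨⟨g, hg, ζ, hζ, rfl, -⟩, hvE⟩
  rw [mem_eigenspace] at hvE
  have hsc := h g ⟨g, hg, rfl⟩ ⟨ζ, hvE⟩
  have hz := cube_eq_neg_one_of_orderOf hζ
  obtain ⟨i, hi⟩ := Function.ne_iff.mp hv
  rcases isMono_or_isHad_of_mem hg with ⟨σ, d, hd, hA⟩ | ⟨η, r, c, hη, hr, hc, hr0, hA⟩
  · rw [hA] at hsc hvE
    obtain ⟨rfl, -, -⟩ := (isScalar_mono_iff hd).mp hsc
    have := hvE i
    rw [mono_mulVec] at this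
    simp at this
    rw [← this.resolve_right hi, hd i] at hz
    norm_num at hz
  · rw [hA] at hsc
    exact not_isScalar_had hη hr hc hsc

/-! ### Invariance of the incidence numbers. -/

/-- The image of a subspace under an element of `GL₃(ℂ)`. -/
def translate (g : GL (Fin 3) ℂ) (P : Submodule ℂ (Fin 3 → ℂ)) : Submodule ℂ (Fin 3 → ℂ) :=
  P.comap (Matrix.toLin' ((g⁻¹ : GL (Fin 3) ℂ) : Matrix (Fin 3) (Fin 3) ℂ))

theorem mem_translate {g : GL (Fin 3) ℂ} {P : Submodule ℂ (Fin 3 → ℂ)} {v : Fin 3 → ℂ} :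
    v ∈ translate g P ↔ g⁻¹ • v ∈ P := Iff.rfl

theorem translate_injective (g : GL (Fin 3) ℂ) : Function.Injective (translate g) := by
  intro P Q h
  ext v
  have : g • v ∈ translate g P ↔ g • v ∈ translate g Q := by rw [h]
  simpa only [mem_translate, inv_smul_smul] using this

theorem finrank_translate (g : GL (Fin 3) ℂ) (P : Submodule ℂ (Fin 3 → ℂ)) :
    Module.finrank ℂ (translate g P) = Module.finrank ℂ P := by
  have h : translate g P = P.map
      (LinearEquiv.ofLinearMap (Matrix.toLin' (g : Matrix (Fin 3) (Fin 3) ℂ))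
        (Matrix.toLin' ((g⁻¹ : GL (Fin 3) ℂ) : Matrix (Fin 3) (Fin 3) ℂ))
        (by rw [← Matrix.toLin'_mul, ← Units.val_mul, mul_inv_cancel]; simp)
        (by rw [← Matrix.toLin'_mul, ← Units.val_mul, inv_mul_cancel]; simp)).toLinearMap := by
    ext v
    rw [mem_translate, Submodule.mem_map]
    constructor
    · intro hv
      exact ⟨_, hv, smul_inv_smul g v⟩
    · rintro ⟨w, hw, rfl⟩
      change g⁻¹ • (g • w) ∈ P
      rwa [inv_smul_smul]
  rw [h, LinearEquiv.finrank_map_eq]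

theorem IsReflectionPlane.translate {P : Submodule ℂ (Fin 3 → ℂ)} (hP : IsReflectionPlane P)
    {g : GL (Fin 3) ℂ} (hg : g ∈ G25) : IsReflectionPlane (translate g P) := by
  obtain ⟨hr, h, hh, h1, hfix⟩ := hP
  refine ⟨by rw [finrank_translate, hr], g * h * g⁻¹, G25.mul_mem (G25.mul_mem hg hh)
    (G25.inv_mem hg), fun h' => h1 (conj_eq_one_iff.mp h'), fun v hv => ?_⟩
  rw [mul_smul, mul_smul, hfix _ (mem_translate.mp hv), smul_inv_smul]

theorem mem_eigenspace_iff_smul {g : GL (Fin 3) ℂ} {ζ : ℂ} {v : Fin 3 → ℂ} :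
    v ∈ eigenspace g ζ ↔ g • v = ζ • v := by
  rw [eigenspace, Module.End.mem_eigenspace_iff]
  rfl

theorem IsRegularVector.smul {v : Fin 3 → ℂ} (hv : IsRegularVector v) {g : GL (Fin 3) ℂ}
    (hg : g ∈ G25) : IsRegularVector (g • v) := by
  intro P hP hmem
  refine hv _ (hP.translate (G25.inv_mem hg)) ?_
  rwa [mem_translate, inv_inv]

theorem IsProperPlane.translate {E : Submodule ℂ (Fin 3 → ℂ)} (hE : IsProperPlane E)
    {g : GL (Fin 3) ℂ} (hg : g ∈ G25) : IsProperPlane (translate g E) := by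
  obtain ⟨h, hh, ζ, hζ, rfl, v, hvE, hv⟩ := hE
  refine ⟨g * h * g⁻¹, G25.mul_mem (G25.mul_mem hg hh) (G25.inv_mem hg), ζ, hζ, ?_, g • v, ?_,
    hv.smul hg⟩
  · ext w
    rw [mem_translate, mem_eigenspace_iff_smul, mem_eigenspace_iff_smul, mul_smul, mul_smul,
      ← eq_inv_smul_iff (g := g), smul_comm g⁻¹ ζ w]
  · rwa [mem_translate, inv_smul_smul]

theorem submodule_smul_le_translate {g : GL (Fin 3) ℂ} {L : Line} {P : Submodule ℂ (Fin 3 → ℂ)}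
    (h : L.submodule ≤ P) : (g • L).submodule ≤ translate g P := by
  induction L using Projectivization.ind with
  | h v hv =>
    rw [Projectivization.submodule_mk, Submodule.span_singleton_le_iff_mem] at h
    rw [Projectivization.smul_mk, Projectivization.submodule_mk,
      Submodule.span_singleton_le_iff_mem, mem_translate, inv_smul_smul]
    exact h

/-- Translation is injective; the same inequality for the inverse element turns this into an
equality. -/
theorem encard_le_encard_smul {Q : Submodule ℂ (Fin 3 → ℂ) → Prop} {g : GL (Fin 3) ℂ}
    (hQ : ∀ P, Q P → Q (translate g P)) (L : Line) :
    {P | Q P ∧ L.submodule ≤ P}.encard ≤ {P | Q P ∧ (g • L).submodule ≤ P}.encard := by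
  rw [← (translate_injective g).encard_image]
  refine Set.encard_le_encard ?_
  rintro _ ⟨P, ⟨hP, hL⟩, rfl⟩
  exact ⟨hQ P hP, submodule_smul_le_translate hL⟩

theorem encard_smul_eq {Q : Submodule ℂ (Fin 3 → ℂ) → Prop}
    (hQ : ∀ g ∈ G25, ∀ P, Q P → Q (translate g P)) {g : GL (Fin 3) ℂ} (hg : g ∈ G25) (L : Line) :
    {P | Q P ∧ (g • L).submodule ≤ P}.encard = {P | Q P ∧ L.submodule ≤ P}.encard := by
  refine le_antisymm ?_ (encard_le_encard_smul (hQ g hg) L)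
  have := encard_le_encard_smul (hQ g⁻¹ (G25.inv_mem hg)) (g • L)
  rwa [inv_smul_smul] at this

theorem numReflectionPlanes_eq_of_mem_orbit {L L' : Line} (h : L ∈ MulAction.orbit G25 L') :
    numReflectionPlanes L = numReflectionPlanes L' := by
  obtain ⟨⟨g, hg⟩, rfl⟩ := h
  exact encard_smul_eq (fun _ h _ hP => hP.translate h) hg L'

theorem numProperPlanes_eq_of_mem_orbit {L L' : Line} (h : L ∈ MulAction.orbit G25 L') :
    numProperPlanes L = numProperPlanes L' := by
  obtain ⟨⟨g, hg⟩, rfl⟩ := h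
  exact encard_smul_eq (fun _ h _ hP => hP.translate h) hg L'

theorem mem_orbitsOfType {L : Line} {n r p : ℕ∞} : orbitOf L ∈ orbitsOfType n r p ↔
    (MulAction.orbit G25 L).encard = n ∧ numReflectionPlanes L = r ∧ numProperPlanes L = p := by
  have horb : MulAction.orbitRel.Quotient.orbit (orbitOf L) = MulAction.orbit G25 L := rfl
  rw [orbitsOfType, Set.mem_ofPred_eq, horb]
  refine and_congr_right fun _ => ⟨fun h => h L (MulAction.mem_orbit_self L), fun h L' hL' => ?_⟩
  rwa [numReflectionPlanes_eq_of_mem_orbit hL', numProperPlanes_eq_of_mem_orbit hL']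

/-! ### The type of every orbit. -/

/-- The lines whose stabilizer in `G25` consists of scalars. -/
def HasScalarStabilizer (L : Line) : Prop :=
  ∀ g ∈ G25, g • L = L → IsScalar (g : Matrix (Fin 3) (Fin 3) ℂ)

theorem mem_orbitsOfType_of_hasScalarStabilizer {L : Line} (h : HasScalarStabilizer L) :
    orbitOf L ∈ orbitsOfType 216 0 0 := by
  induction L using Projectivization.ind with
  | h v hv =>
    have h' : ∀ A, InG25 A → Fixes A v → IsScalar A := by
      rintro _ ⟨g, hg, rfl⟩ hf
      exact h g hg ((fixes_iff_smul hv).mp hf)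
    exact mem_orbitsOfType.mpr ⟨encard_orbit_of_scalar hv h',
      numReflectionPlanes_eq_zero_of_regular hv (isRegularVector_of_scalar hv h'),
      numProperPlanes_of_scalar hv h'⟩

theorem vertexLine_mem : orbitOf vertexLine ∈ orbitsOfType 12 2 3 :=
  mem_orbitsOfType.mpr
    ⟨encard_orbit_vertex, numReflectionPlanes_vertexLine, numProperPlanes_vertexLine⟩

theorem coordinateLine_mem {t : ℂ} (ht : t ≠ 0) (ht6 : t ^ 6 ≠ 1) :
    orbitOf (coordinateLine t) ∈ orbitsOfType 72 1 0 := by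
  have h1 : t ^ 3 ≠ 1 := fun h => ht6 (by linear_combination (t ^ 3 + 1) * h)
  have h2 : t ^ 3 ≠ -1 := fun h => ht6 (by linear_combination (t ^ 3 - 1) * h)
  exact mem_orbitsOfType.mpr ⟨encard_orbit_coordinatePlane ht ht6,
    numReflectionPlanes_coordinateLine ht h2, numProperPlanes_coordinateLine ht h2 h1⟩

theorem coordinateLine_one_mem : orbitOf (coordinateLine 1) ∈ orbitsOfType 36 1 1 :=
  mem_orbitsOfType.mpr ⟨encard_orbit_coordinatePlane_one,
    numReflectionPlanes_coordinateLine one_ne_zero (by norm_num),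
    numProperPlanes_coordinateLine_one⟩

theorem center_mem : orbitOf (coordinateLine (-1)) ∈ orbitsOfType 9 4 0 :=
  mem_orbitsOfType.mpr ⟨encard_orbit_center, numReflectionPlanes_center, numProperPlanes_center⟩

theorem properLine_mem {t : ℂ} (ht : t ≠ 0) (ht1 : t ^ 3 ≠ 1) (ht8 : t ^ 3 ≠ -8)
    (ht54 : t ^ 6 - 20 * t ^ 3 - 8 ≠ 0) : orbitOf (properLine t) ∈ orbitsOfType 108 0 1 :=
  mem_orbitsOfType.mpr ⟨encard_orbit_properPlane ht ht1 ht8 ht54,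
    numReflectionPlanes_eq_zero_of_regular _ (isRegularVector_properLine ht ht1 ht8),
    numProperPlanes_properLine ht1 ht8 ht54⟩

theorem one_add_mem {s : ℂ} (hs : s ^ 2 = 3) :
    orbitOf (properLine (1 + s)) ∈ orbitsOfType 54 0 1 :=
  mem_orbitsOfType.mpr ⟨encard_orbit_one_add hs,
    numReflectionPlanes_eq_zero_of_regular _ (isRegularVector_properLine (one_add_ne_zero hs)
      (one_add_cube_ne_one hs) (one_add_cube_ne_neg_eight hs)), numProperPlanes_one_add hs⟩

theorem orderNine_mem {ν : ℂ} (hν : orderOf ν = 9) :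
    orbitOf (line ν (ν ^ 2)) ∈ orbitsOfType 72 0 0 :=
  mem_orbitsOfType.mpr ⟨encard_orbit_orderNine hν,
    numReflectionPlanes_eq_zero_of_regular _ (isRegularVector_orderNine hν), numProperPlanes_orderNine hν⟩

theorem orbit_types {ν : ℂ} (hν : orderOf ν = 9) (L : Line) :
    (HasScalarStabilizer L ∧ orbitOf L ∈ orbitsOfType 216 0 0) ∨
    (orbitOf L ∈ orbitsOfType 72 1 0 ∧ orbitOf L ∈ Set.range fun t => orbitOf (coordinateLine t)) ∨
    (orbitOf L ∈ orbitsOfType 108 0 1 ∧ orbitOf L ∈ Set.range fun t => orbitOf (properLine t)) ∨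
    (orbitOf L ∈ orbitsOfType 12 2 3 ∧ orbitOf L = orbitOf vertexLine) ∨
    (orbitOf L ∈ orbitsOfType 9 4 0 ∧ orbitOf L = orbitOf (coordinateLine (-1))) ∨
    (orbitOf L ∈ orbitsOfType 36 1 1 ∧ orbitOf L = orbitOf (coordinateLine 1)) ∨
    (orbitOf L ∈ orbitsOfType 54 0 1 ∧
      orbitOf L = orbitOf (line ((1 + (Real.sqrt 3 : ℂ)) * ω ^ 2) ω)) ∨
    (orbitOf L ∈ orbitsOfType 72 0 0 ∧ orbitOf L = orbitOf (line ν (ν ^ 2))) := by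
  rw [line_sqrt_eq]
  rcases orbitOf_cases hν L with h | ⟨t, h0, h6, h⟩ | ⟨t, h0, h1, h8, h54, h⟩ | h | h | h | h | h
  · exact Or.inl ⟨h, mem_orbitsOfType_of_hasScalarStabilizer h⟩
  · have := h ▸ coordinateLine_mem h0 h6
    exact Or.inr (Or.inl ⟨this, t, h.symm⟩)
  · have := h ▸ properLine_mem h0 h1 h8 h54
    exact Or.inr (Or.inr (Or.inl ⟨this, t, h.symm⟩))
  · have := h ▸ vertexLine_mem
    tauto
  · have := h ▸ center_mem
    tauto
  · have := h ▸ coordinateLine_one_mem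
    tauto
  · have := h ▸ one_add_mem sqrt_three_sq
    tauto
  · have := h ▸ orderNine_mem hν
    tauto

/-! ### Zariski topology, dimension and genericity. -/

section Dimension

variable {X : Type*} [TopologicalSpace X]

/-- Nonempty open sets are cofinite, so `X` is irreducible. A proper irreducible closed set is
finite, hence a point by T1. The longest chains are a point inside `X`. -/
theorem topologicalKrullDim_eq_one_of_finite [T1Space X] [Infinite X]
    (h : ∀ C : Set X, IsClosed C → C ≠ Set.univ → C.Finite) : topologicalKrullDim X = 1 := by
  have huniv : IsIrreducible (Set.univ : Set X) := by
    refine ⟨Set.univ_nonempty, fun U V hU hV ⟨x, _, hx⟩ ⟨y, _, hy⟩ => ?_⟩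
    have hfin : ∀ U : Set X, IsOpen U → ∀ x ∈ U, Uᶜ.Finite := fun U hU x hx =>
      h _ hU.isClosed_compl fun he => (he ▸ Set.mem_univ x : x ∈ Uᶜ) hx
    obtain ⟨z, hz⟩ := ((hfin U hU x hx).union (hfin V hV y hy)).infinite_compl.nonempty
    simp only [Set.mem_compl_iff, Set.mem_union, not_or, not_not] at hz
    exact ⟨z, trivial, hz⟩
  apply le_antisymm
  · rw [topologicalKrullDim, Order.krullDim_le_one_iff]
    intro Z
    by_cases hZ : (Z : Set X) = Set.univ
    · right
      intro Y _
      exact fun x _ => (hZ ▸ Set.mem_univ x : x ∈ (Z : Set X))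
    · left
      have hfin : (Z : Set X).Finite := h _ Z.isClosed' hZ
      have hsub : (Z : Set X).Subsingleton := by
        intro x hx y hy
        have hopen : ∀ x, IsOpen ((Z : Set X) \ {x})ᶜ := fun x =>
          (hfin.subset Set.sdiff_subset).isClosed.isOpen_compl
        obtain ⟨z, hz, hzx, hzy⟩ := Z.isIrreducible'.isPreirreducible _ _ (hopen x) (hopen y)
          ⟨x, hx, by simp⟩ ⟨y, hy, by simp⟩
        have key : ∀ x, z ∈ ((Z : Set X) \ {x})ᶜ → z = x := fun x h => by
          by_contra hne
          exact h ⟨hz, hne⟩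
        rw [← key x hzx, ← key y hzy]
      intro Y hY x hx
      obtain ⟨y, hy⟩ := Y.isIrreducible'.nonempty
      rwa [hsub hx (hY hy)]
  · rw [topologicalKrullDim, Order.one_le_krullDim_iff]
    obtain ⟨x⟩ : Nonempty X := inferInstance
    refine ⟨⟨{x}, isIrreducible_singleton, isClosed_singleton⟩, ⟨Set.univ, huniv, isClosed_univ⟩, ?_⟩
    refine lt_of_le_of_ne (fun _ _ => trivial) fun he => ?_
    have : ({x} : Set X) = Set.univ := congrArg TopologicalSpace.IrreducibleCloseds.carrier he
    exact Set.infinite_univ (this ▸ Set.finite_singleton x)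

end Dimension

theorem eval_smul_of_isHomogeneous {F : MvPolynomial (Fin 3) ℂ} {d : ℕ} (hF : F.IsHomogeneous d)
    (c : ℂ) (v : Fin 3 → ℂ) : MvPolynomial.eval (c • v) F = c ^ d * MvPolynomial.eval v F := by
  rw [MvPolynomial.eval_eq', MvPolynomial.eval_eq', Finset.mul_sum]
  refine Finset.sum_congr rfl fun m hm => ?_
  have hd : ∑ i, m i = d := by
    rw [← hF (MvPolynomial.mem_support_iff.mp hm), Finsupp.weight_apply,
      Finsupp.sum_fintype _ _ (by simp)]
    simp
  simp only [Pi.smul_apply, smul_eq_mul, mul_pow, Finset.prod_mul_distrib, Finset.prod_pow_eq_pow_sum,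
    hd]
  ring

/-- The complement of the zero locus of a homogeneous polynomial. -/
def nonvanishing (F : MvPolynomial (Fin 3) ℂ) : Set Line :=
  {L | ∃ v ∈ L.submodule, MvPolynomial.eval v F ≠ 0}

theorem isOpen_nonvanishing {F : MvPolynomial (Fin 3) ℂ} {d : ℕ} (hF : F.IsHomogeneous d) :
    IsOpen (nonvanishing F) :=
  TopologicalSpace.isOpen_generateFrom_of_mem ⟨d, F, hF, rfl⟩

theorem mk_mem_nonvanishing {F : MvPolynomial (Fin 3) ℂ} {d : ℕ} (hF : F.IsHomogeneous d)
    {v : Fin 3 → ℂ} (hv : v ≠ 0) :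
    Projectivization.mk ℂ v hv ∈ nonvanishing F ↔ MvPolynomial.eval v F ≠ 0 := by
  rw [nonvanishing, Set.mem_ofPred_eq, Projectivization.submodule_mk]
  constructor
  · rintro ⟨w, hw, h⟩ h0
    obtain ⟨c, rfl⟩ := Submodule.mem_span_singleton.mp hw
    rw [eval_smul_of_isHomogeneous hF, h0, mul_zero] at h
    exact h rfl
  · exact fun h => ⟨v, Submodule.mem_span_singleton_self v, h⟩

theorem exists_nonvanishing_subset {U : Set Line} (hU : IsOpen U) {L : Line} (hL : L ∈ U) :
    ∃ (d : ℕ) (F : MvPolynomial (Fin 3) ℂ), F.IsHomogeneous d ∧ L ∈ nonvanishing F ∧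
      nonvanishing F ⊆ U := by
  induction hU with
  | basic U h =>
    obtain ⟨d, F, hF, rfl⟩ := h
    exact ⟨d, F, hF, hL, subset_rfl⟩
  | univ =>
    refine ⟨0, 1, MvPolynomial.isHomogeneous_one _ _, ?_, Set.subset_univ _⟩
    exact ⟨0, zero_mem _, by simp⟩
  | inter U V _ _ ihU ihV =>
    obtain ⟨d, F, hF, hFL, hFU⟩ := ihU hL.1
    obtain ⟨e, G, hG, hGL, hGV⟩ := ihV hL.2
    have hmul : ∀ L : Line, L ∈ nonvanishing (F * G) ↔ L ∈ nonvanishing F ∧ L ∈ nonvanishing G := by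
      intro L
      induction L using Projectivization.ind with
      | h v hv =>
        rw [mk_mem_nonvanishing (hF.mul hG), mk_mem_nonvanishing hF, mk_mem_nonvanishing hG, map_mul,
          mul_ne_zero_iff]
    exact ⟨d + e, F * G, hF.mul hG, (hmul L).mpr ⟨hFL, hGL⟩,
      fun M hM => ⟨hFU ((hmul M).mp hM).1, hGV ((hmul M).mp hM).2⟩⟩
  | sUnion S _ ih =>
    obtain ⟨U, hUS, hLU⟩ := hL
    obtain ⟨d, F, hF, hFL, hFU⟩ := ih U hUS hLU
    exact ⟨d, F, hF, hFL, hFU.trans (Set.subset_sUnion_of_mem hUS)⟩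

instance : PreirreducibleSpace Line where
  isPreirreducible_univ := by
    rintro U V hU hV ⟨L, -, hLU⟩ ⟨M, -, hMV⟩
    obtain ⟨d, F, hF, ⟨v, -, hv⟩, hFU⟩ := exists_nonvanishing_subset hU hLU
    obtain ⟨e, G, hG, ⟨w, -, hw⟩, hGV⟩ := exists_nonvanishing_subset hV hMV
    have hF0 : F ≠ 0 := by rintro rfl; simp at hv
    have hG0 : G ≠ 0 := by rintro rfl; simp at hw
    -- The factor `X 0` ensures that `x` is a nonzero vector and defines a line.
    obtain ⟨x, hx⟩ : ∃ x, MvPolynomial.eval x (F * G * MvPolynomial.X 0) ≠ 0 := by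
      by_contra! hcon
      exact mul_ne_zero (mul_ne_zero hF0 hG0) (MvPolynomial.X_ne_zero 0)
        (MvPolynomial.funext fun x => by rw [hcon x, map_zero])
    simp only [map_mul, MvPolynomial.eval_X, mul_ne_zero_iff] at hx
    have hx0 : x ≠ 0 := fun h => hx.2 (congrFun h 0)
    exact ⟨Projectivization.mk ℂ x hx0, trivial, hFU ((mk_mem_nonvanishing hF hx0).mpr hx.1.1),
      hGV ((mk_mem_nonvanishing hG hx0).mpr hx.1.2)⟩

/-- A line that is given by polynomial coordinates depends continuously on the parameter when the
latter varies in `ℂ` with the cofinite topology. -/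
theorem continuous_of_polynomial {f : ℂ → Line} (P : Fin 3 → Polynomial ℂ)
    (hne : ∀ a, (fun i => (P i).eval a) ≠ 0)
    (hf : ∀ a, f a = Projectivization.mk ℂ (fun i => (P i).eval a) (hne a)) :
    Continuous fun a : CofiniteTopology ℂ => f (CofiniteTopology.of.symm a) := by
  rw [continuous_generateFrom_iff]
  rintro _ ⟨d, F, hF, rfl⟩
  rw [CofiniteTopology.isOpen_iff']
  set Q : Polynomial ℂ := MvPolynomial.aeval P F with hQ
  have hmem : ∀ a, f a ∈ nonvanishing F ↔ Q.eval a ≠ 0 := by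
    intro a
    rw [hf, mk_mem_nonvanishing hF, hQ]
    have : MvPolynomial.eval (fun i => (P i).eval a) F =
        Polynomial.eval a (MvPolynomial.aeval P F) := by
      have hcomp : (Polynomial.aeval a).comp (MvPolynomial.aeval P) =
          MvPolynomial.aeval (R := ℂ) fun i => (P i).eval a :=
        MvPolynomial.algHom_ext fun i => by simp
      rw [← MvPolynomial.coe_aeval_eq_eval, ← hcomp]
      simp
    rw [this]
  by_cases hQ0 : Q = 0
  · left
    rw [Set.eq_empty_iff_forall_notMem]
    intro a ha
    exact (hmem _).mp ha (by rw [hQ0, Polynomial.eval_zero])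
  · right
    refine ((Polynomial.finite_setOfPred_isRoot hQ0).image CofiniteTopology.of).subset fun a ha => ?_
    refine ⟨CofiniteTopology.of.symm a, ?_, by simp⟩
    by_contra hroot
    exact ha ((hmem _).mpr hroot)

/-- Two vectors span the same line exactly when the 2×2 minors vanish. -/
theorem isClosed_singleton_line (L : Line) : IsClosed ({L} : Set Line) := by
  induction L using Projectivization.ind with
  | h w hw =>
    set F : Fin 3 → Fin 3 → MvPolynomial (Fin 3) ℂ := fun i j =>
      MvPolynomial.C (w i) * MvPolynomial.X j - MvPolynomial.C (w j) * MvPolynomial.X i with hFdef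
    have hF : ∀ i j, (F i j).IsHomogeneous (0 + 1) := fun i j =>
      ((MvPolynomial.isHomogeneous_C _ _).mul (MvPolynomial.isHomogeneous_X _ _)).sub
        ((MvPolynomial.isHomogeneous_C _ _).mul (MvPolynomial.isHomogeneous_X _ _))
    have : ({Projectivization.mk ℂ w hw} : Set Line)ᶜ = ⋃ i, ⋃ j, nonvanishing (F i j) := by
      ext L
      induction L using Projectivization.ind with
      | h v hv =>
        simp only [Set.mem_compl_iff, Set.mem_singleton_iff, Set.mem_iUnion, mk_mem_nonvanishing (hF _ _),
          Projectivization.mk_eq_mk_iff']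
        rw [← not_iff_not]
        push Not
        simp only [hFdef, map_sub, map_mul, MvPolynomial.eval_C, MvPolynomial.eval_X]
        constructor
        · rintro ⟨a, rfl⟩ i j
          simp
          ring
        · intro h
          obtain ⟨i, hi⟩ := Function.ne_iff.mp hw
          refine ⟨v i / w i, ?_⟩
          ext j
          have := h i j
          simp only [Pi.zero_apply] at hi
          simp only [Pi.smul_apply, smul_eq_mul]
          field_simp
          linear_combination -this
    rw [← isOpen_compl_iff, this]
    exact isOpen_iUnion fun i => isOpen_iUnion fun j => isOpen_nonvanishing (hF i j)

theorem orbit_finite (L : Line) : (MulAction.orbit G25 L).Finite :=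
  Set.finite_range _

theorem continuous_orbitOf : Continuous orbitOf := continuous_quotient_mk'

instance : T1Space LineOrbit where
  t1 O := by
    induction O using Quotient.inductionOn' with
    | h L =>
      have : IsClosed (orbitOf ⁻¹' {orbitOf L}) := by
        have h : orbitOf ⁻¹' {orbitOf L} = ⋃ M ∈ MulAction.orbit G25 L, {M} := by
          ext M
          simp [orbitOf_eq_iff]
        rw [h]
        exact (orbit_finite L).isClosed_biUnion fun M _ => isClosed_singleton_line M
      exact isQuotientMap_quotient_mk'.isClosed_preimage.mp this

/-- A closed set of orbits pulls back to a finite set or to all of `ℂ`, so its trace on `S` is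
finite or everything. `S` is infinite because orbits are finite and `f` is injective. -/
theorem isInfiniteOfDimOne_of_curve {f : ℂ → Line} (hf : Function.Injective f)
    (hcont : Continuous fun a : CofiniteTopology ℂ => f (CofiniteTopology.of.symm a))
    {S : Set LineOrbit} (hS : S ⊆ Set.range fun a => orbitOf (f a))
    (hinf : {a | orbitOf (f a) ∈ S}.Infinite) : IsInfiniteOfDimOne S := by
  have hSinf : S.Infinite := by
    intro hfin
    refine hinf (Set.Finite.subset (s := ⋃ O ∈ S, {a | orbitOf (f a) = O})
      (hfin.biUnion fun O _ => ?_) (fun a ha => Set.mem_biUnion ha rfl))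
    · induction O using Quotient.inductionOn' with
      | h L =>
        refine ((orbit_finite L).preimage hf.injOn).subset fun a ha => ?_
        exact orbitOf_eq_iff.mp ha
  refine ⟨hSinf, ?_⟩
  have : Infinite S := hSinf.to_subtype
  refine topologicalKrullDim_eq_one_of_finite fun C hC hne => ?_
  obtain ⟨D, hD, rfl⟩ := isClosed_induced_iff.mp hC
  have hpre := hD.preimage (continuous_orbitOf.comp hcont)
  rw [CofiniteTopology.isClosed_iff] at hpre
  rcases hpre with h | h
  · refine absurd (Set.eq_univ_of_forall ?_) hne
    rintro ⟨O, hO⟩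
    obtain ⟨a, rfl⟩ := hS hO
    exact (h ▸ Set.mem_univ (CofiniteTopology.of a) : CofiniteTopology.of a ∈ _ ⁻¹' D)
  · refine Set.Finite.of_finite_image (f := Subtype.val) ?_ Subtype.val_injective.injOn
    refine (h.image fun a => orbitOf (f (CofiniteTopology.of.symm a))).subset ?_
    rintro _ ⟨⟨O, hO⟩, hOD, rfl⟩
    obtain ⟨a, rfl⟩ := hS hO
    exact ⟨CofiniteTopology.of a, hOD, rfl⟩

/-- The line of `v` is fixed exactly when `g *ᵥ v` and `v` are dependent, that is, when quadratic
minors vanish. -/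
theorem isOpen_setOf_smul_ne (g : GL (Fin 3) ℂ) : IsOpen {L : Line | g • L ≠ L} := by
  set F : Fin 3 → Fin 3 → MvPolynomial (Fin 3) ℂ := fun i j =>
    (∑ k, MvPolynomial.C ((g : Matrix (Fin 3) (Fin 3) ℂ) i k) * MvPolynomial.X k) *
      MvPolynomial.X j -
    (∑ k, MvPolynomial.C ((g : Matrix (Fin 3) (Fin 3) ℂ) j k) * MvPolynomial.X k) *
      MvPolynomial.X i with hFdef
  have hlin : ∀ i : Fin 3, (∑ k, MvPolynomial.C ((g : Matrix (Fin 3) (Fin 3) ℂ) i k) *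
      MvPolynomial.X k : MvPolynomial (Fin 3) ℂ).IsHomogeneous (0 + 1) := fun i =>
    MvPolynomial.IsHomogeneous.sum _ _ _ fun k _ =>
      (MvPolynomial.isHomogeneous_C _ _).mul (MvPolynomial.isHomogeneous_X _ _)
  have hF : ∀ i j, (F i j).IsHomogeneous (0 + 1 + 1) := fun i j =>
    ((hlin i).mul (MvPolynomial.isHomogeneous_X _ _)).sub
      ((hlin j).mul (MvPolynomial.isHomogeneous_X _ _))
  have : {L : Line | g • L ≠ L} = ⋃ i, ⋃ j, nonvanishing (F i j) := by
    ext L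
    induction L using Projectivization.ind with
    | h v hv =>
      have heval : ∀ i j, MvPolynomial.eval v (F i j) =
          ((g : Matrix (Fin 3) (Fin 3) ℂ) *ᵥ v) i * v j -
            ((g : Matrix (Fin 3) (Fin 3) ℂ) *ᵥ v) j * v i := fun i j => by
        simp [hFdef, mulVec, dotProduct]
      simp only [Set.mem_ofPred_eq, Set.mem_iUnion, mk_mem_nonvanishing (hF _ _), heval]
      rw [← not_iff_not, not_not, ← fixes_iff_smul]
      push Not
      constructor
      · rintro ⟨a, ha⟩ i j
        rw [ha, ha]
        ring
      · intro h
        obtain ⟨j, hj⟩ := Function.ne_iff.mp hv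
        rw [Pi.zero_apply] at hj
        refine ⟨((g : Matrix (Fin 3) (Fin 3) ℂ) *ᵥ v) j / v j, fun i => ?_⟩
        rw [div_mul_eq_mul_div, eq_div_iff hj]
        exact sub_eq_zero.mp (h i j)
  rw [this]
  exact isOpen_iUnion fun i => isOpen_iUnion fun j => isOpen_nonvanishing (hF i j)

/-- If all lines were fixed, the basis vectors would be eigenvectors, and so would their sum, which
makes the eigenvalues equal. -/
theorem exists_smul_ne {g : GL (Fin 3) ℂ} (hg : ¬ IsScalar (g : Matrix (Fin 3) (Fin 3) ℂ)) :
    ∃ L : Line, g • L ≠ L := by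
  by_contra! h
  have hfix : ∀ v : Fin 3 → ℂ, v ≠ 0 → Fixes (g : Matrix (Fin 3) (Fin 3) ℂ) v := fun v hv =>
    (fixes_iff_smul hv).mpr (h _)
  apply hg
  obtain ⟨a, ha⟩ := hfix 1 one_ne_zero
  choose b hb using fun j : Fin 3 => hfix (Pi.single j 1) (single_one_ne_zero j)
  have hentry : ∀ i j, (g : Matrix (Fin 3) (Fin 3) ℂ) i j = if i = j then b j else 0 := by
    intro i j
    have := hb j i
    rw [mulVec_single_one] at this
    simpa [Pi.single_apply] using this
  refine ⟨a, ?_⟩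
  ext i j
  rw [hentry, diagonal_apply]
  split_ifs with hij
  · subst hij
    have := ha i
    simpa [mulVec, dotProduct, hentry] using this
  · rfl

theorem setOf_hasScalarStabilizer : {L | HasScalarStabilizer L} =
    ⋂ g ∈ {g : GL (Fin 3) ℂ | g ∈ G25 ∧ ¬ IsScalar (g : Matrix (Fin 3) (Fin 3) ℂ)},
      {L : Line | g • L ≠ L} := by
  ext L
  simp only [HasScalarStabilizer, Set.mem_ofPred_eq, Set.mem_iInter, and_imp]
  exact forall₂_congr fun g _ => not_imp_not.symm

theorem finite_nonscalar :
    {g : GL (Fin 3) ℂ | g ∈ G25 ∧ ¬ IsScalar (g : Matrix (Fin 3) (Fin 3) ℂ)}.Finite := by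
  have : Finite (G25 : Set (GL (Fin 3) ℂ)) := inferInstanceAs (Finite G25)
  exact (Set.toFinite (G25 : Set (GL (Fin 3) ℂ))).subset fun _ h => h.1

theorem isOpen_dense_biInter {X ι : Type*} [TopologicalSpace X] {s : Set ι} (hs : s.Finite)
    {U : ι → Set X} (hU : ∀ i ∈ s, IsOpen (U i)) (hd : ∀ i ∈ s, Dense (U i)) :
    IsOpen (⋂ i ∈ s, U i) ∧ Dense (⋂ i ∈ s, U i) := by
  induction s, hs using Set.Finite.induction_on with
  | empty => simp
  | @insert a s _ hs ih =>
    rw [Set.biInter_insert]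
    obtain ⟨h1, h2⟩ := ih (fun i hi => hU i (Set.mem_insert_of_mem _ hi))
      (fun i hi => hd i (Set.mem_insert_of_mem _ hi))
    have ha := hU a (Set.mem_insert _ _)
    exact ⟨ha.inter h1, (hd a (Set.mem_insert _ _)).inter_of_isOpen_left h2 ha⟩

theorem isOpen_dense_hasScalarStabilizer :
    IsOpen {L | HasScalarStabilizer L} ∧ Dense {L | HasScalarStabilizer L} := by
  rw [setOf_hasScalarStabilizer]
  refine isOpen_dense_biInter finite_nonscalar (fun g _ => isOpen_setOf_smul_ne g) fun g hg => ?_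
  exact (isOpen_setOf_smul_ne g).dense (exists_smul_ne hg.2)

/-! ### The rows of the table. -/

theorem exists_orderOf_eq_nine : ∃ ν : ℂ, orderOf ν = 9 :=
  ⟨_, (Complex.isPrimitiveRoot_exp 9 (by norm_num)).eq_orderOf.symm⟩

theorem orbitOf_surjective : Function.Surjective orbitOf := Quotient.mk''_surjective

theorem type_unique {O : LineOrbit} {n r p n' r' p' : ℕ∞} (h : O ∈ orbitsOfType n r p)
    (h' : O ∈ orbitsOfType n' r' p') : n = n' ∧ r = r' ∧ p = p' := by
  obtain ⟨L, rfl⟩ := orbitOf_surjective O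
  obtain ⟨rfl, rfl, rfl⟩ := mem_orbitsOfType.mp h
  exact mem_orbitsOfType.mp h'

theorem preimage_orbitsOfType_generic :
    orbitOf ⁻¹' orbitsOfType 216 0 0 = {L | HasScalarStabilizer L} := by
  obtain ⟨ν, hν⟩ := exists_orderOf_eq_nine
  ext L
  refine ⟨fun h => ?_, mem_orbitsOfType_of_hasScalarStabilizer⟩
  rcases orbit_types hν L with ⟨h', -⟩ | ⟨h', -⟩ | ⟨h', -⟩ | ⟨h', -⟩ | ⟨h', -⟩ | ⟨h', -⟩ | ⟨h', -⟩ |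
    ⟨h', -⟩
  · exact h'
  all_goals
    have := (type_unique h h').1
    norm_num at this

theorem isGeneric_orbitsOfType : IsGeneric (orbitsOfType 216 0 0) := by
  obtain ⟨ho, hd⟩ := isOpen_dense_hasScalarStabilizer
  rw [← preimage_orbitsOfType_generic] at ho hd
  refine ⟨isQuotientMap_quotient_mk'.isOpen_preimage.mp ho, ?_⟩
  have := orbitOf_surjective.denseRange.dense_image continuous_orbitOf hd
  rwa [Set.image_preimage_eq _ orbitOf_surjective] at this

/-- The natural numbers from 3 on avoid all exceptional parameters of both families. -/
theorem infinite_of_natCast {p : ℂ → Prop} (h : ∀ n : ℕ, 3 ≤ n → p n) : {a | p a}.Infinite := by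
  refine Set.infinite_of_injective_forall_mem (f := fun n : ℕ => ((n + 3 : ℕ) : ℂ)) ?_
    fun n => h (n + 3) (by omega)
  intro a b hab
  simpa using hab

theorem coordinateLine_injective : Function.Injective coordinateLine := by
  intro a b h
  obtain ⟨c, hc⟩ := (Projectivization.mk_eq_mk_iff' ℂ _ _ _ _).mp h
  have h1 := congrFun hc 1
  have h2 := congrFun hc 2
  simp at h1 h2
  rw [← h2, h1, one_mul]

theorem properLine_injective : Function.Injective properLine := by
  intro a b h
  obtain ⟨c, hc⟩ := (Projectivization.mk_eq_mk_iff' ℂ _ _ _ _).mp h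
  have h1 := congrFun hc 1
  have h0 := congrFun hc 0
  simp at h1 h0
  rw [← h0, h1, one_mul]

theorem isInfiniteOfDimOne_coordinate : IsInfiniteOfDimOne (orbitsOfType 72 1 0) := by
  obtain ⟨ν, hν⟩ := exists_orderOf_eq_nine
  have hvec : ∀ a : ℂ, (fun i => (![0, 1, Polynomial.X] i : Polynomial ℂ).eval a) = ![0, 1, a] := by
    intro a
    ext i
    fin_cases i <;> simp
  refine isInfiniteOfDimOne_of_curve coordinateLine_injective
    (continuous_of_polynomial ![0, 1, Polynomial.X] (fun a => by
      rw [hvec]; exact coordinatePlane_ne_zero a) fun a => by simp only [hvec]) ?_ ?_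
  · intro O hO
    obtain ⟨L, rfl⟩ := orbitOf_surjective O
    rcases orbit_types hν L with ⟨-, h⟩ | ⟨-, h⟩ | ⟨h, -⟩ | ⟨h, -⟩ | ⟨h, -⟩ | ⟨h, -⟩ | ⟨h, -⟩ | ⟨h, -⟩
    on_goal 2 => exact h
    all_goals
      have := type_unique hO h
      norm_num at this
  · refine infinite_of_natCast fun n hn => coordinateLine_mem ?_ ?_
    · exact_mod_cast (by omega : n ≠ 0)
    · exact_mod_cast (Nat.one_lt_pow (by norm_num) (by omega) : 1 < n ^ 6).ne'

theorem isInfiniteOfDimOne_proper : IsInfiniteOfDimOne (orbitsOfType 108 0 1) := by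
  obtain ⟨ν, hν⟩ := exists_orderOf_eq_nine
  have hvec : ∀ a : ℂ, (fun i => (![Polynomial.X, 1, 1] i : Polynomial ℂ).eval a) = ![a, 1, 1] := by
    intro a
    ext i
    fin_cases i <;> simp
  refine isInfiniteOfDimOne_of_curve properLine_injective
    (continuous_of_polynomial ![Polynomial.X, 1, 1] (fun a => by
      rw [hvec]; exact properPlane_ne_zero a) fun a => by simp only [hvec]) ?_ ?_
  · intro O hO
    obtain ⟨L, rfl⟩ := orbitOf_surjective O
    rcases orbit_types hν L with ⟨-, h⟩ | ⟨h, -⟩ | ⟨-, h⟩ | ⟨h, -⟩ | ⟨h, -⟩ | ⟨h, -⟩ | ⟨h, -⟩ | ⟨h, -⟩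
    on_goal 3 => exact h
    all_goals
      have := type_unique hO h
      norm_num at this
  · refine infinite_of_natCast fun n hn => ?_
    have h27 : (27 : ℤ) ≤ (n : ℤ) ^ 3 := by
      have : (3 : ℤ) ≤ n := by exact_mod_cast hn
      calc (27 : ℤ) = 3 ^ 3 := by norm_num
        _ ≤ (n : ℤ) ^ 3 := by gcongr
    refine properLine_mem ?_ ?_ ?_ ?_
    · exact_mod_cast (by omega : n ≠ 0)
    · exact_mod_cast (by omega : (n : ℤ) ^ 3 ≠ 1)
    · exact_mod_cast (by omega : (n : ℤ) ^ 3 ≠ -8)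
    -- With `n ^ 3 ≥ 27`, the value `n ^ 3 * (n ^ 3 - 20)` exceeds 8.
    · have : (n : ℤ) ^ 6 - 20 * (n : ℤ) ^ 3 - 8 ≠ 0 := by nlinarith
      exact_mod_cast this

theorem encard_eq_one_of_forall {n r p : ℕ∞} {O : LineOrbit} (hO : O ∈ orbitsOfType n r p)
    (h : ∀ L, orbitOf L ∈ orbitsOfType n r p → orbitOf L = O) :
    (orbitsOfType n r p).encard = 1 := by
  rw [Set.encard_eq_one]
  refine ⟨O, Set.eq_singleton_iff_unique_mem.mpr ⟨hO, fun O' hO' => ?_⟩⟩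
  obtain ⟨L, rfl⟩ := orbitOf_surjective O'
  exact h L hO'

theorem encard_orbitsOfType_seventyTwo {ν : ℂ} (hν : orderOf ν = 9) :
    (orbitsOfType 72 0 0).encard = 1 := by
  refine encard_eq_one_of_forall (orderNine_mem hν) fun L hL => ?_
  rcases orbit_types hν L with ⟨-, h⟩ | ⟨h, -⟩ | ⟨h, -⟩ | ⟨h, -⟩ | ⟨h, -⟩ | ⟨h, -⟩ | ⟨h, -⟩ | ⟨-, h⟩
  on_goal 8 => exact h
  all_goals
    have := type_unique hL h
    norm_num at this

theorem encard_orbitsOfType_fiftyFour : (orbitsOfType 54 0 1).encard = 1 := by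
  obtain ⟨ν, hν⟩ := exists_orderOf_eq_nine
  refine encard_eq_one_of_forall (line_sqrt_eq ▸ one_add_mem sqrt_three_sq) fun L hL => ?_
  rcases orbit_types hν L with ⟨-, h⟩ | ⟨h, -⟩ | ⟨h, -⟩ | ⟨h, -⟩ | ⟨h, -⟩ | ⟨h, -⟩ | ⟨-, h⟩ | ⟨h, -⟩
  on_goal 7 => exact h
  all_goals
    have := type_unique hL h
    norm_num at this

theorem encard_orbitsOfType_thirtySix : (orbitsOfType 36 1 1).encard = 1 := by
  obtain ⟨ν, hν⟩ := exists_orderOf_eq_nine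
  refine encard_eq_one_of_forall coordinateLine_one_mem fun L hL => ?_
  rcases orbit_types hν L with ⟨-, h⟩ | ⟨h, -⟩ | ⟨h, -⟩ | ⟨h, -⟩ | ⟨h, -⟩ | ⟨-, h⟩ | ⟨h, -⟩ | ⟨h, -⟩
  on_goal 6 => exact h
  all_goals
    have := type_unique hL h
    norm_num at this

theorem encard_orbitsOfType_twelve : (orbitsOfType 12 2 3).encard = 1 := by
  obtain ⟨ν, hν⟩ := exists_orderOf_eq_nine
  refine encard_eq_one_of_forall vertexLine_mem fun L hL => ?_
  rcases orbit_types hν L with ⟨-, h⟩ | ⟨h, -⟩ | ⟨h, -⟩ | ⟨-, h⟩ | ⟨h, -⟩ | ⟨h, -⟩ | ⟨h, -⟩ | ⟨h, -⟩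
  on_goal 4 => exact h
  all_goals
    have := type_unique hL h
    norm_num at this

theorem encard_orbitsOfType_nine : (orbitsOfType 9 4 0).encard = 1 := by
  obtain ⟨ν, hν⟩ := exists_orderOf_eq_nine
  refine encard_eq_one_of_forall center_mem fun L hL => ?_
  rcases orbit_types hν L with ⟨-, h⟩ | ⟨h, -⟩ | ⟨h, -⟩ | ⟨h, -⟩ | ⟨-, h⟩ | ⟨h, -⟩ | ⟨h, -⟩ | ⟨h, -⟩
  on_goal 5 => exact h
  all_goals
    have := type_unique hL h
    norm_num at this

theorem numReflectionPlanes_eq_zero_iff {L : Line} : numReflectionPlanes L = 0 ↔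
    ∀ P, IsReflectionPlane P → ¬ L.submodule ≤ P := by
  rw [numReflectionPlanes, Set.encard_eq_zero, Set.eq_empty_iff_forall_notMem]
  simp only [Set.mem_ofPred_eq, not_and]

/-- The two excluded orbits are the only collisions: the small orbit of size 72 shares its size with
the row `72 1 0` and its incidences with the row `216 0 0`, and the orbit of size 54 shares its
incidences with the row `108 0 1`. The other six rows differ pairwise in size and in incidences. -/
theorem encard_orbit_eq_iff {ν : ℂ} (hν : orderOf ν = 9) {L L' : Line}
    (h₁ : orbitOf L ≠ orbitOf (line ν (ν ^ 2)))
    (h₂ : orbitOf L ≠ orbitOf (line ((1 + (Real.sqrt 3 : ℂ)) * ω ^ 2) ω))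
    (h₁' : orbitOf L' ≠ orbitOf (line ν (ν ^ 2)))
    (h₂' : orbitOf L' ≠ orbitOf (line ((1 + (Real.sqrt 3 : ℂ)) * ω ^ 2) ω)) :
    (MulAction.orbit G25 L).encard = (MulAction.orbit G25 L').encard ↔
      numReflectionPlanes L = numReflectionPlanes L' ∧ numProperPlanes L = numProperPlanes L' := by
  rcases orbit_types hν L with ⟨-, h⟩ | ⟨h, -⟩ | ⟨h, -⟩ | ⟨h, -⟩ | ⟨h, -⟩ | ⟨h, -⟩ | ⟨-, h⟩ | ⟨-, h⟩
  on_goal 7 => exact absurd h h₂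
  on_goal 7 => exact absurd h h₁
  all_goals
    obtain ⟨e1, e2, e3⟩ := mem_orbitsOfType.mp h
    rw [e1, e2, e3]
    rcases orbit_types hν L' with ⟨-, h'⟩ | ⟨h', -⟩ | ⟨h', -⟩ | ⟨h', -⟩ | ⟨h', -⟩ | ⟨h', -⟩ |
      ⟨-, h'⟩ | ⟨-, h'⟩
    on_goal 7 => exact absurd h' h₂'
    on_goal 7 => exact absurd h' h₁'
    all_goals
      obtain ⟨e1', e2', e3'⟩ := mem_orbitsOfType.mp h'
      norm_num [e1', e2', e3']

theorem setOf_encard_eq_seventyTwo {ν : ℂ} (hν : orderOf ν = 9) :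
    {O : LineOrbit | O.orbit.encard = 72 ∧
      ∀ L ∈ O.orbit, ∀ P, IsReflectionPlane P → ¬ L.submodule ≤ P} =
    {orbitOf (line ν (ν ^ 2))} := by
  simp only [← numReflectionPlanes_eq_zero_iff]
  refine Set.eq_singleton_iff_unique_mem.mpr ⟨?_, ?_⟩
  · exact ⟨(orderNine_mem hν).1, fun L hL => ((orderNine_mem hν).2 L hL).1⟩
  · rintro O ⟨hO, hr⟩
    obtain ⟨L, rfl⟩ := orbitOf_surjective O
    have hn : (MulAction.orbit G25 L).encard = 72 := hO
    have hr' := hr L (MulAction.mem_orbit_self L)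
    rcases orbit_types hν L with ⟨-, h⟩ | ⟨h, -⟩ | ⟨h, -⟩ | ⟨h, -⟩ | ⟨h, -⟩ | ⟨h, -⟩ | ⟨h, -⟩ |
      ⟨-, h⟩
    on_goal 8 => exact h
    all_goals
      obtain ⟨e1, e2, -⟩ := mem_orbitsOfType.mp h
      rw [e1] at hn
      rw [e2] at hr'
      have hcon := And.intro hn hr'
      norm_num at hcon

theorem setOf_encard_eq_fiftyFour : {O : LineOrbit | O.orbit.encard = 54} =
    {orbitOf (line ((1 + (Real.sqrt 3 : ℂ)) * ω ^ 2) ω)} := by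
  obtain ⟨ν, hν⟩ := exists_orderOf_eq_nine
  refine Set.eq_singleton_iff_unique_mem.mpr ⟨?_, fun O hO => ?_⟩
  · rw [line_sqrt_eq]
    exact (one_add_mem sqrt_three_sq).1
  · obtain ⟨L, rfl⟩ := orbitOf_surjective O
    have hn : (MulAction.orbit G25 L).encard = 54 := hO
    rcases orbit_types hν L with ⟨-, h⟩ | ⟨h, -⟩ | ⟨h, -⟩ | ⟨h, -⟩ | ⟨h, -⟩ | ⟨h, -⟩ | ⟨-, h⟩ |
      ⟨h, -⟩
    on_goal 7 => exact h
    all_goals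
      rw [(mem_orbitsOfType.mp h).1] at hn
      norm_num at hn

end Hessian

end

theorem mainTheorem4 :
    -- every orbit occurs in one of the eight rows of the table
    (∀ O : Hessian.LineOrbit,
      O ∈ Hessian.orbitsOfType 216 0 0 ∨ O ∈ Hessian.orbitsOfType 72 0 0 ∨
      O ∈ Hessian.orbitsOfType 108 0 1 ∨ O ∈ Hessian.orbitsOfType 54 0 1 ∨
      O ∈ Hessian.orbitsOfType 72 1 0 ∨ O ∈ Hessian.orbitsOfType 36 1 1 ∨
      O ∈ Hessian.orbitsOfType 12 2 3 ∨ O ∈ Hessian.orbitsOfType 9 4 0) ∧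
    -- the number of orbits in each row
    Hessian.IsGeneric (Hessian.orbitsOfType 216 0 0) ∧
    (Hessian.orbitsOfType 72 0 0).encard = 1 ∧
    Hessian.IsInfiniteOfDimOne (Hessian.orbitsOfType 108 0 1) ∧
    (Hessian.orbitsOfType 54 0 1).encard = 1 ∧
    Hessian.IsInfiniteOfDimOne (Hessian.orbitsOfType 72 1 0) ∧
    (Hessian.orbitsOfType 36 1 1).encard = 1 ∧
    (Hessian.orbitsOfType 12 2 3).encard = 1 ∧
    (Hessian.orbitsOfType 9 4 0).encard = 1 ∧
    -- the line `[ν : ν² : 1]` represents the only orbit of order 72 off the reflection planes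
    (∀ ν : ℂ, orderOf ν = 9 →
      {O : Hessian.LineOrbit | O.orbit.encard = 72 ∧
        ∀ L ∈ O.orbit, ∀ P, Hessian.IsReflectionPlane P → ¬ L.submodule ≤ P} =
      {Hessian.orbitOf (Hessian.line ν (ν ^ 2))}) ∧
    -- the line `[(1 + √3) ω² : ω : 1]` represents the only orbit of order 54
    {O : Hessian.LineOrbit | O.orbit.encard = 54} =
      {Hessian.orbitOf (Hessian.line ((1 + (Real.sqrt 3 : ℂ)) * Hessian.ω ^ 2) Hessian.ω)} ∧
    -- off these two orbits, the size of the orbit is characterized by the numbers of planes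
    (∀ ν : ℂ, orderOf ν = 9 → ∀ L L' : Hessian.Line,
      L ∉ MulAction.orbit Hessian.G25 (Hessian.line ν (ν ^ 2)) →
      L ∉ MulAction.orbit Hessian.G25
        (Hessian.line ((1 + (Real.sqrt 3 : ℂ)) * Hessian.ω ^ 2) Hessian.ω) →
      L' ∉ MulAction.orbit Hessian.G25 (Hessian.line ν (ν ^ 2)) →
      L' ∉ MulAction.orbit Hessian.G25
        (Hessian.line ((1 + (Real.sqrt 3 : ℂ)) * Hessian.ω ^ 2) Hessian.ω) →
      ((MulAction.orbit Hessian.G25 L).encard = (MulAction.orbit Hessian.G25 L').encard ↔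
        Hessian.numReflectionPlanes L = Hessian.numReflectionPlanes L' ∧
        Hessian.numProperPlanes L = Hessian.numProperPlanes L')) := by
  obtain ⟨μ, hμ⟩ := Hessian.exists_orderOf_eq_nine
  refine ⟨fun O => ?_, Hessian.isGeneric_orbitsOfType, Hessian.encard_orbitsOfType_seventyTwo hμ,
    Hessian.isInfiniteOfDimOne_proper, Hessian.encard_orbitsOfType_fiftyFour,
    Hessian.isInfiniteOfDimOne_coordinate, Hessian.encard_orbitsOfType_thirtySix,
    Hessian.encard_orbitsOfType_twelve, Hessian.encard_orbitsOfType_nine,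
    fun ν hν => Hessian.setOf_encard_eq_seventyTwo hν, Hessian.setOf_encard_eq_fiftyFour,
    fun ν hν L L' h₁ h₂ h₁' h₂' => ?_⟩
  · obtain ⟨L, rfl⟩ := Hessian.orbitOf_surjective O
    have := Hessian.orbit_types hμ L
    tauto
  · rw [← Hessian.orbitOf_eq_iff] at h₁ h₂ h₁' h₂'
    exact Hessian.encard_orbit_eq_iff hν h₁ h₂ h₁' h₂'
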